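/- **Conventions.** Words are finite words of positive integers. For $i\ge 1$ let $s_i=(i\;i{+}1)$, and let $S_+=\bigcup_n S_n$. A word $u_1\cdots u_k$ is *reduced* if no shorter word has the same product $s_{u_1}\cdots s_{u_k}$; it is then a reduced word of that permutation. A *compatible pair* $(a,i)$ consists of two words of the same length with $i$ weakly decreasing and $a_j<a_{j+1}$ whenever $i_j=i_{j+1}$; it is *bounded* if $i_j\le a_j$ for all $j$. A *decreasing tableau* (resp. *RSSYT*) is a filling of a partition diagram with positive integers that strictly decreases down columns and strictly (resp. weakly) decreases along rows. $\mathrm{word}(T)$ reads the columns from left to right, each from bottom to top; $T$ is *reduced* if $\mathrm{word}(T)$ is. Columns are identified with sets of integers. *Right key.* For a finite set $S$ and a letter $m$, let $S\star m=(S\setminus\{m'\})\cup\{m\}$ where $m'=\min\{x\in S: x\ge m\}$, and $S\star m=S\cup\{m\}$ if there is no such $m'$; extend to words by letting them act letter by letter from left to right. For a decreasing tableau $P$, $K_+(P)$ is the tableau with $j$-th column $\emptyset\star\mathrm{word}(P_{\ge j})$, where $P_{\ge j}$ is $P$ without its first $j-1$ columns. *Left key.* For columns $B$ and $A=\{a_1<\dots<a_m\}$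 let $B\triangleleft A=\{b_1<\dots<b_m\}$, where $b_1$ is the smallest element of $B$ with $b_1\ge a_1$, and $b_t$ is the smallest element of $B$ with $b_t\ge a_t$ and $b_t>b_{t-1}$. For a RSSYT $Q$ with columns $C_1,C_2,\dots$, $K_-(Q)$ is the tableau with $k$-th column $C_1\triangleleft(C_2\triangleleft(\cdots\triangleleft C_k))$. Write $K_+(P)\ge K_-(Q)$ if the two have the same shape and the inequality holds entrywise. *Right nil key.* Nilplactic (Coxeter–Knuth) equivalence of words is generated by $u\,bac\,v\sim u\,bca\,v$ and $u\,acb\,v\sim u\,cab\,v$ for $a<b<c$, and $u\,a(a{+}1)a\,v\sim u\,(a{+}1)a(a{+}1)\,v$. A *frank word* for a reduced decreasing tableau $P$ is a word nilplactic equivalent to $\mathrm{word}(P)$, together with a factorization into strictly increasing words whose lengths are a rearrangement of the column lengths of $P$. A *right nil key* of $P$ is a tableau of the shape of $P$ each of whose columns is, as a set, the last factor of some frank word for $P$ whose last factor has the length of that column. *Hecke column insertion* of $x$ into a decreasing tableau $T$: insert $x$ into the first column. When a letter $x$ is inserted into a column with an entry smaller than $x$, let $y$ be the largest such entry; replace $y$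 by $x$ if the result is a decreasing tableau, otherwise leave the column unchanged; in both cases insert $y$ into the next column. If the column has no entry smaller than $x$, append $x$ at its bottom if the result is a decreasing tableau, and the insertion ends at the new box; otherwise leave the column unchanged, and the insertion ends at the rightmost box of the row containing the bottom entry of the column. $\mathrm{Insert}(a,i)=(P,Q)$ inserts $a_1,a_2,\dots$ successively into the empty tableau, giving $P$; the letter $i_j$ is placed in the box of $Q$ at which the insertion of $a_j$ ends (a new box, or added to the set already there), so that $Q$ is set-valued. *Edelman–Greene column insertion* of $x$: in a column with no entry smaller than $x$, append $x$ at the bottom and stop; otherwise let $y$ be the largest entry smaller than $x$; if $y=x-1$ and $x$ is in the column, leave the column unchanged, else replace $y$ by $x$; in both cases insert $y$ into the next column. A pair $(a,i)$ is sent to $(P,Q)$, where $a_1,a_2,\dots$ are inserted successively to give $P$ and $i_j$ is placed in the new box of $Q$ created by $a_j$. *Polynomials.* Let $\partial_i f=(f-s_if)/(x_i-x_{i+1})$. Schubert polynomials are given by $\mathfrak S_{w_0^{(n)}}=x_1^{n-1}x_2^{n-2}\cdots x_n^{0}$, with $w_0^{(n)}$ the longest element of $S_n$, and $\mathfrak S_w=\partial_i\mathfrak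 S_{ws_i}$ if $w(i)<w(i+1)$. Demazure characters are given by $\kappa_\alpha=x^\alpha$ if $\alpha$ is a partition and $\kappa_\alpha=\partial_i(x_i\kappa_{s_i\alpha})$ if $\alpha_i<\alpha_{i+1}$. The weight $\mathrm{wt}(T)$ is the composition whose $i$-th part is the number of entries $i$ in $T$. **Theorem.** Let $\mathcal C^b(0)$ be the set of bounded compatible pairs $(a,i)$ with $a$ reduced, and $\mathcal T^b(0)$ the set of pairs $(P,Q)$ of tableaux of the same partition shape with $P$ a reduced decreasing tableau, $Q$ a RSSYT, and $K_+(P)\ge K_-(Q)$. 1. Every reduced decreasing tableau $P$ has exactly one right nil key, and it is $K_+(P)$. 2. $\mathrm{Insert}$ restricts to a bijection $\mathcal C^b(0)\to\mathcal T^b(0)$, where a RSSYT is regarded as a set-valued tableau with one-element entries. For every compatible pair $(a,i)$ with $a$ reduced, $\mathrm{Insert}(a,i)$ is computed by Edelman–Greene column insertion. In particular Edelman–Greene column insertion is a bijection $\mathcal C^b(0)\to\mathcal T^b(0)$. 3. For every $w\in S_+$, $$\mathfrak S_w=\sum_{P}\kappa_{\mathrm{wt}(K_+(P))},$$ where $P$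 runs over the finitely many decreasing tableaux such that $\mathrm{word}(P)$ is a reduced word of $w$. -/

import Mathlib

namespace NilKey

/-! ## Words, permutations, compatible pairs -/

/-- The product `s_{u_1} s_{u_2} ⋯ s_{u_k}` of the simple transpositions `s_i = (i, i+1)`. -/
def wordPerm (u : List ℕ) : Equiv.Perm ℕ :=
  (u.map fun i => Equiv.swap i (i + 1)).prod

/-- `u` is a reduced word: a word of positive letters, of minimal length among all words of
positive letters with the same product of simple transpositions. -/
def IsReducedWord (u : List ℕ) : Prop :=
  (∀ i ∈ u, 0 < i) ∧
    ∀ v : List ℕ, (∀ i ∈ v, 0 < i) → wordPerm v = wordPerm u → u.length ≤ v.length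

/-- `w` belongs to the symmetric group on `{1, …, n}`, embedded in the permutations of `ℕ`. -/
def InSym (n : ℕ) (w : Equiv.Perm ℕ) : Prop :=
  ∀ i, (i = 0 ∨ n < i) → w i = i

/-- The group `S_+ = ⋃ₙ S_n` of finitely supported permutations of the positive integers. -/
def InSymPlus (w : Equiv.Perm ℕ) : Prop := ∃ n, InSym n w

/-- Compatible pairs `(a, i)` of words. -/
structure IsCompatible (p : List ℕ × List ℕ) : Prop where
  length_eq : p.1.length = p.2.length
  pos_fst : ∀ x ∈ p.1, 0 < x
  pos_snd : ∀ x ∈ p.2, 0 < x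
  weakly_decreasing : p.2.Pairwise (· ≥ ·)
  strict_of_eq : ∀ j, j + 1 < p.1.length →
    p.2.getD j 0 = p.2.getD (j + 1) 0 → p.1.getD j 0 < p.1.getD (j + 1) 0

/-- The pair `(a, i)` is bounded: `i_j ≤ a_j` for all `j`. -/
def IsBounded (p : List ℕ × List ℕ) : Prop := List.Forall₂ (· ≤ ·) p.2 p.1

/-! ## Tableaux -/

/-- A filling of a Young diagram, given as the list of its columns from left to right, each column
being listed from top to bottom. -/
abbrev Tableau := List (List ℕ)

/-- Reverse semistandard tableaux of partition shape, with positive entries: strictly decreasing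
down columns, weakly decreasing along rows. -/
def IsRSSYT (T : Tableau) : Prop :=
  (∀ C ∈ T, C ≠ [] ∧ (∀ x ∈ C, 0 < x) ∧ C.Pairwise (· > ·)) ∧
    T.IsChain fun C D => D.length ≤ C.length ∧ ∀ r < D.length, D.getD r 0 ≤ C.getD r 0

/-- Decreasing tableaux of partition shape, with positive entries: strictly decreasing
down columns and along rows. -/
def IsDecreasing (T : Tableau) : Prop :=
  (∀ C ∈ T, C ≠ [] ∧ (∀ x ∈ C, 0 < x) ∧ C.Pairwise (· > ·)) ∧
    T.IsChain fun C D => D.length ≤ C.length ∧ ∀ r < D.length, D.getD r 0 < C.getD r 0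

instance (T : Tableau) : Decidable (IsRSSYT T) := by
  unfold IsRSSYT; infer_instance

instance (T : Tableau) : Decidable (IsDecreasing T) := by
  unfold IsDecreasing; infer_instance

/-- The shape of a tableau, recorded by its column lengths (the conjugate partition). -/
def colLengths (T : Tableau) : List ℕ := T.map List.length

/-- The column reading word: columns from left to right, each read from bottom to top. -/
def word (T : Tableau) : List ℕ := (T.map List.reverse).flatten

/-- The weight of a tableau: the composition whose `i`-th part is the number of entries `i`. -/
noncomputable def wt (T : Tableau) : ℕ →₀ ℕ :=
  Multiset.toFinsupp (T.flatten : Multiset ℕ)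

/-- A decreasing tableau is reduced if its column reading word is. -/
def IsReducedDecreasing (P : Tableau) : Prop := IsDecreasing P ∧ IsReducedWord (word P)

/-- Equality of shapes together with entrywise comparison; on key tableaux this is the Bruhat
order on compositions. -/
def KeyLE (S T : Tableau) : Prop := List.Forall₂ (List.Forall₂ (· ≤ ·)) S T

/-! ## The right key of a decreasing tableau and the left key of a RSSYT -/

/-- `S ⋆ m`: replace the smallest element of `S` that is `≥ m` by `m`, or adjoin `m` if there is
no such element. -/
def starAct (S : Finset ℕ) (m : ℕ) : Finset ℕ :=
  if h : (S.filter (m ≤ ·)).Nonempty then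
    insert m (S.erase ((S.filter (m ≤ ·)).min' h))
  else insert m S

/-- `S ⋆ w` for a word `w`, acting letter by letter from left to right. -/
def starWord (S : Finset ℕ) (w : List ℕ) : Finset ℕ := w.foldl starAct S

/-- The right key `K_+(P)`: its `j`-th column is `∅ ⋆ word(P_{≥ j})`, where `P_{≥ j}` is `P` with
the first `j - 1` columns removed (columns are numbered from `0` in the code). -/
def rightKey (P : Tableau) : Tableau :=
  (List.range P.length).map fun j => (starWord ∅ (word (P.drop j))).sort (· ≥ ·)

/-- `B ◁ A` for columns listed in increasing order: going through `a_1 < a_2 < ⋯` in `A`,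
choose the smallest `b_1 ≥ a_1` in `B`, then the smallest `b_2 ≥ a_2` in `B` with `b_2 > b_1`, and
so on. -/
def pick : List ℕ → List ℕ → List ℕ
  | _, [] => []
  | B, a :: A =>
    match B.dropWhile (· < a) with
    | [] => []
    | b :: B₁ => b :: pick B₁ A

/-- `C_1 ◁ (C_2 ◁ (⋯ ◁ C_k))` for columns listed in increasing order. -/
def pickAll : List (List ℕ) → List ℕ
  | [] => []
  | [C] => C
  | C :: D :: R => pick C (pickAll (D :: R))

/-- The left key `K_-(Q)`: its `k`-th column is `C_1 ◁ ⋯ ◁ C_k`, where `C_1, C_2, …` are the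
columns of `Q`. -/
def leftKey (Q : Tableau) : Tableau :=
  (List.range Q.length).map fun k =>
    (pickAll ((Q.take (k + 1)).map List.reverse)).reverse

/-! ## The right nil key -/

/-- Elementary nilplactic (Coxeter-Knuth) relations. -/
inductive NilplacticStep : List ℕ → List ℕ → Prop
  | left_witness (u v : List ℕ) (a b c : ℕ) (hab : a < b) (hbc : b < c) :
      NilplacticStep (u ++ [b, a, c] ++ v) (u ++ [b, c, a] ++ v)
  | right_witness (u v : List ℕ) (a b c : ℕ) (hab : a < b) (hbc : b < c) :
      NilplacticStep (u ++ [a, c, b] ++ v) (u ++ [c, a, b] ++ v)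
  | braid (u v : List ℕ) (a : ℕ) :
      NilplacticStep (u ++ [a, a + 1, a] ++ v) (u ++ [a + 1, a, a + 1] ++ v)

/-- Nilplactic (Coxeter-Knuth) equivalence of words. -/
def Nilplactic : List ℕ → List ℕ → Prop := Relation.EqvGen NilplacticStep

/-- `F`, a list of columns (listed from top to bottom, strictly decreasing), is a frank word for
`P`: the product of the reading words of the columns is nilplactic equivalent to the word of `P`,
and the column lengths are a rearrangement of the column lengths of `P`. -/
def IsFrank (P F : Tableau) : Prop :=
  (∀ C ∈ F, C.Pairwise (· > ·)) ∧ (colLengths F).Perm (colLengths P) ∧ Nilplactic (word F) (word P)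

/-- `K` is a right nil key of `P`: it has the shape of `P`, and each column `D` of `K` is the
rightmost column of some frank word for `P` whose rightmost column has the length of the
corresponding column `C` of `P`. -/
def IsRightNilKey (P K : Tableau) : Prop :=
  List.Forall₂ (fun C D => D.length = C.length ∧ ∃ F, IsFrank P (F ++ [D])) P K

/-! ## Hecke column insertion and `Insert` -/

/-- Replace the entry `y` of a column by `x`. -/
def replaceEntry (y x : ℕ) (C : List ℕ) : List ℕ := C.map fun z => if z = y then x else z

/-- Column Hecke insertion of `x` into the columns `R`, the columns to the left being `L`.
The output is the resulting tableau, the position (row, column), numbered from `0`, of the box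
where the insertion ends, and whether a new box was created.  As columns are decreasing,
`C.find? (· < x)` is the largest entry of `C` that is smaller than `x`.  (A letter reaching an empty
column always opens a new column: all letters bumped there are smaller than the top entry of the
column before.) -/
def heckeAux (L : Tableau) (x : ℕ) : Tableau → Tableau × (ℕ × ℕ) × Bool
  | [] => (L ++ [[x]], (0, L.length), true)
  | C :: R =>
    match C.find? (· < x) with
    | none =>
      if IsDecreasing (L ++ (C ++ [x]) :: R) then
        (L ++ (C ++ [x]) :: R, (C.length, L.length), true)
      else
        (L ++ C :: R,
          (C.length - 1,
            ((L ++ C :: R).filter fun D => C.length - 1 < D.length).length - 1), false)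
    | some y =>
      if IsDecreasing (L ++ replaceEntry y x C :: R) then
        heckeAux (L ++ [replaceEntry y x C]) y R
      else heckeAux (L ++ [C]) y R

/-- Column Hecke insertion of `x` into `T`. -/
def heckeInsert (x : ℕ) (T : Tableau) : Tableau × (ℕ × ℕ) × Bool := heckeAux [] x T

/-- Set-valued fillings, as lists of columns. -/
abbrev SVTableau := List (List (Finset ℕ))

/-- Regard an ordinary filling as a set-valued one with singleton entries. -/
def toSV (Q : Tableau) : SVTableau := Q.map (List.map fun y => {y})

/-- Append an entry at the bottom of column `c` (a new column if `c` is the number of columns). -/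
def appendBox {α : Type} (Q : List (List α)) (c : ℕ) (y : α) : List (List α) :=
  if c < Q.length then Q.modify c (· ++ [y]) else Q ++ [[y]]

/-- One step of `Insert`: insert the letter `xy.1` and record `xy.2`. -/
def insertStep (PQ : Tableau × SVTableau) (xy : ℕ × ℕ) : Tableau × SVTableau :=
  match heckeInsert xy.1 PQ.1 with
  | (P, (_, c), true) => (P, appendBox PQ.2 c {xy.2})
  | (P, (r, c), false) => (P, PQ.2.modify c fun D => D.modify r fun S => insert xy.2 S)

/-- The Hecke RSK map `Insert`. -/
def heckeRSK (p : List ℕ × List ℕ) : Tableau × SVTableau :=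
  (p.1.zip p.2).foldl insertStep ([], [])

/-! ## Edelman-Greene column insertion -/

/-- Edelman-Greene column insertion of `x` into a decreasing tableau.  In a column without entries
smaller than `x`, the letter `x` is appended at the bottom.  Otherwise let `y` be the largest entry
smaller than `x`: if `y = x - 1` and `x` is in the column, the column is unchanged, else `y` is
replaced by `x`; in both cases `y` is inserted into the next column.
The second output is the index of the column that receives a new box. -/
def egColumnInsert (x : ℕ) : Tableau → Tableau × ℕ
  | [] => ([[x]], 0)
  | C :: R =>
    match C.find? (· < x) with
    | none => ((C ++ [x]) :: R, 0)
    | some y =>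
      ((if x = y + 1 ∧ x ∈ C then C else replaceEntry y x C) :: (egColumnInsert y R).1,
        (egColumnInsert y R).2 + 1)

/-- One step of the Edelman-Greene correspondence. -/
def egStep (PQ : Tableau × Tableau) (xy : ℕ × ℕ) : Tableau × Tableau :=
  ((egColumnInsert xy.1 PQ.1).1, appendBox PQ.2 (egColumnInsert xy.1 PQ.1).2 xy.2)

/-- The Edelman-Greene correspondence: `a` is inserted letter by letter, `i` is recorded. -/
def egRSK (p : List ℕ × List ℕ) : Tableau × Tableau :=
  (p.1.zip p.2).foldl egStep ([], [])

/-- Bounded compatible pairs `(a, i)` with `a` reduced. -/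
def boundedReducedPairs : Set (List ℕ × List ℕ) :=
  {p | IsCompatible p ∧ IsBounded p ∧ IsReducedWord p.1}

/-- Pairs `(P, Q)` of tableaux of the same shape with `P` reduced decreasing, `Q` a RSSYT and
`K_+(P) ≥ K_-(Q)`. -/
def boundedReducedTableaux : Set (Tableau × Tableau) :=
  {t | colLengths t.1 = colLengths t.2 ∧ IsReducedDecreasing t.1 ∧ IsRSSYT t.2 ∧
    KeyLE (leftKey t.2) (rightKey t.1)}

/-! ## Schubert polynomials and Demazure characters

The variable `x_i` is `MvPolynomial.X i` with `i ≥ 1`. -/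

open MvPolynomial

theorem dvd_sub_rename_swap (i j : ℕ) (f : MvPolynomial ℕ ℤ) :
    (X i - X j : MvPolynomial ℕ ℤ) ∣ f - rename (Equiv.swap i j) f := by
  induction f using MvPolynomial.induction_on with
  | C a => simp
  | add p q hp hq =>
    have h := dvd_add hp hq
    rw [map_add]
    convert h using 1
    ring
  | mul_X p k hp =>
    have hk : (X i - X j : MvPolynomial ℕ ℤ) ∣ X k - X (Equiv.swap i j k) := by
      rcases eq_or_ne k i with rfl | hki
      · simp
      · rcases eq_or_ne k j with rfl | hkj
        · rw [Equiv.swap_apply_right]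
          exact ⟨-1, by ring⟩
        · simp [Equiv.swap_apply_of_ne_of_ne hki hkj]
    have h := dvd_add (hp.mul_right (X k)) (hk.mul_left (rename (Equiv.swap i j) p))
    rw [map_mul, rename_X]
    convert h using 1
    ring

/-- The divided difference `∂_i f = (f - s_i f) / (x_i - x_{i+1})`: the polynomial `g` with
`f - s_i f = (x_i - x_{i+1}) g`. -/
noncomputable def divDiff (i : ℕ) (f : MvPolynomial ℕ ℤ) : MvPolynomial ℕ ℤ :=
  Classical.choose (dvd_sub_rename_swap i (i + 1) f)

/-- The long element of `S_n`. -/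
def longPerm (n : ℕ) : Equiv.Perm ℕ :=
  Function.Involutive.toPerm (fun i => if 1 ≤ i ∧ i ≤ n then n + 1 - i else i) (by
    intro i
    by_cases h : 1 ≤ i ∧ i ≤ n
    · have h₁ : 1 ≤ n + 1 - i ∧ n + 1 - i ≤ n := by omega
      simp only [h, h₁, and_self, if_true]
      omega
    · simp only [h, if_false])

/-- The recursion defining Schubert polynomials: `𝔖_{w_0^{(n)}} = x_1^{n-1} x_2^{n-2} ⋯ x_n^0`, and
`𝔖_w = ∂_i 𝔖_{w s_i}` if `w s_i > w`, that is, `w(i) < w(i+1)`. -/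
inductive IsSchubert : Equiv.Perm ℕ → MvPolynomial ℕ ℤ → Prop
  | long (n : ℕ) : IsSchubert (longPerm n) (∏ i ∈ Finset.Icc 1 n, X i ^ (n - i))
  | step (w : Equiv.Perm ℕ) (i : ℕ) (f : MvPolynomial ℕ ℤ) (hi : 1 ≤ i) (hw : w i < w (i + 1))
      (h : IsSchubert (w * Equiv.swap i (i + 1)) f) : IsSchubert w (divDiff i f)

/-- The recursion defining Demazure characters: `κ_α = x^α` if `α` is a partition, and
`κ_α = ∂_i (x_i κ_{s_i α})` if `α_i < α_{i+1}`. -/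
inductive IsDemazure : (ℕ →₀ ℕ) → MvPolynomial ℕ ℤ → Prop
  | partition (α : ℕ →₀ ℕ) (h : ∀ i, 1 ≤ i → α (i + 1) ≤ α i) : IsDemazure α (monomial α 1)
  | step (α : ℕ →₀ ℕ) (i : ℕ) (f : MvPolynomial ℕ ℤ) (hi : 1 ≤ i) (hα : α i < α (i + 1))
      (h : IsDemazure (Finsupp.equivMapDomain (Equiv.swap i (i + 1)) α) f) :
      IsDemazure α (divDiff i (X i * f))

theorem sum_swap_lt (g : ℕ → ℕ) (i N : ℕ) (hi : i + 1 < N) (hg : g i < g (i + 1)) :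
    ∑ k ∈ Finset.range N, k * g (Equiv.swap i (i + 1) k) < ∑ k ∈ Finset.range N, k * g k := by
  have h₁ : i ∈ Finset.range N := Finset.mem_range.2 (by omega)
  have h₂ : i + 1 ∈ (Finset.range N).erase i := by simp [hi]
  rw [← Finset.add_sum_erase _ _ h₁, ← Finset.add_sum_erase _ _ h₂,
    ← Finset.add_sum_erase _ (fun k => k * g k) h₁,
    ← Finset.add_sum_erase _ (fun k => k * g k) h₂]
  have h₃ : ∑ k ∈ ((Finset.range N).erase i).erase (i + 1), k * g (Equiv.swap i (i + 1) k) =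
      ∑ k ∈ ((Finset.range N).erase i).erase (i + 1), k * g k := by
    refine Finset.sum_congr rfl fun k hk => ?_
    simp only [Finset.mem_erase] at hk
    rw [Equiv.swap_apply_of_ne_of_ne hk.2.1 hk.1]
  rw [h₃, Equiv.swap_apply_left, Equiv.swap_apply_right]
  nlinarith

theorem exists_isDemazure (α : ℕ →₀ ℕ) : ∃ f, IsDemazure α f := by
  obtain ⟨N, hN⟩ : ∃ N, ∀ k, α k ≠ 0 → k < N :=
    ⟨α.support.sup id + 1, fun k hk =>
      Nat.lt_succ_of_le (Finset.le_sup (f := id) (Finsupp.mem_support_iff.2 hk))⟩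
  induction hm : ∑ k ∈ Finset.range N, k * α k using Nat.strong_induction_on generalizing α with
  | _ m ih =>
    by_cases h : ∀ i, 1 ≤ i → α (i + 1) ≤ α i
    · exact ⟨_, .partition α h⟩
    · push Not at h
      obtain ⟨i, hi, hα⟩ := h
      have hiN : i + 1 < N := hN _ (by omega)
      obtain ⟨f, hf⟩ := ih (∑ k ∈ Finset.range N,
          k * Finsupp.equivMapDomain (Equiv.swap i (i + 1)) α k)
        (by
          rw [← hm]
          simpa [Finsupp.equivMapDomain_apply] using sum_swap_lt α i N hiN hα)
        (Finsupp.equivMapDomain (Equiv.swap i (i + 1)) α)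
        (by
          intro k hk
          rw [Finsupp.equivMapDomain_apply, Equiv.symm_swap] at hk
          have hk₂ := hN _ hk
          rw [Equiv.swap_apply_def] at hk₂
          split_ifs at hk₂ <;> omega) rfl
      exact ⟨_, .step α i f hi hα hf⟩

theorem eq_longPerm (n : ℕ) (w : Equiv.Perm ℕ) (hw : InSym n w)
    (h : ∀ i, 1 ≤ i → i < n → w (i + 1) ≤ w i) : w = longPerm n := by
  have hb : ∀ i, 1 ≤ i → i ≤ n → 1 ≤ w i ∧ w i ≤ n := by
    intro i h₁ h₂
    constructor
    · by_contra hc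
      have h₀ : w i = w 0 := by rw [hw 0 (Or.inl rfl)]; omega
      have := w.injective h₀
      omega
    · by_contra hc
      have h₀ : w i = w (w i) := (hw (w i) (Or.inr (by omega))).symm
      have := w.injective h₀
      omega
  have hs : ∀ i, 1 ≤ i → i < n → w (i + 1) < w i := by
    intro i h₁ h₂
    refine lt_of_le_of_ne (h i h₁ h₂) fun he => ?_
    have := w.injective he
    omega
  have hu : ∀ k, k < n → w (k + 1) ≤ n - k := by
    intro k
    induction k with
    | zero => intro hk; exact (hb 1 le_rfl hk).2
    | succ k ih =>
      intro hk
      have h₁ := ih (by omega)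
      have h₂ := hs (k + 1) (by omega) hk
      omega
  have hl : ∀ k, k < n → k + 1 ≤ w (n - k) := by
    intro k
    induction k with
    | zero => intro hk; exact (hb n hk le_rfl).1
    | succ k ih =>
      intro hk
      have h₁ := ih (by omega)
      have h₂ := hs (n - (k + 1)) (by omega) (by omega)
      rw [show n - (k + 1) + 1 = n - k by omega] at h₂
      omega
  ext i
  change w i = if 1 ≤ i ∧ i ≤ n then n + 1 - i else i
  split_ifs with hi
  · have h₁ := hu (i - 1) (by omega)
    have h₂ := hl (n - i) (by omega)
    rw [show i - 1 + 1 = i by omega] at h₁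
    rw [show n - (n - i) = i by omega] at h₂
    omega
  · exact hw i (by omega)

theorem exists_isSchubert (w : Equiv.Perm ℕ) (hw : InSymPlus w) : ∃ f, IsSchubert w f := by
  obtain ⟨n, hn⟩ := hw
  induction hm : ∑ k ∈ Finset.range (n + 1), k * w k using Nat.strong_induction_on
    generalizing w with
  | _ m ih =>
    by_cases h : ∀ i, 1 ≤ i → i < n → w (i + 1) ≤ w i
    · rw [eq_longPerm n w hn h]
      exact ⟨_, .long n⟩
    · push Not at h
      obtain ⟨i, hi, hin, hwi⟩ := h
      obtain ⟨f, hf⟩ := ih (∑ k ∈ Finset.range (n + 1), k * (w * Equiv.swap i (i + 1)) k)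
        (by
          rw [← hm]
          exact sum_swap_lt w i (n + 1) (by omega) hwi)
        (w * Equiv.swap i (i + 1))
        (by
          intro k hk
          rw [Equiv.Perm.mul_apply, Equiv.swap_apply_of_ne_of_ne (by omega) (by omega)]
          exact hn k hk) rfl
      exact ⟨_, .step w i f hi hwi hf⟩

/-- The Schubert polynomial of `w ∈ S_+`. -/
noncomputable def schubert (w : Equiv.Perm ℕ) (hw : InSymPlus w) : MvPolynomial ℕ ℤ :=
  (exists_isSchubert w hw).choose

/-- The Demazure character (key polynomial) of the composition `α`. -/
noncomputable def demazure (α : ℕ →₀ ℕ) : MvPolynomial ℕ ℤ := (exists_isDemazure α).choose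

/-- The reduced decreasing tableaux whose word is a reduced word of `w`. -/
def reducedTableaux (w : Equiv.Perm ℕ) : Set Tableau :=
  {P | IsReducedDecreasing P ∧ wordPerm (word P) = w}

end NilKey

open NilKey

namespace NilKey

/-! ## Reduced words -/

/-! Read backwards, a compatible pair is a reduced word cut into decreasing factors with increasing
indices (`IsFactorization`), and everything is proved in this form.

Insertion. When the word is reduced, only three things can happen to a column (`ColStep`); any other
configuration would contain two equal letters separated by letters that commute with them. Each of
the three is a chain of nilplactic relations and can be undone. Comparing the paths of successive
letters shows that the new box of `Q` is always the last one holding the minimal entry. Hence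
factorizations correspond bijectively to pairs of a reduced decreasing `P` and a RSSYT `Q` of the
same shape (`factRSK_injective`, `factRSK_surjective`). The test in Hecke insertion has the same
outcome (`EGIns.heckeAux_eq`).

Bounds. Columns of keys are described by the numbers of their entries below each `v`. The star
action is invariant under nilplactic equivalence (`Nilplactic.starWord_eq`), so inserting a letter
adds exactly one element `z` to exactly one column of the right key, and below `z` that column has
nothing that the next one lacks (`EGIns.exists_keyset`). The counts of the left key obey a one-step
recursion (`countLT_pick`). If the pair is bounded, recording which index accompanies which new key
element gives injections that prove the inequality of keys; conversely the inequality survives the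
removal of the last letter and forces the bound for that letter (`bounded_iff_keyBound`).

Nil key. Moving a column of `P` to the right past the later ones gives a frank word ending in the
key column (`exists_rotate`). Conversely, the insertion tableau is a nilplactic invariant, so a
frank word inserts to `P`. Inserted factor by factor, it must keep the sum of the row indices of the
boxes at its minimum, and this rigidity preserves the last factor as a key column
(`insertWord_factor`).

Schubert polynomials. In the nilCoxeter algebra a product of commuting blocks satisfies the divided
difference recursion (`nilBlock_exchange`), and its coefficients are the sums over bounded
factorizations. On the other side, a Demazure character is the sum over all sequences of columns
whose left key dominates the given key; this follows by cutting these sequences into `i`-strings,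
each of which meets a Demazure set in nothing, in its head, or entirely (`divDiff_sum_dominating`).
The bijection then matches the two sums. -/

theorem wordPerm_nil : wordPerm [] = 1 := rfl

theorem wordPerm_cons (x : ℕ) (u : List ℕ) :
    wordPerm (x :: u) = Equiv.swap x (x + 1) * wordPerm u := by
  simp [wordPerm]

theorem wordPerm_append (u v : List ℕ) : wordPerm (u ++ v) = wordPerm u * wordPerm v := by
  simp [wordPerm]

theorem wordPerm_singleton (x : ℕ) : wordPerm [x] = Equiv.swap x (x + 1) := by
  simp [wordPerm]

theorem wordPerm_reverse (u : List ℕ) : wordPerm u.reverse = (wordPerm u)⁻¹ := by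
  induction u with
  | nil => simp [wordPerm]
  | cons x u ih =>
    rw [List.reverse_cons, wordPerm_append, ih, wordPerm_singleton, wordPerm_cons, mul_inv_rev,
      Equiv.swap_inv]

/-- The exchange condition. Either the descent is already there without the first letter `x`, or `x`
creates it; then `s_x` times the rest equals the rest times `s_i`, and `x` can be dropped. -/
theorem exists_shorter_of_descent (u : List ℕ) (hu : ∀ x ∈ u, 0 < x) (i : ℕ)
    (h : wordPerm u (i + 1) < wordPerm u i) :
    ∃ v : List ℕ, v.length + 1 = u.length ∧ (∀ x ∈ v, 0 < x) ∧
      wordPerm v = wordPerm u * Equiv.swap i (i + 1) := by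
  induction u with
  | nil => simp [wordPerm] at h
  | cons x u ih =>
    by_cases h' : wordPerm u (i + 1) < wordPerm u i
    · obtain ⟨v, hv, hpos, hw⟩ := ih (fun y hy => hu y (List.mem_cons_of_mem _ hy)) h'
      refine ⟨x :: v, by simp [hv], ?_, ?_⟩
      · intro y hy
        rcases List.mem_cons.1 hy with rfl | hy
        · exact hu _ List.mem_cons_self
        · exact hpos y hy
      · rw [wordPerm_cons, wordPerm_cons, hw, mul_assoc]
    · refine ⟨u, by simp, fun y hy => hu y (List.mem_cons_of_mem _ hy), ?_⟩
      have hne : wordPerm u i ≠ wordPerm u (i + 1) := fun he => by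
        have := (wordPerm u).injective he
        omega
      rw [wordPerm_cons, Equiv.Perm.mul_apply, Equiv.Perm.mul_apply] at h
      have h₁ : wordPerm u i = x ∧ wordPerm u (i + 1) = x + 1 := by
        rw [Equiv.swap_apply_def, Equiv.swap_apply_def] at h
        split_ifs at h <;> omega
      have h₂ : Equiv.swap x (x + 1) * wordPerm u = wordPerm u * Equiv.swap i (i + 1) := by
        rw [← h₁.1, ← h₁.2.trans (by rw [h₁.1] : x + 1 = wordPerm u i + 1)]
        exact (Equiv.mul_swap_eq_swap_mul (wordPerm u) i (i + 1)).symm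
      rw [wordPerm_cons, h₂, mul_assoc, Equiv.swap_mul_self, mul_one]

theorem IsReducedWord.reverse {u : List ℕ} (h : IsReducedWord u) : IsReducedWord u.reverse := by
  refine ⟨fun i hi => h.1 i (List.mem_reverse.1 hi), fun v hv hw => ?_⟩
  have := h.2 v.reverse (fun i hi => hv i (List.mem_reverse.1 hi))
    (by rw [wordPerm_reverse, hw, wordPerm_reverse, inv_inv])
  simpa using this

theorem isReducedWord_nil : IsReducedWord [] := ⟨by simp, by simp⟩

theorem IsReducedWord.right {u v : List ℕ} (h : IsReducedWord (u ++ v)) : IsReducedWord v := by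
  refine ⟨fun i hi => h.1 i (List.mem_append_right _ hi), fun v' hv' hw => ?_⟩
  have := h.2 (u ++ v') (fun i hi => by
    rcases List.mem_append.1 hi with hi | hi
    · exact h.1 i (List.mem_append_left _ hi)
    · exact hv' i hi) (by rw [wordPerm_append, hw, wordPerm_append])
  simpa using this

theorem IsReducedWord.left {u v : List ℕ} (h : IsReducedWord (u ++ v)) : IsReducedWord u := by
  have := h.reverse
  rw [List.reverse_append] at this
  simpa using this.right.reverse

theorem IsReducedWord.tail {x : ℕ} {v : List ℕ} (h : IsReducedWord (x :: v)) : IsReducedWord v :=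
  IsReducedWord.right (u := [x]) h

/-- By the exchange condition a letter lengthens a reduced word exactly at an ascent. This tests
reducedness one letter at a time, without inversion numbers. -/
theorem isReducedWord_concat {u : List ℕ} {i : ℕ} :
    IsReducedWord (u ++ [i]) ↔
      IsReducedWord u ∧ 0 < i ∧ wordPerm u i < wordPerm u (i + 1) := by
  constructor
  · intro h
    refine ⟨h.left, h.1 i (by simp), ?_⟩
    by_contra hc
    have hne : wordPerm u i ≠ wordPerm u (i + 1) := fun he => by
      have := (wordPerm u).injective he
      omega
    obtain ⟨v, hv, hpos, hw⟩ := exists_shorter_of_descent u h.left.1 i (by omega)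
    have := h.2 v hpos (by rw [hw, wordPerm_append, wordPerm_singleton])
    simp at this
    omega
  · rintro ⟨h, hi, hw⟩
    refine ⟨fun j hj => ?_, fun v hv hvw => ?_⟩
    · rcases List.mem_append.1 hj with hj | hj
      · exact h.1 j hj
      · simp at hj; omega
    · rw [wordPerm_append, wordPerm_singleton] at hvw
      obtain ⟨v', hv', hpos, hw'⟩ := exists_shorter_of_descent v hv i (by
        rw [hvw]; simpa using hw)
      have := h.2 v' hpos (by rw [hw', hvw, mul_assoc, Equiv.swap_mul_self, mul_one])
      simp
      omega

theorem swap_comm_of_lt {a c : ℕ} (h : a + 1 < c) :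
    Equiv.swap a (a + 1) * Equiv.swap c (c + 1) =
      Equiv.swap c (c + 1) * Equiv.swap a (a + 1) := by
  ext k
  simp only [Equiv.Perm.mul_apply, Equiv.swap_apply_def]
  split_ifs <;> omega

theorem swap_braid (a : ℕ) :
    Equiv.swap a (a + 1) * Equiv.swap (a + 1) (a + 2) * Equiv.swap a (a + 1) =
      Equiv.swap (a + 1) (a + 2) * Equiv.swap a (a + 1) * Equiv.swap (a + 1) (a + 2) := by
  ext k
  simp only [Equiv.Perm.mul_apply, Equiv.swap_apply_def]
  split_ifs <;> omega

/-- `s_x` slides through `u` and cancels against its second copy. This excludes the configurations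
that are missing from `ColStep`. -/
theorem not_isReducedWord_of_commute {x : ℕ} {u v : List ℕ}
    (hu : ∀ y ∈ u, y + 1 < x ∨ x + 1 < y) : ¬ IsReducedWord (x :: u ++ x :: v) := by
  intro h
  have hc : Equiv.swap x (x + 1) * wordPerm u = wordPerm u * Equiv.swap x (x + 1) := by
    clear h
    induction u with
    | nil => simp [wordPerm]
    | cons y u ih =>
      have hy : Equiv.swap x (x + 1) * Equiv.swap y (y + 1) =
          Equiv.swap y (y + 1) * Equiv.swap x (x + 1) := by
        rcases hu y List.mem_cons_self with hy | hy
        · exact (swap_comm_of_lt hy).symm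
        · exact swap_comm_of_lt hy
      rw [wordPerm_cons, ← mul_assoc, hy, mul_assoc,
        ih fun z hz => hu z (List.mem_cons_of_mem _ hz), mul_assoc]
  have := h.2 (u ++ v) (fun i hi => h.1 i (by
    simp only [List.mem_append, List.mem_cons] at hi ⊢
    tauto)) (by
      rw [wordPerm_append, wordPerm_append, wordPerm_cons, wordPerm_cons, hc, mul_assoc,
        ← mul_assoc (Equiv.swap x (x + 1)) (Equiv.swap x (x + 1)), Equiv.swap_mul_self, one_mul])
  simp at this

/-! ## Nilplactic equivalence -/

theorem Nilplactic.refl (u : List ℕ) : Nilplactic u u := Relation.EqvGen.refl u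

theorem Nilplactic.symm {u v : List ℕ} (h : Nilplactic u v) : Nilplactic v u :=
  Relation.EqvGen.symm _ _ h

theorem Nilplactic.trans {u v w : List ℕ} (h : Nilplactic u v) (h' : Nilplactic v w) :
    Nilplactic u w := Relation.EqvGen.trans _ _ _ h h'

theorem NilplacticStep.append {u v : List ℕ} (h : NilplacticStep u v) (s t : List ℕ) :
    NilplacticStep (s ++ u ++ t) (s ++ v ++ t) := by
  cases h with
  | left_witness p q a b c hab hbc =>
    simpa using NilplacticStep.left_witness (s ++ p) (q ++ t) a b c hab hbc
  | right_witness p q a b c hab hbc =>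
    simpa using NilplacticStep.right_witness (s ++ p) (q ++ t) a b c hab hbc
  | braid p q a => simpa using NilplacticStep.braid (s ++ p) (q ++ t) a

theorem Nilplactic.append {u v : List ℕ} (h : Nilplactic u v) (s t : List ℕ) :
    Nilplactic (s ++ u ++ t) (s ++ v ++ t) := by
  induction h with
  | rel _ _ h => exact .rel _ _ (h.append s t)
  | refl => exact .refl _
  | symm _ _ _ ih => exact ih.symm
  | trans _ _ _ _ _ ih₁ ih₂ => exact ih₁.trans ih₂

theorem Nilplactic.append_left {u v : List ℕ} (s : List ℕ) (h : Nilplactic u v) :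
    Nilplactic (s ++ u) (s ++ v) := by
  simpa using h.append s []

theorem Nilplactic.append_right {u v : List ℕ} (h : Nilplactic u v) (t : List ℕ) :
    Nilplactic (u ++ t) (v ++ t) := by
  simpa using h.append [] t

theorem NilplacticStep.invariants {u v : List ℕ} (h : NilplacticStep u v) :
    u.length = v.length ∧ wordPerm u = wordPerm v ∧ ((∀ i ∈ u, 0 < i) ↔ ∀ i ∈ v, 0 < i) := by
  cases h with
  | left_witness p q a b c hab hbc =>
    refine ⟨by simp, ?_, ?_⟩
    · simp only [wordPerm_append, wordPerm_cons, wordPerm_nil, mul_one]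
      rw [swap_comm_of_lt (by omega : a + 1 < c)]
    · simp only [List.mem_append, List.mem_cons, List.not_mem_nil, or_false]
      constructor <;> intro h i hi <;> apply h <;> tauto
  | right_witness p q a b c hab hbc =>
    refine ⟨by simp, ?_, ?_⟩
    · simp only [wordPerm_append, wordPerm_cons, wordPerm_nil, mul_one]
      rw [← mul_assoc (Equiv.swap a _), swap_comm_of_lt (by omega : a + 1 < c)]
      simp only [mul_assoc]
    · simp only [List.mem_append, List.mem_cons, List.not_mem_nil, or_false]
      constructor <;> intro h i hi <;> apply h <;> tauto
  | braid p q a =>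
    refine ⟨by simp, ?_, ?_⟩
    · simp only [wordPerm_append, wordPerm_cons, wordPerm_nil, mul_one]
      have := congrArg (fun t => wordPerm p * t * wordPerm q) (swap_braid a)
      simpa only [mul_assoc] using this
    · simp only [List.mem_append, List.mem_cons, List.not_mem_nil, or_false]
      constructor <;> intro h i hi <;> apply h <;> tauto

theorem Nilplactic.invariants {u v : List ℕ} (h : Nilplactic u v) :
    u.length = v.length ∧ wordPerm u = wordPerm v ∧ ((∀ i ∈ u, 0 < i) ↔ ∀ i ∈ v, 0 < i) := by
  induction h with
  | rel _ _ h => exact h.invariants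
  | refl => exact ⟨rfl, rfl, Iff.rfl⟩
  | symm _ _ _ ih => exact ⟨ih.1.symm, ih.2.1.symm, ih.2.2.symm⟩
  | trans _ _ _ _ _ ih₁ ih₂ =>
    exact ⟨ih₁.1.trans ih₂.1, ih₁.2.1.trans ih₂.2.1, ih₁.2.2.trans ih₂.2.2⟩

theorem Nilplactic.isReducedWord {u v : List ℕ} (h : Nilplactic u v) (hu : IsReducedWord u) :
    IsReducedWord v := by
  obtain ⟨hl, hw, hp⟩ := h.invariants
  exact ⟨hp.1 hu.1, fun t ht hv => hl ▸ hu.2 t ht (hv.trans hw.symm)⟩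

/-- Moving a large letter to the right across an increasing word. -/
theorem nilplactic_move_large (V : List ℕ) (x y : ℕ) (hV : (V ++ [y]).Pairwise (· < ·))
    (hx : ∀ z ∈ V ++ [y], z < x) : Nilplactic (x :: V ++ [y]) (V ++ [x, y]) := by
  induction V with
  | nil => exact .refl _
  | cons v V ih =>
    have ih' := ih hV.of_cons fun z hz => hx z (List.mem_cons_of_mem _ hz)
    have h₁ : Nilplactic (x :: v :: V ++ [y]) (v :: x :: V ++ [y]) := by
      -- The letter after `v` is the witness for exchanging `x` and `v`; the final `y` guarantees
      -- that there is one.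
      obtain ⟨w, W, hW⟩ : ∃ w W, V ++ [y] = w :: W := by
        cases V <;> simp
      have h₃ : v < w := (List.pairwise_cons.1 hV).1 w (by simp [hW])
      have h₄ : w < x := hx w (by simp only [List.cons_append, hW]; simp)
      simp only [List.cons_append, hW]
      exact Nilplactic.symm (.rel _ _ (by simpa using NilplacticStep.right_witness [] W v w x h₃ h₄))
    exact h₁.trans (ih'.append_left [v])

/-- Moving a small letter to the right across an increasing word. -/
theorem nilplactic_move_small (U : List ℕ) (x y : ℕ) (hU : (x :: U).Pairwise (· < ·))
    (hy : y < x) : Nilplactic (x :: y :: U) (x :: U ++ [y]) := by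
  induction U generalizing x with
  | nil => exact .refl _
  | cons u U ih =>
    have h₁ : x < u := (List.pairwise_cons.1 hU).1 u (by simp)
    have h₂ : Nilplactic (x :: y :: u :: U) (x :: u :: y :: U) :=
      .rel _ _ (by simpa using NilplacticStep.left_witness [] U y x u hy h₁)
    exact h₂.trans ((ih u hU.of_cons (by omega)).append_left [x])

/-! ## Inserting a letter into a column -/

/-- The column `C` lies strictly above the column `D`, when aligned at the top. -/
def Dominates (C D : List ℕ) : Prop :=
  D.length ≤ C.length ∧ ∀ r < D.length, D.getD r 0 < C.getD r 0

theorem dominates_iff {C D : List ℕ} :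
    Dominates C D ↔ ∀ (r v : ℕ), D[r]? = some v → ∃ w, C[r]? = some w ∧ v < w := by
  constructor
  · rintro ⟨hl, h⟩ r v hv
    obtain ⟨hr, rfl⟩ := List.getElem?_eq_some_iff.1 hv
    refine ⟨C[r], List.getElem?_eq_getElem (by omega), ?_⟩
    have := h r hr
    rwa [List.getD_eq_getElem _ _ hr, List.getD_eq_getElem _ _ (by omega)] at this
  · intro h
    have key : ∀ r (hr : r < D.length), ∃ hc : r < C.length, D[r] < C[r] := by
      intro r hr
      obtain ⟨w, hw, hlt⟩ := h r _ (List.getElem?_eq_getElem hr)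
      obtain ⟨hc, rfl⟩ := List.getElem?_eq_some_iff.1 hw
      exact ⟨hc, hlt⟩
    refine ⟨?_, fun r hr => ?_⟩
    · by_contra hc
      obtain ⟨h₁, -⟩ := key C.length (by omega)
      omega
    · obtain ⟨hc, hlt⟩ := key r hr
      rwa [List.getD_eq_getElem _ _ hr, List.getD_eq_getElem _ _ hc]

/-- Insertion of `x` into the column `C`, giving the column `C'` and possibly bumping a letter. -/
inductive ColStep : ℕ → List ℕ → List ℕ → Option ℕ → Prop
  | append (x : ℕ) (U : List ℕ) (hU : ∀ u ∈ U, x < u) : ColStep x U (U ++ [x]) none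
  | replace (x y : ℕ) (U V : List ℕ) (hU : ∀ u ∈ U, x < u) (hy : y < x) :
      ColStep x (U ++ y :: V) (U ++ x :: V) (some y)
  | keep (y : ℕ) (U V : List ℕ) :
      ColStep (y + 1) (U ++ (y + 1) :: y :: V) (U ++ (y + 1) :: y :: V) (some y)

theorem ColStep.sorted {x : ℕ} {C C' : List ℕ} {o : Option ℕ} (h : ColStep x C C' o)
    (hC : C.Pairwise (· > ·)) : C'.Pairwise (· > ·) := by
  cases h with
  | append _ U hU => simp_all [List.pairwise_append]
  | replace _ _ U V hU hy =>
    simp only [List.pairwise_append, List.pairwise_cons, List.mem_cons] at hC ⊢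
    refine ⟨hC.1, ⟨fun a ha => lt_trans (hC.2.1.1 a ha) hy, hC.2.1.2⟩, ?_⟩
    rintro a ha b (rfl | hb)
    · exact hU a ha
    · exact hC.2.2 a ha b (Or.inr hb)
  | keep => exact hC

theorem ColStep.mem_new {x : ℕ} {C C' : List ℕ} {o : Option ℕ} (h : ColStep x C C' o) :
    x ∈ C' := by
  cases h <;> simp

theorem ColStep.mem_of_mem_new {x : ℕ} {C C' : List ℕ} {o : Option ℕ} (h : ColStep x C C' o)
    {z : ℕ} (hz : z ∈ C') : z = x ∨ z ∈ C := by
  cases h <;> simp at hz ⊢ <;> tauto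

theorem ColStep.mem_out {x y : ℕ} {C C' : List ℕ} (h : ColStep x C C' (some y)) :
    y ∈ C ∧ y < x := by
  cases h <;> simp_all

theorem ColStep.le_out {x y : ℕ} {C C' : List ℕ} (h : ColStep x C C' (some y))
    (hC : C.Pairwise (· > ·)) : ∀ z ∈ C, z < x → z ≤ y := by
  cases h with
  | replace _ _ U V hU hy => grind [List.pairwise_cons]
  | keep => grind [List.pairwise_cons]

theorem ColStep.le_out_new {x y : ℕ} {C C' : List ℕ} (h : ColStep x C C' (some y))
    (hC : C.Pairwise (· > ·)) : ∀ z ∈ C', z < x → z ≤ y ∧ (z = y → x = y + 1) := by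
  cases h with
  | replace _ _ U V hU hy => grind [List.pairwise_cons]
  | keep => grind [List.pairwise_cons]

theorem ColStep.lt_of_none {x : ℕ} {C C' : List ℕ} (h : ColStep x C C' none) :
    C' = C ++ [x] ∧ ∀ z ∈ C, x < z := by
  cases h with
  | append _ U hU => exact ⟨rfl, hU⟩

theorem ColStep.length_some {x y : ℕ} {C C' : List ℕ} (h : ColStep x C C' (some y)) :
    C'.length = C.length := by
  cases h <;> simp

/-- Insertion into a column, for a reduced word, in terms of the defining algorithm. -/
theorem ColStep.find_none {x : ℕ} {C C' : List ℕ} (h : ColStep x C C' none) :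
    C.find? (· < x) = none := by
  have := h.lt_of_none.2
  simp only [List.find?_eq_none, decide_eq_true_eq]
  intro z hz
  have := this z hz
  omega

theorem ColStep.find_some {x y : ℕ} {C C' : List ℕ} (h : ColStep x C C' (some y))
    (hC : C.Pairwise (· > ·)) :
    C.find? (· < x) = some y ∧ C' = if x = y + 1 ∧ x ∈ C then C else replaceEntry y x C := by
  cases h with
  | replace _ _ U V hU hy =>
    have hx : x ∉ U ++ y :: V := by grind [List.pairwise_cons]
    have hyU : ∀ z ∈ U, z ≠ y := by grind
    have hyV : ∀ z ∈ V, z ≠ y := by grind [List.pairwise_cons]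
    refine ⟨?_, ?_⟩
    · rw [List.find?_append, List.find?_eq_none.2 (by intro z hz; have := hU z hz; simp; omega)]
      simp [hy]
    · rw [if_neg (by tauto)]
      simp only [replaceEntry, List.map_append, List.map_cons, if_true]
      congr 1
      · exact ((List.map_congr_left (g := id) fun z hz => by simp [hyU z hz]).trans (List.map_id U)).symm
      · congr 1
        exact ((List.map_congr_left (g := id) fun z hz => by simp [hyV z hz]).trans (List.map_id V)).symm
  | keep _ U V =>
    refine ⟨?_, by simp⟩
    have hU : ∀ z ∈ U, y + 1 < z := fun z hz =>
      (List.pairwise_append.1 hC).2.2 z hz (y + 1) (by simp)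
    rw [List.find?_append, List.find?_eq_none.2 (by intro z hz; have := hU z hz; simp; omega)]
    simp

theorem exists_split_column (x : ℕ) (C : List ℕ) (hC : C.Pairwise (· > ·)) :
    ∃ U V, C = U ++ V ∧ (∀ u ∈ U, x ≤ u) ∧ ∀ v ∈ V, v < x := by
  induction C with
  | nil => exact ⟨[], [], by simp⟩
  | cons c C ih =>
    by_cases h : c < x
    · refine ⟨[], c :: C, by simp, by simp, ?_⟩
      intro v hv
      rcases List.mem_cons.1 hv with rfl | hv
      · exact h
      · have := (List.pairwise_cons.1 hC).1 v hv
        omega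
    · obtain ⟨U, V, rfl, hU, hV⟩ := ih hC.of_cons
      exact ⟨c :: U, V, rfl, by simp; exact ⟨by omega, hU⟩, hV⟩

/-- Split the column at `x`. If `x` is already an entry but its predecessor is not, then `x`
commutes with all smaller entries, which separate its two copies in the word, so the word is not
reduced. -/
theorem exists_colStep {x : ℕ} {C : List ℕ} (hC : C.Pairwise (· > ·))
    (hr : IsReducedWord (x :: C.reverse)) : ∃ C' o, ColStep x C C' o := by
  obtain ⟨U, V, rfl, hU, hV⟩ := exists_split_column x C hC
  rcases List.eq_nil_or_concat U with rfl | ⟨U, u, rfl⟩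
  · cases V with
    | nil => exact ⟨_, _, .append x [] (by simp)⟩
    | cons y V => exact ⟨_, _, .replace x y [] V (by simp) (hV y (by simp))⟩
  · rw [List.concat_eq_append] at *
    rcases (hU u (by simp)).eq_or_lt with rfl | hu
    · cases V with
      | nil =>
        refine absurd hr ?_
        simpa using not_isReducedWord_of_commute (x := x) (u := []) (v := U.reverse) (by simp)
      | cons y V =>
        by_cases hy : x = y + 1
        · subst hy
          exact ⟨_, _, by simpa using ColStep.keep y U V⟩
        · refine absurd hr ?_
          have := not_isReducedWord_of_commute (x := x) (u := (y :: V).reverse) (v := U.reverse)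
            (by
              intro z hz
              have := hV y (by simp)
              rw [List.mem_reverse] at hz
              rcases List.mem_cons.1 hz with rfl | hz
              · omega
              · have h₂ : z < y := by grind [List.pairwise_cons]
                omega)
          simpa using this
    · have hU' : ∀ z ∈ U ++ [u], x < z := by
        intro z hz
        rcases List.mem_append.1 hz with hz | hz
        · have : u < z := by grind [List.pairwise_cons]
          omega
        · simp at hz; omega
      cases V with
      | nil => exact ⟨_, _, by simpa using ColStep.append x (U ++ [u]) hU'⟩
      | cons y V => exact ⟨_, _, .replace x y (U ++ [u]) V hU' (hV y (by simp))⟩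

/-- The inserted letter travels right past the entries below the bumped one, and the bumped letter
then travels right past the entries above it. Only the `keep` case needs a braid relation, between
the two moves. -/
theorem ColStep.nilplactic {x : ℕ} {C C' : List ℕ} {o : Option ℕ} (h : ColStep x C C' o)
    (hC : C.Pairwise (· > ·)) :
    Nilplactic (x :: C.reverse) (C'.reverse ++ o.toList) := by
  have hC' := h.sorted hC
  rw [← List.pairwise_reverse] at hC hC'
  cases h with
  | append _ U hU => simpa using Nilplactic.refl _
  | replace _ y U V hU hy =>
    simp only [List.reverse_append, List.reverse_cons, List.append_assoc, List.cons_append,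
      List.nil_append, Option.toList_some] at hC hC' ⊢
    have h₁ := nilplactic_move_large V.reverse x y
      (by grind [List.pairwise_cons]) (by grind)
    have h₂ := nilplactic_move_small U.reverse x y (by grind [List.pairwise_cons]) hy
    have h₃ := h₁.append_right U.reverse
    have h₄ := h₂.append_left V.reverse
    simp only [List.append_assoc, List.cons_append, List.nil_append] at h₃ h₄
    exact h₃.trans h₄
  | keep y U V =>
    simp only [List.reverse_append, List.reverse_cons, List.append_assoc, List.cons_append,
      List.nil_append, Option.toList_some] at hC ⊢
    have h₁ := nilplactic_move_large V.reverse (y + 1) y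
      (by grind [List.pairwise_cons]) (by grind)
    have h₂ := nilplactic_move_small U.reverse (y + 1) y (by grind [List.pairwise_cons])
      (by omega)
    have h₃ := h₁.append_right ((y + 1) :: U.reverse)
    have h₄ := h₂.append_left (V.reverse ++ [y])
    have h₅ : Nilplactic (V.reverse ++ [y, y + 1, y] ++ U.reverse)
      (V.reverse ++ [y + 1, y, y + 1] ++ U.reverse) := .rel _ _ (.braid _ _ _)
    simp only [List.append_assoc, List.cons_append, List.nil_append] at h₃ h₄ h₅
    exact (h₃.trans h₅.symm).trans h₄

/-- When `y` changes `D`, it lands weakly above the row of `x` in `C'`: the entries of `D` above it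
exceed `y`, so their left neighbours exceed `y + 1`. Hence the left neighbour of `y` in `C'` is
larger than `y`. -/
theorem ColStep.dominates {x y : ℕ} {C C' D D' : List ℕ} {o : Option ℕ}
    (h : ColStep x C C' (some y)) (h' : ColStep y D D' o) (hC : C.Pairwise (· > ·))
    (hD : D.Pairwise (· > ·)) (hCD : Dominates C D) : Dominates C' D' := by
  rw [dominates_iff] at hCD ⊢
  have hCC' : ∀ (r v : ℕ), C[r]? = some v → ∃ w, C'[r]? = some w ∧ v ≤ w := by
    cases h with
    | replace _ _ U V hU hy =>
      intro r v hv
      rw [List.getElem?_append] at hv ⊢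
      split_ifs at hv ⊢ with hr
      · exact ⟨v, hv, le_rfl⟩
      · rw [List.getElem?_cons] at hv ⊢
        split_ifs at hv ⊢ with hr
        · simp only [Option.some.injEq] at hv
          exact ⟨x, rfl, by omega⟩
        · exact ⟨v, hv, le_rfl⟩
    | keep => exact fun r v hv => ⟨v, hv, le_rfl⟩
  have hq : ∀ U₂ : List ℕ, (∀ u ∈ U₂, y < u) →
      (∀ (r v : ℕ), U₂[r]? = some v → D[r]? = some v) →
      ∃ w, C'[U₂.length]? = some w ∧ y < w := by
    intro U₂ hU₂ hUD
    have hC₁ : ∀ r < U₂.length, ∃ w, C[r]? = some w ∧ y + 1 < w := by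
      intro r hr
      obtain ⟨w, hw, hlt⟩ := hCD r _ (hUD r _ (List.getElem?_eq_getElem hr))
      have := hU₂ _ (List.getElem_mem hr)
      exact ⟨w, hw, by omega⟩
    cases h with
    | replace _ _ U V hU hy =>
      have hle : U₂.length ≤ U.length := by
        by_contra hc
        obtain ⟨w, hw, hlt⟩ := hC₁ U.length (by omega)
        simp at hw
        omega
      rcases hle.lt_or_eq with hlt | heq
      · refine ⟨U[U₂.length], by rw [List.getElem?_append_left hlt, List.getElem?_eq_getElem hlt], ?_⟩
        have := hU _ (List.getElem_mem hlt)
        omega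
      · exact ⟨x, by rw [heq, List.getElem?_append_right le_rfl]; simp, hy⟩
    | keep _ U V =>
      have hle : U₂.length ≤ U.length := by
        by_contra hc
        obtain ⟨w, hw, hlt⟩ := hC₁ U.length (by omega)
        simp at hw
        omega
      rcases hle.lt_or_eq with hlt | heq
      · refine ⟨U[U₂.length], by rw [List.getElem?_append_left hlt, List.getElem?_eq_getElem hlt], ?_⟩
        have := (List.pairwise_append.1 hC).2.2 _ (List.getElem_mem hlt) y (by simp)
        omega
      · exact ⟨y + 1, by rw [heq, List.getElem?_append_right le_rfl]; simp, by omega⟩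
  have hmain : ∀ (r v : ℕ), D[r]? = some v → ∃ w, C'[r]? = some w ∧ v < w := by
    intro r v hv
    obtain ⟨w, hw, hlt⟩ := hCD r v hv
    obtain ⟨w', hw', hle⟩ := hCC' r w hw
    exact ⟨w', hw', by omega⟩
  cases h' with
  | append _ U₂ hU₂ =>
    intro r v hv
    rw [List.getElem?_append] at hv
    split_ifs at hv with hr
    · exact hmain r v hv
    · rw [List.getElem?_singleton] at hv
      split_ifs at hv with hr₂
      simp only [Option.some.injEq] at hv
      obtain ⟨w, hw, hlt⟩ := hq D hU₂ fun _ _ h => h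
      exact ⟨w, by rwa [show r = D.length by omega], by omega⟩
  | replace _ z U₂ V₂ hU₂ hz =>
    intro r v hv
    by_cases hr : r = U₂.length
    · subst hr
      simp at hv
      subst hv
      exact hq U₂ hU₂ fun r v h => by
        obtain ⟨hr, -⟩ := List.getElem?_eq_some_iff.1 h
        rw [List.getElem?_append_left hr, h]
    · refine hmain r v ?_
      rw [← hv, List.getElem?_append, List.getElem?_append]
      split_ifs with h₁
      · rfl
      · rw [List.getElem?_cons, List.getElem?_cons, if_neg (by omega), if_neg (by omega)]
  | keep => exact hmain

/-! ## Edelman-Greene column insertion into a tableau -/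

theorem dominates_nil (C : List ℕ) : Dominates C [] := by simp [Dominates]

theorem isDecreasing_nil : IsDecreasing [] := by simp [IsDecreasing]

theorem isDecreasing_cons {C : List ℕ} {R : Tableau} :
    IsDecreasing (C :: R) ↔ (C ≠ [] ∧ (∀ x ∈ C, 0 < x) ∧ C.Pairwise (· > ·)) ∧
      Dominates C (R.headD []) ∧ IsDecreasing R := by
  unfold IsDecreasing
  cases R with
  | nil => simp [dominates_nil]
  | cons D R =>
    simp only [List.mem_cons, List.isChain_cons_cons, List.headD_cons, forall_eq_or_imp, Dominates]
    tauto

theorem IsDecreasing.sorted {T : Tableau} (h : IsDecreasing T) :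
    ∀ C ∈ T, C.Pairwise (· > ·) := fun C hC => (h.1 C hC).2.2

theorem IsDecreasing.headD_sorted {T : Tableau} (h : IsDecreasing T) :
    (T.headD []).Pairwise (· > ·) := by
  cases T with
  | nil => simp
  | cons C T => exact h.sorted C (by simp)

theorem word_nil : word [] = [] := rfl

theorem word_cons (C : List ℕ) (R : Tableau) : word (C :: R) = C.reverse ++ word R := by
  simp [word]

/-- The graph of Edelman-Greene column insertion on reduced words. -/
inductive EGIns : ℕ → Tableau → Tableau → ℕ → Prop
  | nil (x : ℕ) : EGIns x [] [[x]] 0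
  | append (x : ℕ) (C C' : List ℕ) (R : Tableau) (h : ColStep x C C' none) :
      EGIns x (C :: R) (C' :: R) 0
  | bump (x y : ℕ) (C C' : List ℕ) (R R' : Tableau) (c : ℕ) (h : ColStep x C C' (some y))
      (h' : EGIns y R R' c) : EGIns x (C :: R) (C' :: R') (c + 1)

theorem EGIns.eq {x : ℕ} {T T' : Tableau} {c : ℕ} (h : EGIns x T T' c)
    (hT : ∀ C ∈ T, C.Pairwise (· > ·)) : egColumnInsert x T = (T', c) := by
  induction h with
  | nil => rfl
  | append x C C' R h => simp only [egColumnInsert, h.find_none, h.lt_of_none.1]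
  | bump x y C C' R R' c h _ ih =>
    obtain ⟨h₁, h₂⟩ := h.find_some (hT C (by simp))
    simp only [egColumnInsert, h₁, ih fun D hD => hT D (by simp [hD]), ← h₂]

/-- Reading a missing column as an empty one lets `ColStep.dominates` also cover the passage to a
newly opened column. -/
theorem EGIns.head_colStep {x : ℕ} {T T' : Tableau} {c : ℕ} (h : EGIns x T T' c) :
    ∃ o, ColStep x (T.headD []) (T'.headD []) o := by
  cases h with
  | nil => exact ⟨none, .append x [] (by simp)⟩
  | append _ C C' R h => exact ⟨_, h⟩
  | bump _ y C C' R R' c h => exact ⟨_, h⟩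

theorem EGIns.mem {x : ℕ} {T T' : Tableau} {c : ℕ} (h : EGIns x T T' c) :
    ∀ z ∈ word T', z = x ∨ z ∈ word T := by
  induction h with
  | nil => simp [word]
  | append x C C' R h =>
    intro z hz
    simp only [word_cons, List.mem_append, List.mem_reverse] at hz ⊢
    rcases hz with hz | hz
    · have := h.mem_of_mem_new hz
      tauto
    · tauto
  | bump x y C C' R R' c h _ ih =>
    intro z hz
    simp only [word_cons, List.mem_append, List.mem_reverse] at hz ⊢
    rcases hz with hz | hz
    · have := h.mem_of_mem_new hz
      tauto
    · rcases ih z hz with rfl | hz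
      · have := h.mem_out.1
        tauto
      · tauto

theorem EGIns.isDecreasing {x : ℕ} {T T' : Tableau} {c : ℕ} (h : EGIns x T T' c)
    (hx : 0 < x) (hT : IsDecreasing T) : IsDecreasing T' := by
  induction h with
  | nil => simpa [isDecreasing_cons, dominates_nil, isDecreasing_nil] using hx
  | append x C C' R h =>
    rw [isDecreasing_cons] at hT ⊢
    obtain ⟨⟨h₁, h₂, h₃⟩, h₄, h₅⟩ := hT
    refine ⟨⟨List.ne_nil_of_mem h.mem_new, ?_, h.sorted h₃⟩, ?_, h₅⟩
    · intro z hz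
      rcases h.mem_of_mem_new hz with rfl | hz
      exacts [hx, h₂ z hz]
    · rw [h.lt_of_none.1]
      rw [dominates_iff] at h₄ ⊢
      intro r v hv
      obtain ⟨w, hw, hlt⟩ := h₄ r v hv
      refine ⟨w, ?_, hlt⟩
      rw [List.getElem?_append_left (List.getElem?_eq_some_iff.1 hw).1, hw]
  | bump x y C C' R R' c h h' ih =>
    rw [isDecreasing_cons] at hT ⊢
    obtain ⟨⟨h₁, h₂, h₃⟩, h₄, h₅⟩ := hT
    obtain ⟨o, ho⟩ := h'.head_colStep
    refine ⟨⟨List.ne_nil_of_mem h.mem_new, ?_, h.sorted h₃⟩,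
      h.dominates ho h₃ h₅.headD_sorted h₄, ih (h₂ y h.mem_out.1) h₅⟩
    intro z hz
    rcases h.mem_of_mem_new hz with rfl | hz
    exacts [hx, h₂ z hz]

theorem EGIns.nilplactic {x : ℕ} {T T' : Tableau} {c : ℕ} (h : EGIns x T T' c)
    (hT : ∀ C ∈ T, C.Pairwise (· > ·)) : Nilplactic (x :: word T) (word T') := by
  induction h with
  | nil => exact .refl _
  | append x C C' R h =>
    simp only [word_cons]
    simpa using (h.nilplactic (hT C (by simp))).append_right (word R)
  | bump x y C C' R R' c h _ ih =>
    simp only [word_cons]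
    have h₁ := (h.nilplactic (hT C (by simp))).append_right (word R)
    have h₂ := (ih fun D hD => hT D (by simp [hD])).append_left C'.reverse
    simp only [Option.toList_some, List.append_assoc, List.cons_append, List.nil_append] at h₁
    exact h₁.trans h₂

theorem exists_EGIns {x : ℕ} {T : Tableau} (hT : ∀ C ∈ T, C.Pairwise (· > ·))
    (hr : IsReducedWord (x :: word T)) : ∃ T' c, EGIns x T T' c := by
  induction T generalizing x with
  | nil => exact ⟨_, _, .nil x⟩
  | cons C R ih =>
    have hC := hT C (by simp)
    rw [word_cons] at hr
    obtain ⟨C', o, ho⟩ := exists_colStep (x := x) hC (IsReducedWord.left (v := word R) (by simpa using hr))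
    cases o with
    | none => exact ⟨_, _, .append x C C' R ho⟩
    | some y =>
      have h₁ := ((ho.nilplactic hC).append_right (word R)).isReducedWord (by simpa using hr)
      obtain ⟨R', c, h⟩ := ih (x := y) (fun D hD => hT D (by simp [hD]))
        (IsReducedWord.right (u := C'.reverse) (by simpa using h₁))
      exact ⟨_, _, .bump x y C C' R R' c ho h⟩

/-- Adding a box at the bottom of column `c` of a shape given by its column lengths. -/
def addBox : List ℕ → ℕ → List ℕ
  | [], _ => [1]
  | n :: l, 0 => (n + 1) :: l
  | n :: l, c + 1 => n :: addBox l c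

theorem appendBox_nil {α : Type} (c : ℕ) (y : α) : appendBox [] c y = [[y]] := by
  simp [appendBox]

theorem appendBox_cons_zero {α : Type} (C : List α) (Q : List (List α)) (y : α) :
    appendBox (C :: Q) 0 y = (C ++ [y]) :: Q := by
  simp [appendBox]

theorem appendBox_cons_succ {α : Type} (C : List α) (Q : List (List α)) (c : ℕ) (y : α) :
    appendBox (C :: Q) (c + 1) y = C :: appendBox Q c y := by
  simp only [appendBox, List.length_cons, Nat.add_lt_add_iff_right, List.modify_succ_cons,
    List.cons_append]
  split_ifs <;> rfl

theorem length_appendBox {α : Type} (Q : List (List α)) (c : ℕ) (y : α) :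
    (appendBox Q c y).map List.length = addBox (Q.map List.length) c := by
  induction Q generalizing c with
  | nil => simp [appendBox_nil, addBox]
  | cons C Q ih =>
    cases c with
    | zero => simp [appendBox_cons_zero, addBox]
    | succ c => simp [appendBox_cons_succ, addBox, ih]

theorem EGIns.colLengths {x : ℕ} {T T' : Tableau} {c : ℕ} (h : EGIns x T T' c) :
    colLengths T' = addBox (colLengths T) c := by
  induction h with
  | nil => rfl
  | append x C C' R h => simp [NilKey.colLengths, addBox, h.lt_of_none.1]
  | bump x y C C' R R' c h _ ih =>
    simp only [NilKey.colLengths, List.map_cons, addBox, h.length_some] at ih ⊢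
    rw [ih]

theorem EGIns.le_length {x : ℕ} {T T' : Tableau} {c : ℕ} (h : EGIns x T T' c) :
    c ≤ T.length := by
  induction h <;> simp_all

/-- When the larger `y` arrives, `x` is in the column, so `y` cannot stop there and bumps a letter
that is at least `x`, hence larger than the letter bumped by `x`. The second path thus goes strictly
further. -/
theorem EGIns.lt_of_lt {x y : ℕ} {T₀ T₁ T₂ : Tableau} {c d : ℕ} (h : EGIns x T₀ T₁ c)
    (h' : EGIns y T₁ T₂ d) (hxy : x < y) (hT : ∀ C ∈ T₀, C.Pairwise (· > ·)) : c < d := by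
  induction h generalizing y T₂ d with
  | nil x =>
    cases h' with
    | append _ _ C' _ h => have := h.lt_of_none.2 x (by simp); omega
    | bump => omega
  | append x C C' R h =>
    cases h' with
    | append _ _ C' _ h₂ => have := h₂.lt_of_none.2 x h.mem_new; omega
    | bump => omega
  | bump x z C C' R R' c h _ ih =>
    cases h' with
    | append _ _ C' _ h₂ => have := h₂.lt_of_none.2 x h.mem_new; omega
    | bump _ z' _ C'' _ R'' d h₂ h₃ =>
      have hs := h.sorted (hT C (by simp))
      have h₄ := h₂.le_out hs x h.mem_new hxy
      have h₅ := h.mem_out.2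
      have := ih h₃ (by omega) fun D hD => hT D (by simp [hD])
      omega

/-- Bumped letters keep their order: an entry of the new column below `y` is at most the letter `z`
bumped by `x`, and equal to it only if `x = z + 1`, which leaves no room for `y` in between. -/
theorem EGIns.le_of_gt {x y : ℕ} {T₀ T₁ T₂ : Tableau} {c d : ℕ} (h : EGIns x T₀ T₁ c)
    (h' : EGIns y T₁ T₂ d) (hxy : y < x) (hT : ∀ C ∈ T₀, C.Pairwise (· > ·)) : d ≤ c := by
  induction h generalizing y T₂ d with
  | nil x =>
    cases h' with
    | append => exact le_rfl
    | bump _ z' _ C'' _ R'' d h₂ h₃ =>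
      have := h₂.mem_out
      simp at this
      omega
  | append x C C' R h =>
    cases h' with
    | append => exact le_rfl
    | bump _ z' _ C'' _ R'' d h₂ h₃ =>
      have h₄ := h₂.mem_out
      rcases h.mem_of_mem_new h₄.1 with rfl | h₅
      · omega
      · have := h.lt_of_none.2 _ h₅
        omega
  | bump x z C C' R R' c h _ ih =>
    cases h' with
    | append => omega
    | bump _ z' _ C'' _ R'' d h₂ h₃ =>
      have h₄ := h₂.mem_out
      have h₅ := h.le_out_new (hT C (by simp)) z' h₄.1 (by omega)
      have := ih h₃ (by omega) fun D hD => hT D (by simp [hD])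
      omega

/-! ## Reverse insertion -/

/-- The letter to eject is the least entry `x` of `C'` above `y`. If `y` is itself an entry,
reducedness forces `x = y + 1`, which is the `keep` case. -/
theorem exists_colStep_reverse {y : ℕ} {C' : List ℕ} (hC' : C'.Pairwise (· > ·))
    (hr : IsReducedWord (C'.reverse ++ [y])) (hy : ∃ z ∈ C', y < z) :
    ∃ C x, ColStep x C C' (some y) ∧ C.Pairwise (· > ·) := by
  obtain ⟨U, V, rfl, hU, hV⟩ := exists_split_column (y + 1) C' hC'
  rcases List.eq_nil_or_concat U with rfl | ⟨U, x, rfl⟩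
  · obtain ⟨z, hz, hyz⟩ := hy
    have := hV z (by simpa using hz)
    omega
  · rw [List.concat_eq_append, List.append_assoc, List.singleton_append] at *
    have hxU : ∀ u ∈ U, x < u := fun u hu => (List.pairwise_append.1 hC').2.2 u hu x (by simp)
    have hx : y < x := by
      have := hU x (by simp)
      omega
    by_cases hyV : y ∈ V
    · obtain ⟨V', rfl⟩ : ∃ V', V = y :: V' := by
        cases V with
        | nil => simp at hyV
        | cons v V' =>
          rcases List.mem_cons.1 hyV with rfl | hyV
          · exact ⟨_, rfl⟩
          · have := (List.pairwise_append.1 hC').2.1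
            simp only [List.pairwise_cons] at this
            have h₁ := this.2.1 y hyV
            have h₂ := hV v (by simp)
            omega
      rcases Nat.lt_or_ge (y + 1) x with h | h
      · exfalso
        have h₁ := hr.reverse
        rw [List.reverse_append, List.reverse_reverse] at h₁
        have := not_isReducedWord_of_commute (x := y) (u := U ++ [x]) (v := V') (by
          intro z hz
          rcases List.mem_append.1 hz with hz | hz
          · have := hxU z hz
            omega
          · simp at hz
            omega)
        exact this (by simpa using h₁)
      · obtain rfl : x = y + 1 := by omega
        exact ⟨_, _, .keep y U V', hC'⟩
    · refine ⟨U ++ y :: V, x, .replace x y U V hxU hx, ?_⟩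
      have hV' : ∀ v ∈ V, v < y := fun v hv => by
        have := hV v hv
        have : v ≠ y := fun h => hyV (h ▸ hv)
        omega
      grind [List.pairwise_cons]

/-- `C'` and `y` determine `x` as the least entry above `y`, and then the set of entries of the old
column. -/
theorem ColStep.injective {x₁ x₂ y : ℕ} {C₁ C₂ C' : List ℕ} (h₁ : ColStep x₁ C₁ C' (some y))
    (h₂ : ColStep x₂ C₂ C' (some y)) (hC₁ : C₁.Pairwise (· > ·)) (hC₂ : C₂.Pairwise (· > ·)) :
    x₁ = x₂ ∧ C₁ = C₂ := by
  have key : ∀ {x : ℕ} {C : List ℕ}, ColStep x C C' (some y) → C.Pairwise (· > ·) →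
      (x ∈ C' ∧ y < x ∧ (∀ z ∈ C', y < z → x ≤ z)) ∧
        ∀ z, z ∈ C ↔ z = y ∨ (z ∈ C' ∧ (z ≠ x ∨ y ∈ C')) := by
    intro x C h hC
    cases h with
    | replace _ _ U V hU hy => grind [List.pairwise_cons]
    | keep _ U V =>
      have hU : ∀ z ∈ U, y + 1 < z := fun z hz =>
        (List.pairwise_append.1 hC).2.2 z hz (y + 1) (by simp)
      refine ⟨⟨by simp, by omega, ?_⟩, ?_⟩
      · intro z hz h; omega
      · intro z
        simp
        tauto
  obtain ⟨⟨a₁, b₁, c₁⟩, d₁⟩ := key h₁ hC₁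
  obtain ⟨⟨a₂, b₂, c₂⟩, d₂⟩ := key h₂ hC₂
  have hx : x₁ = x₂ := le_antisymm (c₁ _ a₂ b₂) (c₂ _ a₁ b₁)
  subst hx
  exact ⟨rfl, List.Perm.eq_of_pairwise' hC₁ hC₂
    ((List.perm_ext_iff_of_nodup (hC₁.imp fun h => ne_of_gt h) (hC₂.imp fun h => ne_of_gt h)).2
      fun z => (d₁ z).trans (d₂ z).symm)⟩

/-- `c` is the column of a removable box of the shape with column lengths `l`. -/
def IsCorner : List ℕ → ℕ → Prop
  | [], _ => False
  | n :: l, 0 => l.headD 0 < n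
  | _ :: l, c + 1 => IsCorner l c

theorem ColStep.le_new {x : ℕ} {C C' : List ℕ} {o : Option ℕ} (h : ColStep x C C' o) :
    ∀ (r v : ℕ), C[r]? = some v → ∃ w, C'[r]? = some w ∧ v ≤ w := by
  cases h with
  | append _ U hU =>
    intro r v hv
    exact ⟨v, by rw [List.getElem?_append_left (List.getElem?_eq_some_iff.1 hv).1, hv], le_rfl⟩
  | replace _ y U V hU hy =>
    intro r v hv
    rw [List.getElem?_append] at hv ⊢
    split_ifs at hv ⊢ with hr
    · exact ⟨v, hv, le_rfl⟩
    · rw [List.getElem?_cons] at hv ⊢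
      split_ifs at hv ⊢ with hr
      · simp only [Option.some.injEq] at hv
        exact ⟨x, rfl, by omega⟩
      · exact ⟨v, hv, le_rfl⟩
  | keep => exact fun r v hv => ⟨v, hv, le_rfl⟩

/-- Below the row of `x` the entries of `C'` are smaller than `y`, so `y` can sit in `D'` only
weakly above that row. Hence the entry of `D` in the row to which `y` returns is less than `y`. -/
theorem ColStep.dominates_old {x y : ℕ} {C C' D D' : List ℕ} {o : Option ℕ}
    (h : ColStep x C C' (some y)) (h' : ColStep y D D' o) (hC : C.Pairwise (· > ·))
    (hD : D.Pairwise (· > ·)) (hCD : Dominates C' D') : Dominates C D := by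
  rw [dominates_iff] at hCD ⊢
  have hmain : ∀ (r v : ℕ), D[r]? = some v → ∃ w, C'[r]? = some w ∧ v < w := by
    intro r v hv
    obtain ⟨w, hw, hle⟩ := h'.le_new r v hv
    obtain ⟨w', hw', hlt⟩ := hCD r w hw
    exact ⟨w', hw', by omega⟩
  cases h with
  | keep => exact hmain
  | replace _ _ U V hU hy =>
    have hV : ∀ v ∈ V, v < y := fun v hv =>
      (List.pairwise_cons.1 (List.pairwise_append.1 hC).2.1).1 v hv
    have hq : ∀ q : ℕ, D'[q]? = some y → q ≤ U.length := by
      intro q hq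
      by_contra hc
      obtain ⟨w, hw, hlt⟩ := hCD q y hq
      rw [List.getElem?_append_right (by omega), List.getElem?_cons, if_neg (by omega)] at hw
      have := hV w (List.mem_of_getElem? hw)
      omega
    have hUle : ∀ v, D[U.length]? = some v → v < y := by
      intro v hv
      cases h' with
      | append _ D hD' =>
        have h₁ := hq D.length (by simp)
        have h₂ := (List.getElem?_eq_some_iff.1 hv).1
        omega
      | replace _ z U₂ V₂ hU₂ hz =>
        have h₁ := hq U₂.length (by simp)
        rw [List.getElem?_append_right (by omega)] at hv
        have h₂ := List.mem_of_getElem? hv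
        rcases List.mem_cons.1 h₂ with rfl | h₂
        · exact hz
        · have := (List.pairwise_cons.1 (List.pairwise_append.1 hD).2.1).1 v h₂
          omega
      | keep z U₂ V₂ =>
        have h₁ := hq U₂.length (by simp)
        rcases h₁.lt_or_eq with h₁ | h₁
        · rw [List.getElem?_append_right (by omega), List.getElem?_cons, if_neg (by omega)] at hv
          exact (List.pairwise_cons.1 (List.pairwise_append.1 hD).2.1).1 v (List.mem_of_getElem? hv)
        -- Here `y = z + 1`, and the left neighbour of `z` would lie strictly between the two.
        · obtain ⟨w, hw, hlt⟩ := hCD (U₂.length + 1) z (by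
            rw [List.getElem?_append_right (by omega)]; simp)
          rw [List.getElem?_append_right (by omega), List.getElem?_cons, if_neg (by omega)] at hw
          have := hV w (List.mem_of_getElem? hw)
          omega
    intro r v hv
    by_cases hr : r = U.length
    · subst hr
      exact ⟨y, by rw [List.getElem?_append_right le_rfl]; simp, hUle v hv⟩
    · obtain ⟨w, hw, hlt⟩ := hmain r v hv
      refine ⟨w, ?_, hlt⟩
      rw [← hw, List.getElem?_append, List.getElem?_append]
      split_ifs with h₁
      · rfl
      · rw [List.getElem?_cons, List.getElem?_cons, if_neg (by omega), if_neg (by omega)]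

/-- Reverse bumping runs from the corner to the left. A letter leaving a column finds a larger entry
in the previous column because that column dominates. -/
theorem exists_EGIns_reverse {T' : Tableau} {c : ℕ} (hT' : IsDecreasing T')
    (hr : IsReducedWord (word T')) (hc : IsCorner (colLengths T') c) :
    ∃ x T, EGIns x T T' c ∧ IsDecreasing T := by
  induction T' generalizing c with
  | nil => simp [colLengths, IsCorner] at hc
  | cons C' R' ih =>
    obtain ⟨⟨h₁, h₂, h₃⟩, h₄, h₅⟩ := isDecreasing_cons.1 hT'
    cases c with
    | zero =>
      have hlen : (R'.headD []).length < C'.length := by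
        cases R' with
        | nil => simpa [colLengths, IsCorner] using hc
        | cons D R' => simpa [colLengths, IsCorner] using hc
      obtain ⟨C, x, rfl⟩ : ∃ C x, C' = C ++ [x] := by
        rcases List.eq_nil_or_concat C' with rfl | ⟨C, x, rfl⟩
        · simp at hlen
        · exact ⟨C, x, by simp⟩
      rcases C.eq_nil_or_concat with rfl | hne
      · have : R' = [] := by
          cases R' with
          | nil => rfl
          | cons D R' =>
            have := (isDecreasing_cons.1 h₅).1.1
            simp at hlen
            tauto
        subst this
        exact ⟨x, [], .nil x, isDecreasing_nil⟩
      · refine ⟨x, C :: R', .append x C _ R' (.append x C ?_), ?_⟩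
        · intro u hu
          exact (List.pairwise_append.1 h₃).2.2 u hu x (by simp)
        · refine isDecreasing_cons.2 ⟨⟨?_, ?_, (List.pairwise_append.1 h₃).1⟩, ?_, h₅⟩
          · rintro rfl
            obtain ⟨_, _, h⟩ := hne
            simp at h
          · exact fun z hz => h₂ z (by simp [hz])
          · refine ⟨by rw [List.length_append, List.length_singleton] at hlen; omega, fun r hr => ?_⟩
            have := h₄.2 r hr
            rwa [List.getD_append _ _ _ _ (by rw [List.length_append, List.length_singleton] at hlen; omega)] at this
    | succ c =>
      rw [word_cons] at hr
      obtain ⟨y, T, hy, hT⟩ := ih (c := c) h₅ hr.right (by simpa [colLengths, IsCorner] using hc)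
      obtain ⟨o, ho⟩ := hy.head_colStep
      have hr₁ : IsReducedWord (C'.reverse ++ y :: word T) :=
        ((hy.nilplactic hT.sorted).symm.append_left C'.reverse).isReducedWord hr
      obtain ⟨C, x, hx, hC⟩ := exists_colStep_reverse (y := y) h₃
        (IsReducedWord.left (v := word T) (by simpa using hr₁)) (by
          obtain ⟨q, hq⟩ := List.mem_iff_getElem?.1 ho.mem_new
          obtain ⟨w, hw, hlt⟩ := dominates_iff.1 h₄ q y hq
          exact ⟨w, List.mem_of_getElem? hw, hlt⟩)
      have hins : EGIns x (C :: T) (C' :: R') (c + 1) := .bump x y C C' T R' c hx hy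
      have hsort : ∀ D ∈ C :: T, D.Pairwise (· > ·) := by
        intro D hD
        rcases List.mem_cons.1 hD with rfl | hD
        exacts [hC, hT.sorted D hD]
      have hr₂ := (hins.nilplactic hsort).symm.isReducedWord (by rwa [word_cons])
      refine ⟨x, C :: T, hins, isDecreasing_cons.2 ⟨⟨List.ne_nil_of_mem hx.mem_out.1, ?_, hC⟩,
        hx.dominates_old ho hC hT.headD_sorted h₄, hT⟩⟩
      intro z hz
      exact hr₂.1 z (by simp [word_cons, hz])

theorem EGIns.injective {x₁ x₂ : ℕ} {T₁ T₂ T' : Tableau} {c : ℕ} (h₁ : EGIns x₁ T₁ T' c)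
    (h₂ : EGIns x₂ T₂ T' c) (hT₁ : IsDecreasing T₁) (hT₂ : IsDecreasing T₂) :
    x₁ = x₂ ∧ T₁ = T₂ := by
  induction h₁ generalizing x₂ T₂ with
  | nil x =>
    cases h₂ with
    | nil => exact ⟨rfl, rfl⟩
    | append _ C _ _ h =>
      have := h.lt_of_none.1
      have hC := (isDecreasing_cons.1 hT₂).1.1
      rw [eq_comm, List.append_eq_singleton_iff] at this
      simp_all
  | append x C C' R h =>
    cases h₂ with
    | nil =>
      have := h.lt_of_none.1
      have hC := (isDecreasing_cons.1 hT₁).1.1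
      rw [eq_comm, List.append_eq_singleton_iff] at this
      simp_all
    | append _ C₂ _ _ h₂ =>
      have := h.lt_of_none.1.symm.trans h₂.lt_of_none.1
      rw [List.append_eq_append_iff] at this
      have h₃ := List.append_inj' (h.lt_of_none.1.symm.trans h₂.lt_of_none.1) rfl
      simp only [List.cons.injEq, and_true] at h₃
      exact ⟨h₃.2, by rw [h₃.1]⟩
  | bump x y C C' R R' c h h' ih =>
    cases h₂ with
    | bump _ y₂ C₂ _ R₂ _ _ h₂ h₂' =>
      obtain ⟨rfl, rfl⟩ := ih h₂' (isDecreasing_cons.1 hT₁).2.2 (isDecreasing_cons.1 hT₂).2.2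
      obtain ⟨rfl, rfl⟩ := h.injective h₂ (hT₁.sorted _ (by simp)) (hT₂.sorted _ (by simp))
      exact ⟨rfl, rfl⟩

/-! ## Hecke insertion agrees with Edelman-Greene insertion on reduced words -/

theorem ColStep.isDecreasing_cons {x : ℕ} {C C' : List ℕ} {o : Option ℕ} {R : Tableau}
    (h : ColStep x C C' o) (hx : 0 < x) (hR : IsDecreasing (C :: R)) : IsDecreasing (C' :: R) := by
  obtain ⟨⟨h₁, h₂, h₃⟩, h₄, h₅⟩ := NilKey.isDecreasing_cons.1 hR
  refine NilKey.isDecreasing_cons.2 ⟨⟨List.ne_nil_of_mem h.mem_new, ?_, h.sorted h₃⟩, ?_, h₅⟩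
  · intro z hz
    rcases h.mem_of_mem_new hz with rfl | hz
    exacts [hx, h₂ z hz]
  · rw [dominates_iff] at h₄ ⊢
    intro r v hv
    obtain ⟨w, hw, hlt⟩ := h₄ r v hv
    obtain ⟨w', hw', hle⟩ := h.le_new r w hw
    exact ⟨w', hw', by omega⟩

/-- Hecke insertion tests the whole tableau, so the hypothesis on `L` carries the guarantee that the
columns already passed fit whatever the next step produces. In the `keep` case the replacement would
repeat an entry, so both algorithms leave the column alone. -/
theorem EGIns.heckeAux_eq {x : ℕ} {R R' : Tableau} {c : ℕ} (h : EGIns x R R' c) (hx : 0 < x)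
    (hR : IsDecreasing R) (L : Tableau)
    (hL : ∀ C' o, ColStep x (R.headD []) C' o →
      ∀ S, IsDecreasing (C' :: S) → IsDecreasing (L ++ C' :: S)) :
    ∃ r, heckeAux L x R = (L ++ R', (r, L.length + c), true) := by
  induction h generalizing L with
  | nil x => exact ⟨0, rfl⟩
  | append x C C' R h =>
    have hd : IsDecreasing (L ++ (C ++ [x]) :: R) :=
      h.lt_of_none.1 ▸ hL C' none h R (h.isDecreasing_cons hx hR)
    refine ⟨C.length, ?_⟩
    simp only [heckeAux, h.find_none, if_pos hd, h.lt_of_none.1, Nat.add_zero]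
  | bump x y C C' R R' c h h' ih =>
    obtain ⟨⟨h₁, h₂, h₃⟩, h₄, h₅⟩ := NilKey.isDecreasing_cons.1 hR
    obtain ⟨hf, hC'⟩ := h.find_some h₃
    have hstep : heckeAux L x (C :: R) = heckeAux (L ++ [C']) y R := by
      simp only [heckeAux, hf]
      split_ifs at hC' with hk
      · rw [if_neg, hC']
        intro hd
        have hs := hd.sorted (replaceEntry y x C) (by simp)
        have hnd : (replaceEntry y x C).Nodup := hs.imp fun h => ne_of_gt h
        have := List.inj_on_of_nodup_map hnd hk.2 h.mem_out.1
        simp at this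
        omega
      · rw [if_pos, hC']
        rw [← hC']
        exact hL C' _ h R (h.isDecreasing_cons hx hR)
    obtain ⟨r, hr⟩ := ih (h₂ y h.mem_out.1) h₅ (L ++ [C']) (by
      intro C'' o ho S hS
      rw [List.append_assoc, List.singleton_append]
      refine hL C' _ h _ (NilKey.isDecreasing_cons.2 ⟨⟨List.ne_nil_of_mem h.mem_new, ?_,
        h.sorted h₃⟩, ?_, hS⟩)
      · intro z hz
        rcases h.mem_of_mem_new hz with rfl | hz
        exacts [hx, h₂ z hz]
      · exact h.dominates ho h₃ h₅.headD_sorted h₄)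
    refine ⟨r, ?_⟩
    rw [hstep, hr]
    simp
    omega

theorem toSV_appendBox (Q : Tableau) (c i : ℕ) :
    toSV (appendBox Q c i) = appendBox (toSV Q) c {i} := by
  induction Q generalizing c with
  | nil => simp [appendBox_nil, toSV]
  | cons C Q ih =>
    cases c with
    | zero => simp [appendBox_cons_zero, toSV]
    | succ c =>
      have := ih c
      simp only [toSV] at this
      simp [appendBox_cons_succ, toSV, this]

theorem EGIns.insertStep_eq {x i : ℕ} {P P' Q : Tableau} {c : ℕ} (h : EGIns x P P' c)
    (hx : 0 < x) (hP : IsDecreasing P) :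
    insertStep (P, toSV Q) (x, i) = Prod.map id toSV (egStep (P, Q) (x, i)) := by
  obtain ⟨r, hr⟩ := h.heckeAux_eq hx hP [] (fun _ _ _ _ hS => hS)
  simp only [List.nil_append, List.length_nil, Nat.zero_add] at hr
  simp only [insertStep, heckeInsert, hr, egStep, h.eq hP.sorted, Prod.map, id, toSV_appendBox]

/-! ## Recording tableaux -/

/-- Weak version of `Dominates`. -/
def WeaklyDominates (C D : List ℕ) : Prop :=
  D.length ≤ C.length ∧ ∀ r < D.length, D.getD r 0 ≤ C.getD r 0

theorem weaklyDominates_nil (C : List ℕ) : WeaklyDominates C [] := by simp [WeaklyDominates]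

theorem isRSSYT_nil : IsRSSYT [] := by simp [IsRSSYT]

theorem isRSSYT_cons {C : List ℕ} {R : Tableau} :
    IsRSSYT (C :: R) ↔ (C ≠ [] ∧ (∀ x ∈ C, 0 < x) ∧ C.Pairwise (· > ·)) ∧
      WeaklyDominates C (R.headD []) ∧ IsRSSYT R := by
  unfold IsRSSYT
  cases R with
  | nil => simp [weaklyDominates_nil]
  | cons D R =>
    simp only [List.mem_cons, List.isChain_cons_cons, List.headD_cons, forall_eq_or_imp,
      WeaklyDominates]
    tauto

theorem flatten_appendBox {α : Type} (Q : List (List α)) (c : ℕ) (i : α) :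
    (appendBox Q c i).flatten.Perm (i :: Q.flatten) := by
  induction Q generalizing c with
  | nil => simp [appendBox_nil]
  | cons C Q ih =>
    cases c with
    | zero =>
      rw [appendBox_cons_zero, List.flatten_cons, List.flatten_cons, List.append_assoc,
        List.singleton_append]
      exact List.perm_middle
    | succ c =>
      rw [appendBox_cons_succ, List.flatten_cons, List.flatten_cons]
      exact ((ih c).append_left C).trans List.perm_middle

theorem headD_appendBox (Q : Tableau) (c i : ℕ) :
    (appendBox Q c i).headD [] = Q.headD [] ∨ (appendBox Q c i).headD [] = Q.headD [] ++ [i] := by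
  cases Q with
  | nil => simp [appendBox_nil]
  | cons C Q => cases c <;> simp [appendBox_cons_zero, appendBox_cons_succ]

theorem drop_appendBox {Q : Tableau} {c d i : ℕ} (h : c < d) (hc : c ≤ Q.length) :
    (appendBox Q c i).drop d = Q.drop d := by
  induction Q generalizing c d with
  | nil =>
    obtain ⟨d, rfl⟩ : ∃ d', d = d' + 1 := ⟨d - 1, by omega⟩
    simp [appendBox_nil]
  | cons C Q ih =>
    obtain ⟨d, rfl⟩ : ∃ d', d = d' + 1 := ⟨d - 1, by omega⟩
    cases c with
    | zero => simp [appendBox_cons_zero]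
    | succ c =>
      simp only [appendBox_cons_succ, List.drop_succ_cons]
      exact ih (by omega) (by simpa using hc)

theorem IsRSSYT.ne_nil {Q : Tableau} (hQ : IsRSSYT Q) : ∀ C ∈ Q, C ≠ [] :=
  fun C hC => (hQ.1 C hC).1

/-- A new box containing `i` in column `c` of `Q` is the last one that contains the smallest entry
of the tableau. -/
structure IsMinBox (Q : Tableau) (c i : ℕ) : Prop where
  ne_nil : ∀ C ∈ Q, C ≠ []
  le_length : c ≤ Q.length
  le : ∀ z ∈ Q.flatten, i ≤ z
  lt : ∀ z ∈ (Q.drop c).flatten, i < z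

theorem IsMinBox.isRSSYT {Q : Tableau} {c i : ℕ} (h : IsMinBox Q c i) (hQ : IsRSSYT Q)
    (hi : 0 < i) (hs : (addBox (colLengths Q) c).Pairwise (· ≥ ·)) :
    IsRSSYT (appendBox Q c i) := by
  induction Q generalizing c with
  | nil => simp [appendBox_nil, isRSSYT_cons, weaklyDominates_nil, isRSSYT_nil, hi]
  | cons C Q ih =>
    obtain ⟨⟨h₁, h₂, h₃⟩, h₄, h₅⟩ := isRSSYT_cons.1 hQ
    cases c with
    | zero =>
      rw [appendBox_cons_zero, isRSSYT_cons]
      refine ⟨⟨by simp, ?_, ?_⟩, ⟨?_, ?_⟩, h₅⟩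
      · intro x hx
        rcases List.mem_append.1 hx with hx | hx
        · exact h₂ x hx
        · simp at hx; omega
      · rw [List.pairwise_append]
        refine ⟨h₃, by simp, fun a ha b hb => ?_⟩
        have := h.lt a (by simp [ha])
        simp at hb
        omega
      · have := h₄.1
        rw [List.length_append]
        omega
      · intro r hr
        have := h₄.2 r hr
        rwa [List.getD_append _ _ _ _ (by have := h₄.1; omega)]
    | succ c =>
      have hbox : IsMinBox Q c i := ⟨fun D hD => h.ne_nil D (by simp [hD]),
        by simpa using h.le_length, fun z hz => h.le z (by
          rw [List.flatten_cons]; exact List.mem_append_right _ hz), by simpa using h.lt⟩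
      rw [appendBox_cons_succ, isRSSYT_cons]
      simp only [colLengths, List.map_cons, addBox, List.pairwise_cons] at hs
      refine ⟨⟨h₁, h₂, h₃⟩, ?_, ih hbox h₅ hs.2⟩
      have hlen : ((appendBox Q c i).headD []).length ≤ C.length := by
        have := length_appendBox Q c i
        cases hA : appendBox Q c i with
        | nil => simp
        | cons D A =>
          rw [hA] at this
          exact hs.1 _ (by rw [← this]; simp)
      refine ⟨hlen, fun r hr => ?_⟩
      rcases headD_appendBox Q c i with hh | hh
      · rw [hh] at hr ⊢
        exact h₄.2 r hr
      · rw [hh] at hr hlen ⊢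
        rw [List.length_append, List.length_singleton] at hr hlen
        rcases Nat.lt_or_ge r (Q.headD []).length with h' | h'
        · rw [List.getD_append _ _ _ _ h']
          exact h₄.2 r h'
        · obtain rfl : r = (Q.headD []).length := by omega
          have hC : C.getD (Q.headD []).length 0 ∈ C := by
            rw [List.getD_eq_getElem C _ (by omega)]
            exact List.getElem_mem _
          rw [List.getD_append_right _ _ _ _ le_rfl, Nat.sub_self, List.getD_cons_zero]
          exact h.le _ (by
            rw [List.flatten_cons]
            exact List.mem_append_left _ hC)

/-- The added box is the bottom of the last column containing `i`, so it can be read off from the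
result. -/
theorem IsMinBox.eq_of_appendBox_eq {Q₁ Q₂ : Tableau} {c₁ c₂ i : ℕ} (h₁ : IsMinBox Q₁ c₁ i)
    (h₂ : IsMinBox Q₂ c₂ i) (h : appendBox Q₁ c₁ i = appendBox Q₂ c₂ i) :
    Q₁ = Q₂ ∧ c₁ = c₂ := by
  have tail : ∀ {C : List ℕ} {Q : Tableau} {c : ℕ}, IsMinBox (C :: Q) (c + 1) i →
      IsMinBox Q c i := fun {C Q c} h => ⟨fun D hD => h.ne_nil D (by simp [hD]),
        by simpa using h.le_length, fun z hz => h.le z (by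
          rw [List.flatten_cons]; exact List.mem_append_right _ hz), by simpa using h.lt⟩
  have hne : ∀ (Q : Tableau) (c : ℕ), appendBox Q c i ≠ [] := by
    intro Q c hQ
    have := flatten_appendBox Q c i
    rw [hQ] at this
    simp at this
  have hmem : ∀ (C : List ℕ) (Q Q' : Tableau) (c : ℕ), IsMinBox (C :: Q) 0 i →
      Q ≠ appendBox Q' c i := by
    rintro C Q Q' c hQ rfl
    have := hQ.lt i (by
      rw [List.drop_zero, List.flatten_cons]
      exact List.mem_append_right _ ((flatten_appendBox Q' c i).mem_iff.2 (by simp)))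
    omega
  induction Q₁ generalizing Q₂ c₁ c₂ with
  | nil =>
    have hc₁ : c₁ = 0 := by simpa using h₁.le_length
    rw [appendBox_nil] at h
    cases Q₂ with
    | nil => exact ⟨rfl, by have := h₂.le_length; simp at this; omega⟩
    | cons D Q₂ =>
      cases c₂ with
      | zero =>
        rw [appendBox_cons_zero] at h
        have := h₂.ne_nil D (by simp)
        have h := (List.cons.inj h).1
        rw [eq_comm, List.append_eq_singleton_iff] at h
        simp_all
      | succ c₂ =>
        rw [appendBox_cons_succ] at h
        exact absurd (List.cons.inj h).2.symm (hne _ _)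
  | cons C Q₁ ih =>
    cases Q₂ with
    | nil =>
      have hc₂ : c₂ = 0 := by simpa using h₂.le_length
      rw [appendBox_nil] at h
      cases c₁ with
      | zero =>
        rw [appendBox_cons_zero] at h
        have := h₁.ne_nil C (by simp)
        have h := (List.cons.inj h).1
        rw [List.append_eq_singleton_iff] at h
        simp_all
      | succ c₁ =>
        rw [appendBox_cons_succ] at h
        exact absurd (List.cons.inj h).2 (hne _ _)
    | cons D Q₂ =>
      cases c₁ with
      | zero =>
        cases c₂ with
        | zero =>
          rw [appendBox_cons_zero, appendBox_cons_zero] at h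
          obtain ⟨h', rfl⟩ := List.cons.inj h
          exact ⟨by rw [List.append_cancel_right h'], rfl⟩
        | succ c₂ =>
          rw [appendBox_cons_zero, appendBox_cons_succ] at h
          exact absurd (List.cons.inj h).2 (hmem C Q₁ Q₂ c₂ h₁)
      | succ c₁ =>
        cases c₂ with
        | zero =>
          rw [appendBox_cons_zero, appendBox_cons_succ] at h
          exact absurd (List.cons.inj h).2.symm (hmem D Q₂ Q₁ c₁ h₂)
        | succ c₂ =>
          rw [appendBox_cons_succ, appendBox_cons_succ] at h
          obtain ⟨rfl, h'⟩ := List.cons.inj h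
          obtain ⟨rfl, rfl⟩ := ih (tail h₁) (tail h₂) h'
          exact ⟨rfl, rfl⟩

/-- In the last column containing the minimum `i`, it stands at the bottom, and the next column is
shorter: an entry to the right of it would be at most `i` and yet exceed `i`. -/
theorem exists_appendBox {Q : Tableau} (hQ : IsRSSYT Q) {i : ℕ} (hi : i ∈ Q.flatten)
    (hmin : ∀ z ∈ Q.flatten, i ≤ z) :
    ∃ Q₀ c, Q = appendBox Q₀ c i ∧ IsRSSYT Q₀ ∧ IsMinBox Q₀ c i ∧ IsCorner (colLengths Q) c := by
  induction Q with
  | nil => simp at hi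
  | cons C Q ih =>
    obtain ⟨⟨h₁, h₂, h₃⟩, h₄, h₅⟩ := isRSSYT_cons.1 hQ
    rw [List.flatten_cons] at hi hmin
    by_cases hiQ : i ∈ Q.flatten
    · obtain ⟨Q₀, c, rfl, hQ₀, hbox, hc⟩ :=
        ih h₅ hiQ fun z hz => hmin z (List.mem_append_right _ hz)
      refine ⟨C :: Q₀, c + 1, by rw [appendBox_cons_succ], ?_, ⟨?_, ?_, ?_, ?_⟩, ?_⟩
      · refine isRSSYT_cons.2 ⟨⟨h₁, h₂, h₃⟩, ?_, hQ₀⟩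
        rcases headD_appendBox Q₀ c i with hh | hh
        · rwa [hh] at h₄
        · rw [hh] at h₄
          have hl := h₄.1
          rw [List.length_append] at hl
          refine ⟨by omega, fun r hr => ?_⟩
          have := h₄.2 r (by rw [List.length_append]; omega)
          rwa [List.getD_append _ _ _ _ hr] at this
      · intro D hD
        rcases List.mem_cons.1 hD with rfl | hD
        exacts [h₁, hbox.ne_nil D hD]
      · simpa using hbox.le_length
      · intro z hz
        rw [List.flatten_cons] at hz
        rcases List.mem_append.1 hz with hz | hz
        exacts [hmin z (List.mem_append_left _ hz), hbox.le z hz]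
      · simpa using hbox.lt
      · simpa [colLengths, IsCorner] using hc
    · have hiC : i ∈ C := by simpa [hiQ] using hi
      have hlt : ∀ z ∈ Q.flatten, i < z := fun z hz =>
        lt_of_le_of_ne (hmin z (List.mem_append_right _ hz)) fun h => hiQ (h ▸ hz)
      obtain ⟨D, d, rfl⟩ : ∃ D d, C = D ++ [d] := by
        rcases List.eq_nil_or_concat C with rfl | ⟨D, d, rfl⟩
        · exact absurd rfl h₁
        · exact ⟨D, d, by simp⟩
      have hD : ∀ a ∈ D, d < a := fun a ha => (List.pairwise_append.1 h₃).2.2 a ha d (by simp)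
      obtain rfl : d = i := by
        have h₆ := hmin d (by simp)
        rcases List.mem_append.1 hiC with h | h
        · have := hD i h
          omega
        · exact (List.mem_singleton.1 h).symm
      have hlen : (Q.headD []).length ≤ D.length := by
        by_contra hc
        have h₆ := h₄.2 D.length (by omega)
        rw [List.getD_append_right _ _ _ _ le_rfl, List.getD_eq_getElem _ _ (by omega)] at h₆
        have h₇ := hlt ((Q.headD [])[D.length]) (by
          cases Q with
          | nil => simp at hc
          | cons E Q =>
            rw [List.flatten_cons]
            exact List.mem_append_left _ (List.getElem_mem _))
        simp at h₆
        simp at h₇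
        omega
      have hcorner : IsCorner (colLengths ((D ++ [d]) :: Q)) 0 := by
        cases Q with
        | nil => simp [colLengths, IsCorner]
        | cons E Q =>
          simp only [List.headD_cons] at hlen
          simp [colLengths, IsCorner]
          omega
      rcases D with _ | ⟨e, D⟩
      · have : Q = [] := by
          cases Q with
          | nil => rfl
          | cons E Q =>
            have := (isRSSYT_cons.1 h₅).1.1
            simp at hlen
            tauto
        subst this
        exact ⟨[], 0, by simp [appendBox_nil], isRSSYT_nil,
          ⟨by simp, by simp, by simp, by simp⟩, hcorner⟩
      · refine ⟨(e :: D) :: Q, 0, by rw [appendBox_cons_zero], ?_, ⟨?_, by simp, ?_, ?_⟩, hcorner⟩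
        · refine isRSSYT_cons.2 ⟨⟨by simp, fun x hx => h₂ x (List.mem_append_left _ hx),
            (List.pairwise_append.1 h₃).1⟩, ⟨hlen, fun r hr => ?_⟩, h₅⟩
          have := h₄.2 r hr
          rwa [List.getD_append _ _ _ _ (by omega)] at this
        · intro E hE
          rcases List.mem_cons.1 hE with rfl | hE
          exacts [by simp, h₅.ne_nil E hE]
        · intro z hz
          rw [List.flatten_cons] at hz
          rcases List.mem_append.1 hz with hz | hz
          exacts [(hD z hz).le, (hlt z hz).le]
        · intro z hz
          rw [List.drop_zero, List.flatten_cons] at hz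
          rcases List.mem_append.1 hz with hz | hz
          exacts [hD z hz, hlt z hz]

/-- Zero entries must be excluded: `[]` and `[0]` both become `[1]`. -/
theorem addBox_injective {l₁ l₂ : List ℕ} {c : ℕ} (h : addBox l₁ c = addBox l₂ c)
    (h₁ : ∀ n ∈ l₁, n ≠ 0) (h₂ : ∀ n ∈ l₂, n ≠ 0) : l₁ = l₂ := by
  have hne : ∀ l c, addBox l c ≠ [] := by
    intro l c
    cases l <;> cases c <;> simp [addBox]
  induction l₁ generalizing l₂ c with
  | nil =>
    cases l₂ with
    | nil => rfl
    | cons n l₂ =>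
      cases c with
      | zero => simp [addBox] at h; simp_all
      | succ c =>
        simp only [addBox, List.cons.injEq] at h
        exact absurd h.2.symm (hne _ _)
  | cons n l₁ ih =>
    cases l₂ with
    | nil =>
      cases c with
      | zero => simp [addBox] at h; simp_all
      | succ c =>
        simp only [addBox, List.cons.injEq] at h
        exact absurd h.2 (hne _ _)
    | cons m l₂ =>
      cases c with
      | zero =>
        simp only [addBox, List.cons.injEq] at h
        rw [h.2, show n = m by omega]
      | succ c =>
        simp only [addBox, List.cons.injEq] at h
        rw [h.1, ih h.2 (fun k hk => h₁ k (by simp [hk])) fun k hk => h₂ k (by simp [hk])]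

theorem IsDecreasing.pairwise_colLengths {T : Tableau} (hT : IsDecreasing T) :
    (colLengths T).Pairwise (· ≥ ·) := by
  rw [← List.isChain_iff_pairwise, colLengths, List.isChain_map]
  exact hT.2.imp fun _ _ h => h.1

/-! ## The Edelman-Greene correspondence on factorizations -/

/-- The order on pairs (letter, index): increasing indices, and decreasing letters for equal
indices. -/
def PairLT (p q : ℕ × ℕ) : Prop := p.2 < q.2 ∨ (p.2 = q.2 ∧ q.1 < p.1)

/-- A reduced word cut into decreasing factors, given by pairs (letter, index of the factor).
This is a compatible pair of words read backwards. -/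
structure IsFactorization (l : List (ℕ × ℕ)) : Prop where
  pairwise : l.Pairwise PairLT
  pos : ∀ p ∈ l, 0 < p.2
  reduced : IsReducedWord (l.map Prod.fst)

theorem IsFactorization.tail {p : ℕ × ℕ} {l : List (ℕ × ℕ)} (h : IsFactorization (p :: l)) :
    IsFactorization l :=
  ⟨h.pairwise.of_cons, fun q hq => h.pos q (List.mem_cons_of_mem _ hq),
    IsReducedWord.tail (by simpa using h.reduced)⟩

/-- The Edelman-Greene correspondence, in terms of factorizations. -/
def factRSK (l : List (ℕ × ℕ)) : Tableau × Tableau := l.foldr (fun p t => egStep t p) ([], [])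

theorem factRSK_cons (p : ℕ × ℕ) (l : List (ℕ × ℕ)) :
    factRSK (p :: l) = egStep (factRSK l) p := rfl

/-- The properties of the tableaux of a factorization. -/
structure FactRSKSpec (l : List (ℕ × ℕ)) : Prop where
  isDecreasing : IsDecreasing (factRSK l).1
  nilplactic : Nilplactic (l.map Prod.fst) (word (factRSK l).1)
  colLengths : colLengths (factRSK l).1 = colLengths (factRSK l).2
  isRSSYT : IsRSSYT (factRSK l).2
  perm : (factRSK l).2.flatten.Perm (l.map Prod.snd)

theorem FactRSKSpec.exists_ins {x i : ℕ} {l : List (ℕ × ℕ)} (h : FactRSKSpec l)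
    (hl : IsFactorization ((x, i) :: l)) :
    ∃ P c, EGIns x (factRSK l).1 P c ∧ factRSK ((x, i) :: l) = (P, appendBox (factRSK l).2 c i) := by
  obtain ⟨P, c, hP⟩ := exists_EGIns (x := x) h.isDecreasing.sorted
    ((h.nilplactic.append_left [x]).isReducedWord hl.reduced)
  refine ⟨P, c, hP, ?_⟩
  rw [factRSK_cons, egStep, hP.eq h.isDecreasing.sorted]

theorem FactRSKSpec.cons {x i : ℕ} {l : List (ℕ × ℕ)} (h : FactRSKSpec l)
    (hl : IsFactorization ((x, i) :: l)) {P : Tableau} {c : ℕ} (hP : EGIns x (factRSK l).1 P c)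
    (he : factRSK ((x, i) :: l) = (P, appendBox (factRSK l).2 c i))
    (hbox : IsMinBox (factRSK l).2 c i) : FactRSKSpec ((x, i) :: l) := by
  have hdec := hP.isDecreasing (hl.reduced.1 x (by simp)) h.isDecreasing
  have hlen := hP.colLengths
  rw [h.colLengths] at hlen
  refine ⟨?_, ?_, ?_, ?_, ?_⟩ <;> rw [he]
  · exact hdec
  · exact (h.nilplactic.append_left [x]).trans (hP.nilplactic h.isDecreasing.sorted)
  · exact hlen.trans (length_appendBox _ _ _).symm
  · exact hbox.isRSSYT h.isRSSYT (hl.pos (x, i) (by simp)) (hlen ▸ hdec.pairwise_colLengths)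
  · exact (flatten_appendBox _ _ _).trans (h.perm.cons i)

/-- The claims are proved together because the place of the next box depends on the last insertion.
A smaller index is below every entry; an equal index comes with a larger letter, and then
`EGIns.lt_of_lt` puts its box strictly to the right of the last one. -/
theorem factRSKSpec_and_isMinBox (l : List (ℕ × ℕ)) (hl : IsFactorization l) :
    FactRSKSpec l ∧ ∀ x i P c, IsFactorization ((x, i) :: l) → EGIns x (factRSK l).1 P c →
      IsMinBox (factRSK l).2 c i := by
  induction l with
  | nil =>
    refine ⟨⟨isDecreasing_nil, .refl _, rfl, isRSSYT_nil, .refl _⟩, ?_⟩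
    intro x i P c _ hP
    exact ⟨by simp [factRSK], hP.le_length, by simp [factRSK], by simp [factRSK]⟩
  | cons p l ih =>
    obtain ⟨y, j⟩ := p
    obtain ⟨ih₁, ih₂⟩ := ih hl.tail
    obtain ⟨P₀, c₀, hP₀, he⟩ := ih₁.exists_ins hl
    have hbox := ih₂ y j P₀ c₀ hl hP₀
    have hspec := ih₁.cons hl hP₀ he hbox
    refine ⟨hspec, fun x i P c hl' hP => ?_⟩
    rw [he] at hP ⊢
    have hle : ∀ z ∈ (appendBox (factRSK l).2 c₀ j).flatten, j ≤ z := by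
      intro z hz
      rcases List.mem_cons.1 ((flatten_appendBox _ _ _).mem_iff.1 hz) with rfl | hz
      exacts [le_rfl, hbox.le z hz]
    have hlen : c ≤ (appendBox (factRSK l).2 c₀ j).length := by
      have h₁ := hP.le_length
      have h₂ := congrArg List.length hspec.colLengths
      rw [he] at h₂
      simp only [colLengths, List.length_map] at h₂
      simp only at h₁ h₂ ⊢
      omega
    have hne : ∀ C ∈ appendBox (factRSK l).2 c₀ j, C ≠ [] := by
      have := hspec.isRSSYT.ne_nil
      rwa [he] at this
    have hlt := (List.pairwise_cons.1 hl'.pairwise).1 (y, j) (by simp)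
    rcases hlt with hij | ⟨hij, hxy⟩
    · simp only at hij
      refine ⟨hne, hlen, fun z hz => ?_, fun z hz => ?_⟩
      · have := hle z hz
        omega
      · have := hle z ((List.drop_sublist _ _).flatten.subset hz)
        omega
    · simp only at hij hxy
      subst hij
      have hc := hP₀.lt_of_lt hP hxy ih₁.isDecreasing.sorted
      refine ⟨hne, hlen, hle, fun z hz => ?_⟩
      rw [drop_appendBox hc hbox.le_length] at hz
      refine hbox.lt z ?_
      obtain ⟨d, rfl⟩ := Nat.exists_eq_add_of_lt hc
      rw [show c₀ + d + 1 = c₀ + (d + 1) by omega, ← List.drop_drop] at hz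
      exact (List.drop_sublist _ _).flatten.subset hz

theorem IsFactorization.spec {l : List (ℕ × ℕ)} (hl : IsFactorization l) : FactRSKSpec l :=
  (factRSKSpec_and_isMinBox l hl).1

theorem IsFactorization.exists_ins {x i : ℕ} {l : List (ℕ × ℕ)}
    (hl : IsFactorization ((x, i) :: l)) :
    ∃ P c, EGIns x (factRSK l).1 P c ∧
      factRSK ((x, i) :: l) = (P, appendBox (factRSK l).2 c i) ∧ IsMinBox (factRSK l).2 c i := by
  obtain ⟨P, c, h₁, h₂⟩ := hl.tail.spec.exists_ins hl
  exact ⟨P, c, h₁, h₂, (factRSKSpec_and_isMinBox l hl.tail).2 x i P c hl h₁⟩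

/-- The index inserted last is the minimum of `Q`, its box is the last one holding it, and reverse
insertion recovers the letter. -/
theorem factRSK_injective {l l' : List (ℕ × ℕ)} (hl : IsFactorization l)
    (hl' : IsFactorization l') (h : factRSK l = factRSK l') : l = l' := by
  induction l generalizing l' with
  | nil =>
    have := hl'.spec.perm
    rw [← h] at this
    have := this.length_eq
    simp [factRSK] at this
    exact (List.eq_nil_of_length_eq_zero this.symm).symm
  | cons p l ih =>
    obtain ⟨x, i⟩ := p
    obtain ⟨P, c, hP, he, hbox⟩ := hl.exists_ins
    cases l' with
    | nil =>
      have := hl.spec.perm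
      rw [h] at this
      have := this.length_eq
      simp [factRSK] at this
    | cons p' l' =>
      obtain ⟨x', i'⟩ := p'
      obtain ⟨P', c', hP', he', hbox'⟩ := hl'.exists_ins
      rw [he, he', Prod.mk.injEq] at h
      obtain ⟨rfl, hQ⟩ := h
      have hmin : ∀ {Q Q' : Tableau} {c c' i i' : ℕ}, IsMinBox Q c i →
          appendBox Q c i = appendBox Q' c' i' → i ≤ i' := by
        intro Q Q' c c' i i' hb h
        have h₁ : i' ∈ (appendBox Q c i).flatten := by
          rw [h]
          exact (flatten_appendBox _ _ _).mem_iff.2 (by simp)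
        rcases List.mem_cons.1 ((flatten_appendBox _ _ _).mem_iff.1 h₁) with rfl | h₁
        exacts [le_rfl, hb.le _ h₁]
      obtain rfl : i = i' := le_antisymm (hmin hbox hQ) (hmin hbox' hQ.symm)
      obtain ⟨hQ₀, rfl⟩ := hbox.eq_of_appendBox_eq hbox' hQ
      obtain ⟨rfl, hP₀⟩ := hP.injective hP' hl.tail.spec.isDecreasing hl'.tail.spec.isDecreasing
      rw [ih hl.tail hl'.tail (Prod.ext hP₀ hQ₀)]

/-- Strip the last box holding the minimum `i` and reverse insert. If the next pair has the same
index, its letter must be smaller: otherwise `EGIns.le_of_gt` would put the newer box weakly left of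
the older one, against the choice of the box. -/
theorem factRSK_surjective {P Q : Tableau} (hP : IsReducedDecreasing P) (hQ : IsRSSYT Q)
    (hs : colLengths P = colLengths Q) : ∃ l, IsFactorization l ∧ factRSK l = (P, Q) := by
  induction hn : Q.flatten.length generalizing P Q with
  | zero =>
    have hQ₀ : Q = [] := by
      cases Q with
      | nil => rfl
      | cons C Q =>
        have := (isRSSYT_cons.1 hQ).1.1
        simp at hn
        tauto
    subst hQ₀
    have hP₀ : P = [] := by simpa [colLengths] using hs
    subst hP₀
    exact ⟨[], ⟨by simp, by simp, isReducedWord_nil⟩, rfl⟩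
  | succ n ih =>
    obtain ⟨i, hi, hmin⟩ : ∃ i ∈ Q.flatten, ∀ z ∈ Q.flatten, i ≤ z := by
      have hne : Q.flatten.toFinset.Nonempty := by
        rw [List.toFinset_nonempty_iff]
        intro h
        rw [h] at hn
        simp at hn
      exact ⟨_, List.mem_toFinset.1 (Finset.min'_mem _ hne),
        fun z hz => Finset.min'_le _ z (List.mem_toFinset.2 hz)⟩
    obtain ⟨Q₀, c, rfl, hQ₀, hbox, hc⟩ := exists_appendBox hQ hi hmin
    obtain ⟨x, P₀, hx, hP₀⟩ := exists_EGIns_reverse hP.1 hP.2 (hs ▸ hc)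
    have hred : IsReducedWord (x :: word P₀) :=
      (hx.nilplactic hP₀.sorted).symm.isReducedWord hP.2
    have hs₀ : colLengths P₀ = colLengths Q₀ := by
      have h₁ := hx.colLengths.symm.trans (hs.trans (length_appendBox Q₀ c i))
      refine addBox_injective h₁ ?_ ?_
      · intro k hk
        obtain ⟨C, hC, rfl⟩ := List.mem_map.1 hk
        have := (hP₀.1 C hC).1
        simpa using this
      · intro k hk
        obtain ⟨C, hC, rfl⟩ := List.mem_map.1 hk
        have := hQ₀.ne_nil C hC
        simpa using this
    obtain ⟨l, hl, he⟩ := ih ⟨hP₀, hred.tail⟩ hQ₀ hs₀ (by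
      have := (flatten_appendBox Q₀ c i).length_eq
      simp only [List.length_cons] at this
      omega)
    have hredl : IsReducedWord (x :: l.map Prod.fst) := by
      have := hl.spec.nilplactic
      rw [he] at this
      exact (this.symm.append_left [x]).isReducedWord hred
    have hfact : IsFactorization ((x, i) :: l) := by
      have hlt : ∀ q, l.head? = some q → PairLT (x, i) q := by
        rintro ⟨y, j⟩ hq
        obtain ⟨l₀, rfl⟩ : ∃ l₀, l = (y, j) :: l₀ := by
          cases l with
          | nil => simp at hq
          | cons q l₀ => exact ⟨l₀, by simpa using hq⟩
        obtain ⟨P₁, c₁, hP₁, he₁, hbox₁⟩ := hl.exists_ins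
        rw [he, Prod.mk.injEq] at he₁
        obtain ⟨rfl, rfl⟩ := he₁
        have hij : i ≤ j := hbox.le j ((flatten_appendBox _ _ _).mem_iff.2 (by simp))
        rcases hij.lt_or_eq with hij | rfl
        · exact Or.inl hij
        · refine Or.inr ⟨rfl, ?_⟩
          simp only
          by_contra hc₂
          have hxy : x ≠ y := by
            rintro rfl
            exact not_isReducedWord_of_commute (x := x) (u := []) (v := l₀.map Prod.fst) (by simp)
              (by simpa using hredl)
          have h₁ := hP₁.le_of_gt hx (by omega) hl.tail.spec.isDecreasing.sorted
          have h₂ : i ∈ ((appendBox (factRSK l₀).2 c₁ i).drop c).flatten := by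
            rw [List.mem_flatten]
            have h₃ : ∀ (Q : Tableau) (c : ℕ), c ≤ Q.length →
                ∃ D, (appendBox Q c i)[c]? = some D ∧ i ∈ D := by
              intro Q c hc
              unfold appendBox
              split_ifs with h
              · exact ⟨Q[c] ++ [i], by simp [h], by simp⟩
              · exact ⟨[i], by rw [List.getElem?_append_right (by omega)]; simp [show c - Q.length = 0 by omega], by simp⟩
            obtain ⟨D, hD, hiD⟩ := h₃ (factRSK l₀).2 c₁ hbox₁.le_length
            refine ⟨D, ?_, hiD⟩
            have : ((appendBox (factRSK l₀).2 c₁ i).drop c)[c₁ - c]? = some D := by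
              rw [List.getElem?_drop, Nat.add_sub_cancel' h₁, hD]
            exact List.mem_of_getElem? this
          have := hbox.lt i h₂
          omega
      refine ⟨?_, ?_, hredl⟩
      · rw [List.pairwise_cons]
        refine ⟨?_, hl.pairwise⟩
        intro q hq
        cases l with
        | nil => simp at hq
        | cons q₀ l₀ =>
          have h₀ := hlt q₀ rfl
          rcases List.mem_cons.1 hq with rfl | hq
          · exact h₀
          · have h₁ := (List.pairwise_cons.1 hl.pairwise).1 q hq
            unfold PairLT at h₀ h₁ ⊢
            omega
      · intro q hq
        rcases List.mem_cons.1 hq with rfl | hq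
        · obtain ⟨C, hC, hiC⟩ := List.mem_flatten.1 hi
          exact (hQ.1 C hC).2.1 i hiC
        · exact hl.pos q hq
    refine ⟨(x, i) :: l, hfact, ?_⟩
    rw [factRSK_cons, he, egStep, hx.eq hP₀.sorted]

/-! ## Compatible pairs and factorizations -/

/-- The factorization of a compatible pair. -/
def toFact (p : List ℕ × List ℕ) : List (ℕ × ℕ) := (p.1.zip p.2).reverse

theorem egRSK_eq (p : List ℕ × List ℕ) : egRSK p = factRSK (toFact p) := by
  simp [egRSK, factRSK, toFact]

theorem toFact_map_fst {p : List ℕ × List ℕ} (h : p.1.length = p.2.length) :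
    (toFact p).map Prod.fst = p.1.reverse := by
  rw [toFact, List.map_reverse, List.map_fst_zip h.le]

theorem toFact_map_snd {p : List ℕ × List ℕ} (h : p.1.length = p.2.length) :
    (toFact p).map Prod.snd = p.2.reverse := by
  rw [toFact, List.map_reverse, List.map_snd_zip h.ge]

theorem IsCompatible.isFactorization {p : List ℕ × List ℕ} (h : IsCompatible p)
    (hr : IsReducedWord p.1) : IsFactorization (toFact p) := by
  have hl := h.length_eq
  refine ⟨?_, ?_, ?_⟩
  · rw [toFact, List.pairwise_reverse]
    have htr : IsTrans (ℕ × ℕ) (fun a b => PairLT b a) := ⟨by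
      intro a b c h₁ h₂
      unfold PairLT at *
      omega⟩
    rw [← List.isChain_iff_pairwise, List.isChain_iff_getElem]
    intro j hj
    rw [List.length_zip] at hj
    simp only [List.getElem_zip, PairLT]
    have h₁ := (List.pairwise_iff_getElem.1 h.weakly_decreasing) j (j + 1) (by omega) (by omega)
      (by omega)
    have h₂ := h.strict_of_eq j (by omega)
    rw [List.getD_eq_getElem _ _ (by omega), List.getD_eq_getElem _ _ (by omega),
      List.getD_eq_getElem _ _ (by omega), List.getD_eq_getElem _ _ (by omega)] at h₂
    omega
  · intro q hq
    exact h.pos_snd q.2 (List.of_mem_zip (List.mem_reverse.1 hq)).2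
  · rw [toFact_map_fst hl]
    exact hr.reverse

theorem IsFactorization.exists_compatible {l : List (ℕ × ℕ)} (h : IsFactorization l) :
    ∃ p, IsCompatible p ∧ IsReducedWord p.1 ∧ toFact p = l := by
  have hz : (l.reverse.map Prod.fst).zip (l.reverse.map Prod.snd) = l.reverse := by
    rw [← List.unzip_fst, ← List.unzip_snd, List.zip_unzip]
  have hp : l.reverse.Pairwise (fun a b => PairLT b a) := List.pairwise_reverse.2 h.pairwise
  have hred : IsReducedWord (l.reverse.map Prod.fst) := by
    rw [List.map_reverse]
    exact h.reduced.reverse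
  refine ⟨(l.reverse.map Prod.fst, l.reverse.map Prod.snd), ⟨by simp, hred.1, ?_, ?_, ?_⟩, hred, ?_⟩
  · intro x hx
    obtain ⟨q, hq, rfl⟩ := List.mem_map.1 hx
    exact h.pos q (List.mem_reverse.1 hq)
  · rw [List.pairwise_map]
    refine hp.imp ?_
    intro a b hab
    unfold PairLT at hab
    omega
  · intro j hj
    rw [List.length_map] at hj
    have := List.pairwise_iff_getElem.1 hp j (j + 1) (by omega) (by omega) (by omega)
    rw [List.getD_eq_getElem _ _ (by simpa using Nat.lt_of_succ_lt (by simpa using hj)),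
      List.getD_eq_getElem _ _ (by simpa using hj),
      List.getD_eq_getElem _ _ (by simpa using Nat.lt_of_succ_lt (by simpa using hj)),
      List.getD_eq_getElem _ _ (by simpa using hj)]
    simp only [List.getElem_map]
    unfold PairLT at this
    omega
  · rw [toFact, hz, List.reverse_reverse]

theorem toFact_injective {p q : List ℕ × List ℕ} (hp : p.1.length = p.2.length)
    (hq : q.1.length = q.2.length) (h : toFact p = toFact q) : p = q := by
  have h₁ := congrArg (List.map Prod.fst) h
  have h₂ := congrArg (List.map Prod.snd) h
  rw [toFact_map_fst hp, toFact_map_fst hq] at h₁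
  rw [toFact_map_snd hp, toFact_map_snd hq] at h₂
  exact Prod.ext (List.reverse_injective h₁) (List.reverse_injective h₂)

theorem isBounded_iff {p : List ℕ × List ℕ} (h : p.1.length = p.2.length) :
    IsBounded p ↔ ∀ q ∈ toFact p, q.2 ≤ q.1 := by
  rw [IsBounded, List.forall₂_iff_zip]
  simp only [toFact, List.mem_reverse]
  constructor
  · rintro ⟨-, h'⟩ ⟨a, b⟩ hq
    exact h' (by rw [← List.zip_swap]; exact List.mem_map.2 ⟨_, hq, rfl⟩)
  · refine fun h' => ⟨h.symm, fun {a b} hab => ?_⟩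
    rw [← List.zip_swap] at hab
    obtain ⟨⟨c, d⟩, hc, he⟩ := List.mem_map.1 hab
    cases he
    exact h' _ hc

theorem heckeRSK_eq {p : List ℕ × List ℕ} (h : IsCompatible p) (hr : IsReducedWord p.1) :
    heckeRSK p = Prod.map id toSV (egRSK p) := by
  have key : ∀ l : List (ℕ × ℕ), IsFactorization l →
      l.foldr (fun p t => insertStep t p) ([], []) = Prod.map id toSV (factRSK l) := by
    intro l hl
    induction l with
    | nil => rfl
    | cons q l ih =>
      obtain ⟨x, i⟩ := q
      obtain ⟨P, c, hP, -, -⟩ := hl.exists_ins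
      rw [List.foldr_cons, ih hl.tail, factRSK_cons]
      exact hP.insertStep_eq (hl.reduced.1 x (by simp)) hl.tail.spec.isDecreasing
  rw [egRSK_eq, ← key _ (h.isFactorization hr)]
  simp [heckeRSK, toFact]

/-! ## The star action -/

theorem starAct_cases (S : Finset ℕ) (m : ℕ) :
    (∃ u ∈ S, m ≤ u ∧ (∀ v ∈ S, m ≤ v → u ≤ v) ∧ starAct S m = insert m (S.erase u)) ∨
      ((∀ v ∈ S, v < m) ∧ starAct S m = insert m S) := by
  unfold starAct
  split_ifs with h
  · left
    have h₁ := Finset.min'_mem _ h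
    rw [Finset.mem_filter] at h₁
    exact ⟨_, h₁.1, h₁.2, fun v hv hmv => Finset.min'_le _ _ (Finset.mem_filter.2 ⟨hv, hmv⟩), rfl⟩
  · right
    refine ⟨fun v hv => ?_, rfl⟩
    by_contra hc
    exact h ⟨v, Finset.mem_filter.2 ⟨hv, by omega⟩⟩

theorem starAct_eq_of_least {S : Finset ℕ} {m u : ℕ} (hu : u ∈ S) (hm : m ≤ u)
    (h : ∀ v ∈ S, m ≤ v → u ≤ v) : starAct S m = insert m (S.erase u) := by
  rcases starAct_cases S m with ⟨u', hu', hm', h', he⟩ | ⟨h', -⟩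
  · rwa [le_antisymm (h u' hu' hm') (h' u hu hm)]
  · have := h' u hu
    omega

theorem starAct_eq_of_lt {S : Finset ℕ} {m : ℕ} (h : ∀ v ∈ S, v < m) :
    starAct S m = insert m S := by
  rcases starAct_cases S m with ⟨u', hu', hm', -, -⟩ | ⟨-, he⟩
  · have := h u' hu'
    omega
  · exact he

/-- The number of elements of `S` below `v`. -/
def countLT (S : Finset ℕ) (v : ℕ) : ℕ := (S.filter (· < v)).card

theorem countLT_mono (S : Finset ℕ) {v w : ℕ} (h : v ≤ w) : countLT S v ≤ countLT S w :=
  Finset.card_le_card fun x hx => by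
    rw [Finset.mem_filter] at hx ⊢
    exact ⟨hx.1, by omega⟩

theorem countLT_succ (S : Finset ℕ) (v : ℕ) :
    countLT S (v + 1) = countLT S v + if v ∈ S then 1 else 0 := by
  unfold countLT
  split_ifs with h
  · have : S.filter (· < v + 1) = insert v (S.filter (· < v)) := by
      ext x
      simp only [Finset.mem_filter, Finset.mem_insert]
      constructor
      · rintro ⟨h₁, h₂⟩
        by_cases hx : x = v
        · exact Or.inl hx
        · exact Or.inr ⟨h₁, by omega⟩
      · rintro (rfl | ⟨h₁, h₂⟩)
        · exact ⟨h, by omega⟩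
        · exact ⟨h₁, by omega⟩
    rw [this, Finset.card_insert_of_notMem (by simp)]
  · rw [Nat.add_zero]
    congr 1
    ext x
    simp only [Finset.mem_filter]
    constructor
    · rintro ⟨h₁, h₂⟩
      have : x ≠ v := fun he => h (he ▸ h₁)
      exact ⟨h₁, by omega⟩
    · rintro ⟨h₁, h₂⟩
      exact ⟨h₁, by omega⟩

theorem eq_of_countLT {S T : Finset ℕ} (h : ∀ v, countLT S v = countLT T v) : S = T := by
  ext v
  have h₁ := h (v + 1)
  rw [countLT_succ, countLT_succ, h v] at h₁
  split_ifs at h₁ <;> simp_all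

/-- Replacing the least `u ≥ m` by `m` raises the count by one exactly for `m < v ≤ u`, where the
old count is constant. Written with `max`, both branches of the action become one formula, and
relations between words become piecewise linear identities. -/
theorem countLT_starAct (S : Finset ℕ) (m v : ℕ) :
    countLT (starAct S m) v =
      if v ≤ m then countLT S v else max (countLT S v) (countLT S m + 1) := by
  have h₀ : countLT S 0 = 0 := by simp [countLT]
  have h₀' : countLT (starAct S m) 0 = 0 := by simp [countLT]
  rcases starAct_cases S m with ⟨u, hu, hm, hleast, he⟩ | ⟨hlt, he⟩
  · have hind : ∀ v, countLT (starAct S m) v = countLT S v + (if m < v ∧ v ≤ u then 1 else 0) := by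
      intro v
      induction v with
      | zero => simp [h₀, h₀']
      | succ v ih =>
        rw [countLT_succ, countLT_succ, ih, he]
        simp only [Finset.mem_insert, Finset.mem_erase]
        have : v ∈ S → m ≤ v → u ≤ v := hleast v
        by_cases hv : v ∈ S
        · simp only [hv, and_true, if_true]
          have := hleast v hv
          split_ifs <;> omega
        · have : v ≠ u := fun h => hv (h ▸ hu)
          simp only [hv, and_false, or_false, if_false]
          split_ifs <;> omega
    have hconst : ∀ v, m ≤ v → v ≤ u → countLT S v = countLT S m := by
      intro v hmv
      induction v, hmv using Nat.le_induction with
      | base => simp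
      | succ v hmv ih =>
        intro hvu
        rw [countLT_succ, ih (by omega), if_neg fun hv => by
          have := hleast v hv hmv
          omega, Nat.add_zero]
    have hbig : u < v → countLT S m + 1 ≤ countLT S v := by
      intro h
      have h₁ := countLT_mono S (show u + 1 ≤ v from h)
      rw [countLT_succ, if_pos hu, hconst u hm le_rfl] at h₁
      exact h₁
    rw [hind]
    have := hconst v
    split_ifs <;> omega
  · have hind : ∀ v, countLT (starAct S m) v = countLT S v + (if m < v then 1 else 0) := by
      intro v
      induction v with
      | zero => simp [h₀, h₀']
      | succ v ih =>
        rw [countLT_succ, countLT_succ, ih, he]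
        simp only [Finset.mem_insert]
        by_cases hv : v ∈ S
        · simp only [hv, or_true, if_true]
          have := hlt v hv
          split_ifs <;> omega
        · simp only [hv, or_false, if_false]
          split_ifs <;> omega
    have hconst : ∀ v, m ≤ v → countLT S v = countLT S m := by
      intro v hmv
      induction v, hmv using Nat.le_induction with
      | base => rfl
      | succ v hmv ih =>
        rw [countLT_succ, ih, if_neg fun hv => by
          have := hlt v hv
          omega, Nat.add_zero]
    rw [hind]
    have := hconst v
    split_ifs <;> omega

theorem starWord_append (S : Finset ℕ) (u v : List ℕ) :
    starWord S (u ++ v) = starWord (starWord S u) v := List.foldl_append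

theorem starWord_cons (S : Finset ℕ) (m : ℕ) (v : List ℕ) :
    starWord S (m :: v) = starWord (starAct S m) v := rfl

theorem starWord_nil (S : Finset ℕ) : starWord S [] = S := rfl

/-- Checked on counting functions through `countLT_starAct`. That `starWord ∅` depends only on the
nilplactic class is what ties the right key to insertion. -/
theorem NilplacticStep.starWord_eq {u v : List ℕ} (h : NilplacticStep u v) (S : Finset ℕ) :
    starWord S u = starWord S v := by
  cases h with
  | left_witness p q a b c hab hbc =>
    have key : ∀ S, starWord S [b, a, c] = starWord S [b, c, a] := by
      intro S
      refine eq_of_countLT fun v => ?_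
      have h₁ := countLT_mono S hab.le
      have h₂ := countLT_mono S hbc.le
      simp only [starWord_cons, starWord_nil, countLT_starAct, hab.le, (hab.trans hbc).le,
        not_le.2 hbc, not_le.2 (hab.trans hbc), if_true, if_false]
      by_cases ha : v ≤ a <;> by_cases hb : v ≤ b <;> by_cases hc : v ≤ c <;>
        simp only [ha, hb, hc, if_true, if_false] <;> omega
    rw [starWord_append, starWord_append, key, ← starWord_append, ← starWord_append,
      List.append_assoc]
  | right_witness p q a b c hab hbc =>
    have key : ∀ S, starWord S [a, c, b] = starWord S [c, a, b] := by
      intro S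
      refine eq_of_countLT fun v => ?_
      have h₁ := countLT_mono S hab.le
      have h₂ := countLT_mono S hbc.le
      simp only [starWord_cons, starWord_nil, countLT_starAct, hbc.le, (hab.trans hbc).le,
        not_le.2 hab, not_le.2 (hab.trans hbc), if_true, if_false]
      by_cases ha : v ≤ a <;> by_cases hb : v ≤ b <;> by_cases hc : v ≤ c <;>
        simp only [ha, hb, hc, if_true, if_false] <;> omega
    rw [starWord_append, starWord_append, key, ← starWord_append, ← starWord_append,
      List.append_assoc]
  | braid p q a =>
    have key : ∀ S, starWord S [a, a + 1, a] = starWord S [a + 1, a, a + 1] := by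
      intro S
      refine eq_of_countLT fun v => ?_
      have h₁ := countLT_succ S a
      have h₂ : a + 1 < v → countLT S (a + 1) ≤ countLT S v := fun h => countLT_mono S h.le
      simp only [starWord_cons, starWord_nil, countLT_starAct]
      split_ifs at h₁ ⊢ <;> omega
    rw [starWord_append, starWord_append, key, ← starWord_append, ← starWord_append,
      List.append_assoc]

theorem Nilplactic.starWord_eq {u v : List ℕ} (h : Nilplactic u v) (S : Finset ℕ) :
    starWord S u = starWord S v := by
  induction h with
  | rel _ _ h => exact h.starWord_eq S
  | refl => rfl
  | symm _ _ _ ih => exact ih.symm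
  | trans _ _ _ _ _ ih₁ ih₂ => exact ih₁.trans ih₂

/-! ### Monotonicity of the star action, and its values on columns -/

theorem starAct_mono {S T : Finset ℕ} (h : S ⊆ T) (m : ℕ) : starAct S m ⊆ starAct T m := by
  intro z hz
  rcases starAct_cases S m with ⟨u, hu, hm, hl, he⟩ | ⟨hl, he⟩ <;>
  rcases starAct_cases T m with ⟨u', hu', hm', hl', he'⟩ | ⟨hl', he'⟩ <;>
  rw [he] at hz <;> rw [he'] <;>
  simp only [Finset.mem_insert, Finset.mem_erase] at hz ⊢ <;> grind

theorem starWord_mono {S T : Finset ℕ} (h : S ⊆ T) (w : List ℕ) :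
    starWord S w ⊆ starWord T w := by
  induction w generalizing S T with
  | nil => exact h
  | cons m w ih => exact ih (starAct_mono h m)

theorem starWord_subset_append (u w : List ℕ) : starWord ∅ w ⊆ starWord ∅ (u ++ w) := by
  rw [starWord_append]
  exact starWord_mono (Finset.empty_subset _) w

theorem mem_starWord {S : Finset ℕ} {w : List ℕ} {z : ℕ} (h : z ∈ starWord S w) :
    z ∈ S ∨ z ∈ w := by
  induction w generalizing S with
  | nil => exact Or.inl h
  | cons m w ih =>
    rcases ih h with h | h
    · rcases starAct_cases S m with ⟨u, -, -, -, he⟩ | ⟨-, he⟩ <;> rw [he] at h <;>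
        simp only [Finset.mem_insert, Finset.mem_erase] at h <;> simp only [List.mem_cons] <;> tauto
    · exact Or.inr (List.mem_cons_of_mem _ h)

theorem starWord_increasing {S : Finset ℕ} {w : List ℕ} (hw : w.Pairwise (· < ·))
    (h : ∀ z ∈ S, ∀ m ∈ w, z < m) : starWord S w = S ∪ w.toFinset := by
  induction w generalizing S with
  | nil => simp [starWord_nil]
  | cons m w ih =>
    rw [starWord_cons, starAct_eq_of_lt fun v hv => h v hv m (by simp), ih hw.of_cons]
    · ext z
      simp only [Finset.mem_union, Finset.mem_insert, List.mem_toFinset, List.mem_cons]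
      tauto
    · intro z hz k hk
      rcases Finset.mem_insert.1 hz with rfl | hz
      · exact (List.pairwise_cons.1 hw).1 k hk
      · exact h z hz k (by simp [hk])

theorem starWord_column {C : List ℕ} (hC : C.Pairwise (· > ·)) :
    starWord ∅ C.reverse = C.toFinset := by
  rw [starWord_increasing (List.pairwise_reverse.2 hC) (by simp)]
  simp

/-- The star action undoes a bump: the least entry of `C'` that is at least `y` is `x` after a
replacement and `y` itself otherwise, and acting by `y` restores the old column. -/
theorem ColStep.starAct_eq {x y : ℕ} {C C' : List ℕ} (h : ColStep x C C' (some y))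
    (hC : C.Pairwise (· > ·)) : starAct C'.toFinset y = C.toFinset := by
  cases h with
  | replace _ _ U V hU hy =>
    rw [starAct_eq_of_least (u := x) (by simp) hy.le]
    · ext z
      simp only [Finset.mem_insert, Finset.mem_erase, List.mem_toFinset]
      grind [List.pairwise_cons]
    · intro v hv
      simp only [List.mem_toFinset] at hv
      grind [List.pairwise_cons]
  | keep _ U V =>
    rw [starAct_eq_of_least (u := y) (by simp) le_rfl (fun _ _ h => h)]
    exact Finset.insert_erase (by simp)

/-! ## Exchanging the lengths of adjacent columns -/

/-- The letters of `B`, from the bottom up, are reverse inserted into `A`; the ejected letters form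
`B'` and what remains is `A'`. Each reverse insertion is a star action on the entries. The last
clause serves the induction: it makes the ejected letters increase. -/
theorem exists_swap_columns {A B : List ℕ} (hA : A.Pairwise (· > ·)) (hB : B.Pairwise (· > ·))
    (hAB : Dominates A B) (hr : IsReducedWord (A.reverse ++ B.reverse)) :
    ∃ B' A' : List ℕ, B'.length = B.length ∧ A'.length = A.length ∧ B'.Pairwise (· > ·) ∧
      A'.Pairwise (· > ·) ∧ Nilplactic (B'.reverse ++ A'.reverse) (A.reverse ++ B.reverse) ∧
      A'.toFinset = starWord A.toFinset B.reverse ∧ ∀ z ∈ B', z ∈ A ∧ ∃ w ∈ B, w < z := by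
  induction hn : B.length generalizing A B with
  | zero =>
    obtain rfl := List.eq_nil_of_length_eq_zero hn
    exact ⟨[], A, rfl, rfl, by simp, hA, by simpa using Nilplactic.refl _, by simp [starWord_nil],
      by simp⟩
  | succ n ih =>
    obtain ⟨B₀, y, rfl⟩ : ∃ B₀ y, B = B₀ ++ [y] := by
      rcases List.eq_nil_or_concat B with rfl | ⟨D, d, rfl⟩
      · simp at hn
      · exact ⟨D, d, by simp⟩
    have hn : B₀.length = n := by simpa using hn
    simp only [List.reverse_append, List.reverse_singleton, List.singleton_append] at hr ⊢
    have hdom := dominates_iff.1 hAB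
    obtain ⟨w, hw, hyw⟩ := hdom B₀.length y (by simp)
    obtain ⟨A₁, x, hx, hA₁⟩ := exists_colStep_reverse (y := y) hA
      (IsReducedWord.left (v := B₀.reverse) (by simpa using hr)) ⟨w, List.mem_of_getElem? hw, hyw⟩
    have hB₀ := (List.pairwise_append.1 hB).1
    have hyB : ∀ b ∈ B₀, y < b := fun b hb => (List.pairwise_append.1 hB).2.2 b hb y (by simp)
    have hdom₁ : Dominates A₁ B₀ := by
      rw [dominates_iff]
      intro r v hv
      have hr := (List.getElem?_eq_some_iff.1 hv).1
      obtain ⟨w', hw', hlt⟩ := hdom r v (by rw [List.getElem?_append_left hr, hv])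
      refine ⟨w', ?_, hlt⟩
      cases hx with
      | keep => exact hw'
      | replace _ _ U V hU hy =>
        have : r < U.length := by
          by_contra hc
          rw [List.getElem?_append_right (by omega), List.getElem?_cons, if_neg (by omega)] at hw
          have := (List.pairwise_cons.1 (List.pairwise_append.1 hA₁).2.1).1 w
            (List.mem_of_getElem? hw)
          omega
        rw [List.getElem?_append_left this] at hw' ⊢
        exact hw'
    have hnil : Nilplactic (x :: A₁.reverse ++ B₀.reverse) (A.reverse ++ y :: B₀.reverse) := by
      simpa using (hx.nilplactic hA₁).append_right B₀.reverse
    obtain ⟨B', A', h₁, h₂, h₃, h₄, h₅, h₆, h₇⟩ := ih hA₁ hB₀ hdom₁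
      (hnil.symm.isReducedWord hr).tail hn
    have hxA : ∀ z ∈ A₁, y + 1 < z → x < z ∧ z ∈ A := by
      intro z hz hyz
      cases hx with
      | replace _ _ U V hU hy =>
        rcases List.mem_append.1 hz with hz | hz
        · exact ⟨hU z hz, by simp [hz]⟩
        · rcases List.mem_cons.1 hz with rfl | hz
          · omega
          · have := (List.pairwise_cons.1 (List.pairwise_append.1 hA₁).2.1).1 z hz
            omega
      | keep => exact ⟨hyz, hz⟩
    refine ⟨B' ++ [x], A', by simp [h₁], by rw [h₂, hx.length_some], ?_, h₄, ?_, ?_, ?_⟩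
    · rw [List.pairwise_append]
      refine ⟨h₃, by simp, fun a ha b hb => ?_⟩
      obtain rfl : b = x := by simpa using hb
      obtain ⟨h₈, w, hw, hwa⟩ := h₇ a ha
      have := hyB w hw
      exact (hxA a h₈ (by omega)).1
    · have := h₅.append_left [x]
      simp only [List.reverse_append, List.reverse_singleton, List.cons_append,
        List.nil_append] at this ⊢
      exact this.trans hnil
    · rw [starWord_cons, hx.starAct_eq hA₁, h₆]
    · intro z hz
      rcases List.mem_append.1 hz with hz | hz
      · obtain ⟨h₈, w, hw, hwa⟩ := h₇ z hz
        have := hyB w hw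
        exact ⟨(hxA z h₈ (by omega)).2, w, by simp [hw], hwa⟩
      · obtain rfl : z = x := by simpa using hz
        exact ⟨hx.mem_new, y, by simp, hx.mem_out.2⟩

theorem sublist_of_subset {A B : List ℕ} (hA : A.Pairwise (· > ·)) (hB : B.Pairwise (· > ·))
    (h : B ⊆ A) : B.Sublist A :=
  List.sublist_of_subperm_of_pairwise
    (List.subperm_of_subset (hB.imp fun h => ne_of_gt h) h) hB hA

theorem getElem?_le_of_sublist {A B : List ℕ} (h : B.Sublist A) (hA : A.Pairwise (· > ·)) :
    ∀ (r v : ℕ), B[r]? = some v → ∃ w, A[r]? = some w ∧ v ≤ w := by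
  induction h with
  | slnil => simp
  | @cons B A a h ih =>
    intro r v hv
    obtain ⟨w, hw, hle⟩ := ih hA.of_cons r v hv
    have hr := (List.getElem?_eq_some_iff.1 hw).1
    refine ⟨(a :: A)[r]'(by simp; omega), by rw [List.getElem?_eq_getElem], ?_⟩
    cases r with
    | zero =>
      have := (List.pairwise_cons.1 hA).1 w (List.mem_of_getElem? hw)
      simp
      omega
    | succ r =>
      have h₁ := List.pairwise_iff_getElem.1 hA.of_cons r (r + 1) (by omega) hr (by omega)
      rw [(List.getElem?_eq_some_iff.1 hw).2] at h₁
      simp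
      omega
  | cons_cons a h ih =>
    intro r v hv
    cases r with
    | zero => exact ⟨v, by simpa using hv, le_rfl⟩
    | succ r => simpa using ih hA.of_cons r v (by simpa using hv)

/-- Exchange the first column with each column to its right in turn. The other lengths are kept, and
the travelling column undergoes the star action of every column it passes, so it ends as the first
column of the right key. -/
theorem exists_rotate {A : List ℕ} {R : Tableau} (h : IsReducedDecreasing (A :: R)) :
    ∃ (F : Tableau) (D : List ℕ), colLengths F = colLengths R ∧ D.length = A.length ∧
      (∀ C ∈ F ++ [D], C.Pairwise (· > ·)) ∧ Nilplactic (word (F ++ [D])) (word (A :: R)) ∧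
      D.toFinset = starWord ∅ (word (A :: R)) := by
  induction R generalizing A with
  | nil =>
    have hA := h.1.sorted A (by simp)
    refine ⟨[], A, rfl, rfl, by simpa using hA, .refl _, ?_⟩
    rw [word_cons, word_nil, List.append_nil, starWord_column hA]
  | cons B R ih =>
    obtain ⟨hdec, hr⟩ := h
    have hA := hdec.sorted A (by simp)
    have hB := hdec.sorted B (by simp)
    obtain ⟨h₁, h₂, h₃⟩ := isDecreasing_cons.1 hdec
    obtain ⟨h₄, h₅, h₆⟩ := isDecreasing_cons.1 h₃
    simp only [word_cons] at hr
    obtain ⟨B', A', hl₁, hl₂, hs₁, hs₂, hn, hst, -⟩ := exists_swap_columns hA hB h₂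
      (IsReducedWord.left (v := word R) (by simpa using hr))
    have hn' : Nilplactic (B'.reverse ++ word (A' :: R)) (word (A :: B :: R)) := by
      simpa [word_cons] using hn.append_right (word R)
    have hr' := (hn'.symm.isReducedWord (by simpa [word_cons] using hr)).right
    -- Monotonicity gives `∅ ⋆ B ⊆ A ⋆ B`. So `A'` dominates whatever `B` dominates, and the
    -- exchange can be repeated with the next column.
    have hBA : B ⊆ A' := by
      intro z hz
      rw [← List.mem_toFinset, hst]
      refine starWord_mono (Finset.empty_subset _) _ ?_
      rw [starWord_column hB]
      simpa using hz
    have hdec' : IsDecreasing (A' :: R) := by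
      refine isDecreasing_cons.2 ⟨⟨?_, ?_, hs₂⟩, ?_, h₆⟩
      · rintro rfl
        exact h₄.1 (List.eq_nil_of_subset_nil hBA)
      · intro z hz
        exact hr'.1 z (by simp [word_cons, hz])
      · rw [dominates_iff] at h₅ ⊢
        intro r v hv
        obtain ⟨w, hw, hlt⟩ := h₅ r v hv
        obtain ⟨w', hw', hle⟩ := getElem?_le_of_sublist (sublist_of_subset hs₂ hB hBA) hs₂ r w hw
        exact ⟨w', hw', by omega⟩
    obtain ⟨F, D, k₁, k₂, k₃, k₄, k₅⟩ := ih ⟨hdec', hr'⟩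
    refine ⟨B' :: F, D, ?_, k₂.trans hl₂, ?_, ?_, ?_⟩
    · simp only [colLengths, List.map_cons] at k₁ ⊢
      rw [k₁, hl₁]
    · intro C hC
      rcases List.mem_cons.1 hC with rfl | hC
      exacts [hs₁, k₃ C hC]
    · rw [List.cons_append, word_cons]
      exact (k₄.append_left B'.reverse).trans hn'
    · rw [k₅, word_cons, word_cons, word_cons, starWord_append, starWord_append, starWord_append,
        starWord_column hs₂, starWord_column hA, hst]

/-! ## The columns of the right key -/

/-- The set of entries of the `k`-th column of the right key. -/
def keyset (P : Tableau) (k : ℕ) : Finset ℕ := starWord ∅ (word (P.drop k))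

theorem keyset_nil (k : ℕ) : keyset [] k = ∅ := by simp [keyset, word_nil, starWord_nil]

theorem keyset_zero (P : Tableau) : keyset P 0 = starWord ∅ (word P) := rfl

theorem keyset_cons_succ (C : List ℕ) (R : Tableau) (k : ℕ) :
    keyset (C :: R) (k + 1) = keyset R k := rfl

theorem rightKey_eq (P : Tableau) :
    rightKey P = (List.range P.length).map fun k => (keyset P k).sort (· ≥ ·) := rfl

theorem keyset_succ_subset (P : Tableau) (k : ℕ) : keyset P (k + 1) ⊆ keyset P k := by
  induction P generalizing k with
  | nil => simp [keyset_nil]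
  | cons C R ih =>
    cases k with
    | zero =>
      rw [keyset_cons_succ, keyset_zero, keyset_zero, word_cons]
      exact starWord_subset_append _ _
    | succ k => exact ih k

theorem keyset_antitone (P : Tableau) : Antitone (keyset P) :=
  antitone_nat_of_succ_le (keyset_succ_subset P)

theorem mem_word_of_mem_keyset {P : Tableau} {k z : ℕ} (h : z ∈ keyset P k) : z ∈ word P := by
  have := keyset_antitone P (Nat.zero_le k) h
  simpa using mem_starWord this

theorem IsReducedDecreasing.tail {C : List ℕ} {R : Tableau} (h : IsReducedDecreasing (C :: R)) :
    IsReducedDecreasing R := by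
  have h₂ := h.2
  rw [word_cons] at h₂
  exact ⟨(isDecreasing_cons.1 h.1).2.2, h₂.right⟩

/-- The travelling column of `exists_rotate` keeps its length. -/
theorem card_keyset {P : Tableau} (h : IsReducedDecreasing P) (k : ℕ) :
    (keyset P k).card = (colLengths P).getD k 0 := by
  induction P generalizing k with
  | nil => simp [keyset_nil, colLengths]
  | cons C R ih =>
    cases k with
    | zero =>
      obtain ⟨F, D, -, hD, hs, -, he⟩ := exists_rotate h
      rw [keyset_zero, ← he, List.toFinset_card_of_nodup
        ((hs D (by simp)).imp fun h => ne_of_gt h), hD]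
      simp [colLengths]
    | succ k =>
      rw [keyset_cons_succ, ih h.tail]
      simp [colLengths]

/-- The extra letter `z` survives the action, possibly changed, unless `m` uses it up. The third set
`S₀` records that below the extra letter `S₁` has nothing that `S₀` lacks; in the application it
becomes the next column of the right key. -/
theorem starAct_insert {S₀ S₁ : Finset ℕ} {z : ℕ} (h₀ : S₀ ⊆ S₁) (hz : z ∉ S₁)
    (h : ∀ s ∈ S₁, s < z → s ∈ S₀) (m : ℕ) :
    starAct (insert z S₁) m = starAct S₁ m ∨
      ∃ z', z' ∉ starAct S₁ m ∧ starAct (insert z S₁) m = insert z' (starAct S₁ m) ∧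
        ∀ s ∈ starAct S₁ m, s < z' → s ∈ starAct S₀ m := by
  rcases starAct_cases S₁ m with ⟨u, hu, hm, hl, he⟩ | ⟨hl, he⟩
  -- If `m ≤ z < u`, the larger set gives up `z` where the smaller one gives up `u`, so the extra
  -- letter becomes `u`.
  · by_cases hzu : m ≤ z ∧ z < u
    · right
      refine ⟨u, ?_, ?_, ?_⟩
      · rw [he]
        simp
        omega
      · rw [starAct_eq_of_least (u := z) (by simp) hzu.1, he]
        · ext y
          simp only [Finset.mem_insert, Finset.mem_erase]
          by_cases hy : y = u
          · subst hy; simp [hu]; omega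
          · by_cases hy' : y = z
            · subst hy'; simp [hz, hy]
            · simp [hy, hy']
        · intro v hv hmv
          rcases Finset.mem_insert.1 hv with rfl | hv
          · exact le_rfl
          · have := hl v hv hmv
            omega
      · intro s hs hsu
        rw [he] at hs
        rcases Finset.mem_insert.1 hs with rfl | hs
        · rcases starAct_cases S₀ s with ⟨u', -, -, -, he'⟩ | ⟨-, he'⟩ <;> rw [he'] <;> simp
        · obtain ⟨-, hs⟩ := Finset.mem_erase.1 hs
          have hsm : s < m := by
            by_contra hc
            have := hl s hs (by omega)
            omega
          have hs₀ := h s hs (by omega)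
          rcases starAct_cases S₀ m with ⟨u', -, hu', -, he'⟩ | ⟨-, he'⟩ <;> rw [he']
          · exact Finset.mem_insert_of_mem (Finset.mem_erase.2 ⟨by omega, hs₀⟩)
          · exact Finset.mem_insert_of_mem hs₀
    · right
      have hzu' : z < m ∨ u < z := by
        have : z ≠ u := fun h => hz (h ▸ hu)
        omega
      refine ⟨z, ?_, ?_, ?_⟩
      · rw [he]
        simp only [Finset.mem_insert, Finset.mem_erase, hz, and_false, or_false]
        omega
      · rw [starAct_eq_of_least (u := u) (by simp [hu]) hm, he]
        · ext y
          simp only [Finset.mem_insert, Finset.mem_erase]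
          by_cases hy : y = z
          · subst hy
            simp
            omega
          · simp [hy]
        · intro v hv hmv
          rcases Finset.mem_insert.1 hv with rfl | hv
          · omega
          · exact hl v hv hmv
      · intro s hs hsz
        rw [he] at hs
        rcases Finset.mem_insert.1 hs with rfl | hs
        · rcases starAct_cases S₀ s with ⟨u', -, -, -, he'⟩ | ⟨-, he'⟩ <;> rw [he'] <;> simp
        · obtain ⟨hsu, hs⟩ := Finset.mem_erase.1 hs
          have hs₀ := h s hs hsz
          rcases starAct_cases S₀ m with ⟨u', hu'S, hu', hl', he'⟩ | ⟨-, he'⟩ <;> rw [he']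
          · refine Finset.mem_insert_of_mem (Finset.mem_erase.2 ⟨?_, hs₀⟩)
            rintro rfl
            have h₁ := hl s hs hu'
            have h₂ := hl' u (h u hu (by omega)) hm
            omega
          · exact Finset.mem_insert_of_mem hs₀
  · by_cases hzm : m ≤ z
    · left
      rw [starAct_eq_of_least (u := z) (by simp) hzm, he, Finset.erase_insert hz]
      intro v hv hmv
      rcases Finset.mem_insert.1 hv with rfl | hv
      · exact le_rfl
      · have := hl v hv
        omega
    · right
      refine ⟨z, ?_, ?_, ?_⟩
      · rw [he]
        simp only [Finset.mem_insert, hz, or_false]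
        omega
      · rw [starAct_eq_of_lt, he, Finset.insert_comm]
        intro v hv
        rcases Finset.mem_insert.1 hv with rfl | hv
        · omega
        · exact hl v hv
      · intro s hs hsz
        rw [he] at hs
        rcases Finset.mem_insert.1 hs with rfl | hs
        · omega
        · have hs₀ := h s hs hsz
          rw [starAct_eq_of_lt fun v hv => hl v (h₀ hv)]
          exact Finset.mem_insert_of_mem hs₀

theorem starWord_insert {S₀ S₁ : Finset ℕ} {z : ℕ} (h₀ : S₀ ⊆ S₁) (hz : z ∉ S₁)
    (h : ∀ s ∈ S₁, s < z → s ∈ S₀) (w : List ℕ) :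
    starWord (insert z S₁) w = starWord S₁ w ∨
      ∃ z', z' ∉ starWord S₁ w ∧ starWord (insert z S₁) w = insert z' (starWord S₁ w) ∧
        ∀ s ∈ starWord S₁ w, s < z' → s ∈ starWord S₀ w := by
  induction w generalizing S₀ S₁ z with
  | nil => exact Or.inr ⟨z, hz, rfl, h⟩
  | cons m w ih =>
    simp only [starWord_cons]
    rcases starAct_insert h₀ hz h m with he | ⟨z', hz', he, h'⟩
    · exact Or.inl (by rw [he])
    · rw [he]
      exact ih (starAct_mono h₀ m) hz' h'

/-- Left of column `c`, prepending a letter to the word can only enlarge a key column, whose size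
does not change. In column `c` the appended letter is carried through the later columns by
`starWord_insert`, and the number of boxes excludes that it is absorbed. -/
theorem EGIns.exists_keyset {x : ℕ} {P P' : Tableau} {c : ℕ} (h : EGIns x P P' c)
    (hP : IsDecreasing P) (hr : IsReducedWord (x :: word P)) :
    ∃ z, z ∉ keyset P c ∧
      (∀ k, keyset P' k = if k = c then insert z (keyset P c) else keyset P k) ∧
      ∀ s ∈ keyset P c, s < z → s ∈ keyset P (c + 1) := by
  induction h with
  | nil x =>
    refine ⟨x, by simp [keyset_nil], fun k => ?_, by simp [keyset_nil]⟩
    cases k with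
    | zero =>
      rw [keyset_zero, keyset_nil]
      simp [word, starWord, starAct]
    | succ k => rw [keyset_cons_succ, if_neg (by omega), keyset_nil, keyset_nil]
  | append x C C' R h =>
    have hC := hP.sorted C (by simp)
    have hC' := h.sorted hC
    obtain ⟨hCx, hlt⟩ := h.lt_of_none
    have hnil := (EGIns.append x C C' R h).nilplactic hP.sorted
    have hdec := (EGIns.append x C C' R h).isDecreasing (hr.1 x (by simp)) hP
    have hcard := card_keyset ⟨hdec, hnil.isReducedWord hr⟩ 0
    have hcard' := card_keyset ⟨hP, hr.tail⟩ 0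
    have hset : C'.toFinset = insert x C.toFinset := by
      rw [hCx]
      ext z
      simp
    have h₁ := starWord_insert (S₀ := ∅) (S₁ := C.toFinset) (z := x) (Finset.empty_subset _)
      (fun hx => by have := hlt x (by simpa using hx); omega)
      (fun s hs hsx => by have := hlt s (by simpa using hs); omega) (word R)
    have hk : keyset (C' :: R) 0 = starWord (insert x C.toFinset) (word R) := by
      rw [keyset_zero, word_cons, starWord_append, starWord_column hC', hset]
    have hk' : keyset (C :: R) 0 = starWord C.toFinset (word R) := by
      rw [keyset_zero, word_cons, starWord_append, starWord_column hC]
    rw [← hk, ← hk'] at h₁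
    rcases h₁ with h₁ | ⟨z, hz, h₁, h₂⟩
    · rw [h₁, hcard'] at hcard
      simp [NilKey.colLengths, hCx] at hcard
    · refine ⟨z, hz, fun k => ?_, h₂⟩
      cases k with
      | zero => simpa using h₁
      | succ k => rw [if_neg (by omega), keyset_cons_succ, keyset_cons_succ]
  | bump x y C C' R R' c h h' ih =>
    have hnil := (EGIns.bump x y C C' R R' c h h').nilplactic hP.sorted
    have hdec := (EGIns.bump x y C C' R R' c h h').isDecreasing (hr.1 x (by simp)) hP
    have hcard := card_keyset ⟨hdec, hnil.isReducedWord hr⟩ 0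
    have hcard' := card_keyset ⟨hP, hr.tail⟩ 0
    have hC := hP.sorted C (by simp)
    have hr' : IsReducedWord (C'.reverse ++ (y :: word R)) := by
      have := ((h.nilplactic hC).append_right (word R)).isReducedWord
        (by simpa [word_cons] using hr)
      simpa using this
    obtain ⟨z, hz, h₁, h₂⟩ := ih (isDecreasing_cons.1 hP).2.2 hr'.right
    refine ⟨z, hz, fun k => ?_, h₂⟩
    cases k with
    | zero =>
      rw [if_neg (by omega)]
      symm
      refine Finset.eq_of_subset_of_card_le ?_ ?_
      · rw [keyset_zero, keyset_zero, ← hnil.starWord_eq]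
        exact starWord_subset_append [x] _
      · rw [hcard, hcard']
        simp [NilKey.colLengths, h.length_some]
    | succ k =>
      rw [keyset_cons_succ, keyset_cons_succ, keyset_cons_succ, h₁]
      simp

/-! ## Comparing columns by counting -/

theorem countLT_zero (S : Finset ℕ) : countLT S 0 = 0 := by simp [countLT]

theorem countLT_empty (v : ℕ) : countLT ∅ v = 0 := by simp [countLT]

theorem countLT_le_card (S : Finset ℕ) (v : ℕ) : countLT S v ≤ S.card :=
  Finset.card_filter_le _ _

theorem countLT_eq_card {S : Finset ℕ} {v : ℕ} (h : ∀ s ∈ S, s < v) : countLT S v = S.card := by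
  rw [countLT, Finset.filter_true_of_mem h]

theorem countLT_eq_zero {S : Finset ℕ} {v : ℕ} (h : ∀ s ∈ S, v ≤ s) : countLT S v = 0 := by
  rw [countLT, Finset.filter_false_of_mem fun s hs => not_lt.2 (h s hs), Finset.card_empty]

theorem countLT_insert {S : Finset ℕ} {a : ℕ} (ha : a ∉ S) (v : ℕ) :
    countLT (insert a S) v = (if a < v then 1 else 0) + countLT S v := by
  unfold countLT
  rw [Finset.filter_insert]
  split_ifs
  · rw [Finset.card_insert_of_notMem (by simp [ha]), add_comm]
  · rw [zero_add]

theorem countLT_subset {S T : Finset ℕ} (h : S ⊆ T) (v : ℕ) : countLT S v ≤ countLT T v :=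
  Finset.card_le_card (Finset.filter_subset_filter _ h)

/-- Smaller entries mean larger counts below each `v`. All comparisons of keys are carried out in
terms of these counts. -/
theorem forall₂_le_iff {L M : List ℕ} (hL : L.Pairwise (· > ·)) (hM : M.Pairwise (· > ·)) :
    List.Forall₂ (· ≤ ·) L M ↔
      L.length = M.length ∧ ∀ v, countLT M.toFinset v ≤ countLT L.toFinset v := by
  induction L generalizing M with
  | nil =>
    cases M with
    | nil => simp
    | cons m M => simp
  | cons l L ih =>
    cases M with
    | nil => simp
    | cons m M =>
      obtain ⟨hl, hL'⟩ := List.pairwise_cons.1 hL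
      obtain ⟨hm, hM'⟩ := List.pairwise_cons.1 hM
      have hlL : l ∉ L.toFinset := fun h => by have := hl l (by simpa using h); omega
      have hmM : m ∉ M.toFinset := fun h => by have := hm m (by simpa using h); omega
      have hc : L.toFinset.card = L.length := List.toFinset_card_of_nodup (hL'.imp ne_of_gt)
      have hc' : M.toFinset.card = M.length := List.toFinset_card_of_nodup (hM'.imp ne_of_gt)
      rw [List.forall₂_cons, ih hL' hM']
      simp only [List.toFinset_cons, countLT_insert hlL, countLT_insert hmM, List.length_cons]
      have hLv : ∀ v, l ≤ v → countLT L.toFinset v = L.length := fun v hv => by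
        rw [← hc]
        exact countLT_eq_card fun s hs => (hl s (by simpa using hs)).trans_le hv
      have hMv : ∀ v, m ≤ v → countLT M.toFinset v = M.length := fun v hv => by
        rw [← hc']
        exact countLT_eq_card fun s hs => (hm s (by simpa using hs)).trans_le hv
      have hMc : ∀ v, countLT M.toFinset v ≤ M.length := fun v => hc' ▸ countLT_le_card _ _
      constructor
      · rintro ⟨hlm, hlen, h⟩
        refine ⟨by omega, fun v => ?_⟩
        have := h v
        split_ifs <;> omega
      · rintro ⟨hlen, h⟩
        refine ⟨?_, by omega, fun v => ?_⟩
        · by_contra hlt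
          have h₁ := h l
          rw [hLv l le_rfl, hMv l (by omega), if_pos (by omega), if_neg (by omega)] at h₁
          omega
        · by_cases hlv : l ≤ v
          · have := hLv v hlv
            have := hMc v
            omega
          · have := h v
            split_ifs at this <;> omega

/-! ## The columns of the left key -/

/-- The greedy choice takes `v ∈ B` exactly when fewer letters have been chosen so far than `A` has
letters up to `v`. This one-step recursion replaces the algorithm from here on. -/
theorem countLT_pick {A B : List ℕ} (hA : A.Pairwise (· < ·)) (hB : B.Pairwise (· < ·)) :
    (pick B A).Pairwise (· < ·) ∧ pick B A ⊆ B ∧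
    ∀ v, countLT (pick B A).toFinset (v + 1) =
      min (countLT (pick B A).toFinset v + if v ∈ B then 1 else 0) (countLT A.toFinset (v + 1)) := by
  induction A generalizing B with
  | nil => simp [pick, countLT_empty]
  | cons a A ih =>
    obtain ⟨ha, hA'⟩ := List.pairwise_cons.1 hA
    have haA : a ∉ A.toFinset := fun h => by have := ha a (by simpa using h); omega
    have hsplit := List.takeWhile_append_dropWhile (p := fun z => decide (z < a)) (l := B)
    have htake : ∀ z ∈ B.takeWhile (fun z => decide (z < a)), z < a := fun z hz => by
      simpa using List.mem_takeWhile_imp hz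
    rw [pick]
    cases hd : B.dropWhile (fun z => decide (z < a)) with
    | nil =>
      rw [hd, List.append_nil] at hsplit
      rw [hsplit] at htake
      refine ⟨by simp, by simp, fun v => ?_⟩
      simp only [List.toFinset_nil, countLT_empty, List.toFinset_cons, countLT_insert haA]
      split_ifs with h₁ h₂
      · have := htake v h₁
        omega
      · rw [countLT_eq_zero]
        · simp
        · intro s hs
          have := ha s (by simpa using hs)
          omega
      · simp
      · simp
    | cons b B₁ =>
      rw [hd] at hsplit
      have hab : a ≤ b := by
        have := List.head_dropWhile_not (p := fun z => decide (z < a)) (l := B) (by rw [hd]; simp)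
        simpa [hd] using this
      have hBs := hB
      rw [← hsplit, List.pairwise_append, List.pairwise_cons] at hBs
      obtain ⟨-, ⟨hb, hB₁⟩, hsep⟩ := hBs
      obtain ⟨h₁, h₂, h₃⟩ := ih hA' hB₁
      have hbp : b ∉ (pick B₁ A).toFinset := fun h => by
        have := hb b (h₂ (by simpa using h))
        omega
      have hmem : ∀ v, v ∈ B ↔ v < a ∧ v ∈ B ∨ v = b ∨ v ∈ B₁ := by
        intro v
        constructor
        · intro hv
          rw [← hsplit, List.mem_append, List.mem_cons] at hv
          rcases hv with hv | hv
          · exact Or.inl ⟨htake v hv, hsplit ▸ List.mem_append_left _ hv⟩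
          · exact Or.inr hv
        · rintro (hv | hv)
          · exact hv.2
          · rw [← hsplit, List.mem_append, List.mem_cons]
            exact Or.inr hv
      refine ⟨List.pairwise_cons.2 ⟨fun z hz => hb z (h₂ hz), h₁⟩, ?_, fun v => ?_⟩
      · intro z hz
        rw [hmem]
        rcases List.mem_cons.1 hz with rfl | hz
        · exact Or.inr (Or.inl rfl)
        · exact Or.inr (Or.inr (h₂ hz))
      · simp only [List.toFinset_cons, countLT_insert haA, countLT_insert hbp]
        have hsmall : ∀ w, w ≤ b + 1 → countLT (pick B₁ A).toFinset w = 0 := fun w hw =>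
          countLT_eq_zero fun s hs => by
            have := hb s (h₂ (by simpa using hs))
            omega
        have hAsmall : ∀ w, w ≤ a → countLT A.toFinset w = 0 := fun w hw =>
          countLT_eq_zero fun s hs => by
            have := ha s (by simpa using hs)
            omega
        have hB₁ : v ∈ B₁ → b < v := hb v
        have hvB := hmem v
        rcases lt_trichotomy v b with hvb | rfl | hvb
        · rw [hsmall _ (by omega), hsmall _ (by omega)]
          by_cases hva : v < a
          · rw [hAsmall _ (by omega)]
            split_ifs <;> omega
          · have hvB' : v ∉ B := by
              intro h
              rcases hvB.1 h with h | h | h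
              · omega
              · omega
              · have := hB₁ h
                omega
            simp only [hvB', if_false]
            split_ifs <;> omega
        · have hvB' : v ∈ B := hvB.2 (Or.inr (Or.inl rfl))
          rw [hsmall _ (by omega), hsmall _ (by omega)]
          simp only [hvB', if_true]
          split_ifs <;> omega
        · have : v ∈ B ↔ v ∈ B₁ := by
            rw [hvB]
            constructor
            · rintro (h | h | h)
              · omega
              · omega
              · exact h
            · exact fun h => Or.inr (Or.inr h)
          simp only [h₃ v, this]
          split_ifs <;> omega

/-- The counting function of `C ◁ A`, where `f` is the counting function of `A`. -/
def pickCount (C : List ℕ) (f : ℕ → ℕ) : ℕ → ℕ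
  | 0 => 0
  | v + 1 => min (pickCount C f v + if v ∈ C then 1 else 0) (f (v + 1))

/-- The number of entries below `v` in the `k`-th column of the left key. -/
def leftCount : Tableau → ℕ → ℕ → ℕ
  | [], _ => fun _ => 0
  | C :: _, 0 => countLT C.toFinset
  | C :: Q, k + 1 => pickCount C (leftCount Q k)

theorem leftCount_nil (k v : ℕ) : leftCount [] k v = 0 := rfl

theorem leftCount_cons_zero (C : List ℕ) (Q : Tableau) (v : ℕ) :
    leftCount (C :: Q) 0 v = countLT C.toFinset v := rfl

theorem leftCount_cons_succ (C : List ℕ) (Q : Tableau) (k v : ℕ) :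
    leftCount (C :: Q) (k + 1) (v + 1) =
      min (leftCount (C :: Q) (k + 1) v + if v ∈ C then 1 else 0) (leftCount Q k (v + 1)) := rfl

theorem leftCount_zero (Q : Tableau) (k : ℕ) : leftCount Q k 0 = 0 := by
  cases Q with
  | nil => rfl
  | cons C Q =>
    cases k with
    | zero => exact countLT_zero _
    | succ k => rfl

theorem leftKey_column {Q : Tableau} (hQ : ∀ C ∈ Q, C.Pairwise (· > ·)) {k : ℕ}
    (hk : k < Q.length) :
    (pickAll ((Q.take (k + 1)).map List.reverse)).Pairwise (· < ·) ∧
      ∀ v, countLT (pickAll ((Q.take (k + 1)).map List.reverse)).toFinset v = leftCount Q k v := by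
  induction Q generalizing k with
  | nil => simp at hk
  | cons C Q ih =>
    have hC : C.reverse.Pairwise (· < ·) := List.pairwise_reverse.2 (hQ C (by simp))
    cases k with
    | zero => simpa [pickAll, leftCount] using hC
    | succ k =>
      obtain ⟨h₁, h₂⟩ := ih (fun D hD => hQ D (by simp [hD])) (by simpa using hk)
      have he : pickAll (((C :: Q).take (k + 1 + 1)).map List.reverse) =
          pick C.reverse (pickAll ((Q.take (k + 1)).map List.reverse)) := by
        cases Q with
        | nil => simp at hk
        | cons D Q => simp [pickAll]
      rw [he]
      obtain ⟨h₃, -, h₄⟩ := countLT_pick h₁ hC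
      refine ⟨h₃, fun v => ?_⟩
      induction v with
      | zero => rw [leftCount_zero, countLT_zero]
      | succ v ihv =>
        rw [h₄, ihv, leftCount_cons_succ, h₂]
        simp

theorem leftCount_le_countLT (Q : Tableau) (k v : ℕ) :
    leftCount Q k v ≤ countLT (Q.getD k []).toFinset v := by
  induction Q generalizing k v with
  | nil => simp [leftCount]
  | cons C Q ih =>
    cases k with
    | zero => simp [leftCount]
    | succ k =>
      cases v with
      | zero => simp [leftCount_zero]
      | succ v =>
        rw [leftCount_cons_succ]
        exact (min_le_right _ _).trans (by simpa using ih k (v + 1))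

theorem leftCount_succ_le (Q : Tableau) (k v : ℕ) : leftCount Q (k + 1) v ≤ leftCount Q k v := by
  induction Q generalizing k v with
  | nil => simp [leftCount]
  | cons C Q ih =>
    induction v with
    | zero => simp [leftCount_zero]
    | succ v ihv =>
      rw [leftCount_cons_succ]
      cases k with
      | zero =>
        refine (min_le_left _ _).trans ?_
        rw [leftCount_cons_zero] at ihv ⊢
        rw [countLT_succ]
        simp only [List.mem_toFinset]
        omega
      | succ k =>
        rw [leftCount_cons_succ]
        have := ih k (v + 1)
        omega

/-- Any chain of sets of entries bounds the left key. -/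
theorem le_leftCount {Q : Tableau} {k : ℕ} {X : ℕ → Finset ℕ}
    (hX : ∀ j ≤ k, X j ⊆ (Q.getD j []).toFinset)
    (h : ∀ j < k, ∀ v, countLT (X j) v ≤ countLT (X (j + 1)) v) (v : ℕ) :
    countLT (X 0) v ≤ leftCount Q k v := by
  induction Q generalizing k v X with
  | nil =>
    have : X 0 = ∅ := by simpa using hX 0 (Nat.zero_le _)
    simp [this, countLT_empty]
  | cons C Q ih =>
    cases k with
    | zero => exact countLT_subset (by simpa using hX 0 le_rfl) v
    | succ k =>
      induction v with
      | zero => simp [countLT_zero]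
      | succ v ihv =>
        rw [leftCount_cons_succ]
        refine le_min ?_ ?_
        · rw [countLT_succ]
          have h₀ : v ∈ X 0 → v ∈ C := fun hv => by
            simpa using hX 0 (Nat.zero_le _) hv
          split_ifs <;> first | omega | (exfalso; tauto)
        · refine (h 0 (by omega) _).trans (ih (X := fun j => X (j + 1)) ?_ ?_ (v + 1))
          · intro j hj
            simpa using hX (j + 1) (by omega)
          · exact fun j hj => h (j + 1) (by omega)

/-- The equality of shapes contained in `KeyLE` comes for free: a left key column is no longer than
the column of `Q`, and for large `v` the inequality of counts makes it at least as long as the key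
column of `P`. -/
theorem keyLE_iff {P Q : Tableau} (hP : IsReducedDecreasing P) (hQ : IsRSSYT Q)
    (hs : colLengths P = colLengths Q) :
    KeyLE (leftKey Q) (rightKey P) ↔ ∀ k v, countLT (keyset P k) v ≤ leftCount Q k v := by
  have hlen : P.length = Q.length := by simpa [colLengths] using congrArg List.length hs
  have hcol : ∀ C ∈ Q, C.Pairwise (· > ·) := fun C hC => (hQ.1 C hC).2.2
  rw [KeyLE, List.forall₂_iff_get]
  simp only [leftKey, rightKey_eq, List.length_map, List.length_range, hlen, true_and,
    List.get_eq_getElem, List.getElem_map, List.getElem_range]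
  have key : ∀ k < Q.length, (List.Forall₂ (· ≤ ·)
      (pickAll ((Q.take (k + 1)).map List.reverse)).reverse ((keyset P k).sort (· ≥ ·)) ↔
        ∀ v, countLT (keyset P k) v ≤ leftCount Q k v) := by
    intro k hk
    obtain ⟨h₁, h₂⟩ := leftKey_column hcol hk
    have hcard := List.toFinset_card_of_nodup (h₁.imp ne_of_lt)
    rw [forall₂_le_iff (List.pairwise_reverse.2 h₁) (Finset.sortedGT_sort _).pairwise,
      List.toFinset_reverse, Finset.sort_toFinset]
    simp only [h₂, List.length_reverse, Finset.length_sort, and_iff_right_iff_imp]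
    intro h
    obtain ⟨N, hN⟩ : ∃ N, ∀ s ∈ keyset P k ∪
        (pickAll ((Q.take (k + 1)).map List.reverse)).toFinset, s < N :=
      ⟨_, fun s hs => Nat.lt_succ_of_le (Finset.le_sup (f := id) hs)⟩
    have h₃ := h N
    rw [countLT_eq_card fun s hs => hN s (Finset.mem_union_left _ hs), ← h₂,
      countLT_eq_card fun s hs => hN s (Finset.mem_union_right _ hs), hcard] at h₃
    refine le_antisymm ?_ h₃
    rw [← hcard, ← countLT_eq_card fun s hs => hN s (Finset.mem_union_right _ hs), h₂]
    refine (leftCount_le_countLT Q k N).trans ((countLT_le_card _ _).trans ?_)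
    rw [card_keyset hP, hs]
    refine (List.toFinset_card_le _).trans (le_of_eq ?_)
    simp [colLengths, List.getD_eq_getElem?_getD, hk]
  constructor
  · intro h k v
    by_cases hk : k < Q.length
    · exact (key k hk).1 (h k hk hk) v
    · have : keyset P k = ∅ := by
        rw [← Finset.card_eq_zero, card_keyset hP, hs]
        simp [colLengths, List.getD_eq_getElem?_getD, not_lt.1 hk]
      simp [this, countLT_empty]
  · exact fun h k hk _ => (key k hk).2 (h k)

/-! ## Boundedness and the comparison of keys -/

theorem mem_flatten_of_mem_getD {Q : Tableau} {k z : ℕ} (h : z ∈ Q.getD k []) : z ∈ Q.flatten := by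
  rw [List.getD_eq_getElem?_getD] at h
  cases hk : Q[k]? with
  | none => simp [hk] at h
  | some C => exact List.mem_flatten.2 ⟨C, List.mem_of_getElem? hk, by simpa [hk] using h⟩

theorem mem_getD_appendBox {Q : Tableau} {c i k z : ℕ} (hc : c ≤ Q.length) :
    z ∈ (appendBox Q c i).getD k [] ↔ z ∈ Q.getD k [] ∨ (k = c ∧ z = i) := by
  induction Q generalizing c k with
  | nil =>
    obtain rfl : c = 0 := by simpa using hc
    cases k <;> simp [appendBox_nil]
  | cons C Q ih =>
    cases c with
    | zero => cases k <;> simp [appendBox_cons_zero]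
    | succ c =>
      cases k with
      | zero => simp [appendBox_cons_succ]
      | succ k => simpa [appendBox_cons_succ] using ih (by simpa using hc)

/-- A key column left of column `c` does not see the new box. One to the right of `c` cannot use it,
since the entries of its own column exceed `i` and so its count at `i + 1` is still zero. -/
theorem leftCount_appendBox_le {Q : Tableau} {c i : ℕ} (hc : c ≤ Q.length)
    (h : ∀ z ∈ (Q.drop c).flatten, i < z) (k v : ℕ) :
    leftCount (appendBox Q c i) k v ≤ leftCount Q k v + if k = c then 1 else 0 := by
  induction Q generalizing c k v with
  | nil =>
    obtain rfl : c = 0 := by simpa using hc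
    rw [appendBox_nil]
    cases k with
    | zero =>
      rw [leftCount_cons_zero]
      exact (countLT_le_card _ _).trans (by simp)
    | succ k =>
      cases v with
      | zero => simp [leftCount_zero]
      | succ v => exact (min_le_right _ _).trans (by simp [leftCount_nil])
  | cons C Q ih =>
    cases c with
    | zero =>
      rw [appendBox_cons_zero]
      have hi : i ∉ C.toFinset := fun hi => (h i (by simp_all)).false
      have hset : (C ++ [i]).toFinset = insert i C.toFinset := by
        ext z
        simp
      cases k with
      | zero =>
        rw [leftCount_cons_zero, leftCount_cons_zero, hset, countLT_insert hi]
        split_ifs <;> omega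
      | succ k =>
        rw [if_neg (by omega), Nat.add_zero]
        induction v with
        | zero => simp [leftCount_zero]
        | succ v ihv =>
          rw [leftCount_cons_succ, leftCount_cons_succ]
          by_cases hv : v = i
          · have h₁ := leftCount_le_countLT Q k (v + 1)
            rw [countLT_eq_zero] at h₁
            · omega
            · intro s hs
              have := mem_flatten_of_mem_getD (by simpa using hs)
              have := h s (by simpa using Or.inr (by simpa using this))
              omega
          · have : v ∈ C ++ [i] ↔ v ∈ C := by simp [hv]
            simp only [this]
            omega
    | succ c =>
      rw [appendBox_cons_succ]
      cases k with
      | zero => simp [leftCount_cons_zero]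
      | succ k =>
        have ih' := ih (c := c) (by simpa using hc) (by simpa using h) k
        induction v with
        | zero => simp [leftCount_zero]
        | succ v ihv =>
          rw [leftCount_cons_succ, leftCount_cons_succ]
          have := ih' (v + 1)
          simp only [Nat.add_right_cancel_iff] at ihv ⊢
          omega

/-- The comparison of the left key of `Q` and the right key of `P`, in terms of counting
functions. -/
def KeyBound (P Q : Tableau) : Prop := ∀ k v, countLT (keyset P k) v ≤ leftCount Q k v

/-- Only column `c` matters. Above `z` the right key loses one letter and the left key at most one.
At or below `z` the right key column has the same counts as the next one, so the bound for column `c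
+ 1` applies, as the left key counts decrease in `k`. -/
theorem EGIns.keyBound_of_keyBound {x i c : ℕ} {P P' Q : Tableau} (h : EGIns x P P' c)
    (hP : IsDecreasing P) (hr : IsReducedWord (x :: word P)) (hbox : IsMinBox Q c i)
    (hb : KeyBound P' (appendBox Q c i)) : KeyBound P Q := by
  have hb' : ∀ k v, countLT (keyset P' k) v ≤ leftCount Q k v + if k = c then 1 else 0 :=
    fun k v => (hb k v).trans (leftCount_appendBox_le hbox.le_length hbox.lt k v)
  obtain ⟨z, hz, h₁, h₂⟩ := h.exists_keyset hP hr
  intro k v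
  by_cases hk : k = c
  · subst hk
    by_cases hv : v ≤ z
    · have h₃ : countLT (keyset P k) v = countLT (keyset P (k + 1)) v := by
        refine le_antisymm ?_ (countLT_subset (keyset_succ_subset P k) v)
        refine Finset.card_le_card fun s hs => ?_
        obtain ⟨hs, hsv⟩ := Finset.mem_filter.1 hs
        exact Finset.mem_filter.2 ⟨h₂ s hs (by omega), hsv⟩
      have h₄ := hb' (k + 1) v
      rw [h₁, if_neg (by omega), if_neg (by omega), Nat.add_zero] at h₄
      rw [h₃]
      exact h₄.trans (leftCount_succ_le Q k v)
    · have h₄ := hb' k v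
      rw [h₁, if_pos rfl, if_pos rfl, countLT_insert hz, if_pos (by omega)] at h₄
      omega
  · have h₄ := hb' k v
    rwa [h₁, if_neg hk, if_neg hk, Nat.add_zero] at h₄

/-! ### Matchings between the right key of `P` and the columns of `Q` -/

theorem countLT_image_le {S : Finset ℕ} {f g : ℕ → ℕ} (hf : Set.InjOn f S) (hg : Set.InjOn g S)
    (hle : ∀ s ∈ S, g s ≤ f s) (v : ℕ) : countLT (S.image f) v ≤ countLT (S.image g) v := by
  have key : ∀ f : ℕ → ℕ, Set.InjOn f S →
      countLT (S.image f) v = (S.filter (f · < v)).card := by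
    intro f hf
    rw [countLT, Finset.filter_image, Finset.card_image_of_injOn]
    exact hf.mono fun s hs => (Finset.mem_filter.1 hs).1
  rw [key f hf, key g hg]
  refine Finset.card_le_card fun s hs => ?_
  obtain ⟨hs, hv⟩ := Finset.mem_filter.1 hs
  exact Finset.mem_filter.2 ⟨hs, (hle s hs).trans_lt hv⟩

/-- A matching of the key sets of `P` with the columns of `Q`. -/
structure IsKeyMatching (P Q : Tableau) (τ : ℕ → ℕ → ℕ) : Prop where
  injOn : ∀ k, Set.InjOn (τ k) (keyset P k)
  mem : ∀ k, ∀ s ∈ keyset P k, τ k s ∈ Q.getD k []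
  succ_le : ∀ k, ∀ s ∈ keyset P (k + 1), τ (k + 1) s ≤ τ k s
  zero_le : ∀ s ∈ keyset P 0, τ 0 s ≤ s

/-- For fixed `k`, the images of `keyset P k` under `τ 0, …, τ k` form a chain of sets of entries to
which `le_leftCount` applies; `τ 0 s ≤ s` compares the key column with the first of them. -/
theorem IsKeyMatching.keyBound {P Q : Tableau} {τ : ℕ → ℕ → ℕ} (h : IsKeyMatching P Q τ) :
    KeyBound P Q := by
  intro k v
  have hsub : ∀ j ≤ k, keyset P k ⊆ keyset P j := fun j hj => keyset_antitone P hj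
  have h₁ := countLT_image_le (f := id) (g := τ 0) (S := keyset P k) (fun _ _ _ _ h => h)
    ((h.injOn 0).mono (hsub 0 (Nat.zero_le _))) (fun s hs => h.zero_le s (hsub 0 (Nat.zero_le _) hs))
    v
  rw [Finset.image_id] at h₁
  refine h₁.trans (le_leftCount (X := fun j => (keyset P k).image (τ j)) ?_ ?_ v)
  · intro j hj y hy
    obtain ⟨s, hs, rfl⟩ := Finset.mem_image.1 hy
    exact List.mem_toFinset.2 (h.mem j s (hsub j hj hs))
  · intro j hj
    exact countLT_image_le ((h.injOn j).mono (hsub j hj.le)) ((h.injOn (j + 1)).mono (hsub _ hj))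
      fun s hs => h.succ_le j s (hsub _ hj hs)

/-- The new key letter `z` of column `c` is matched with the new box. Its entry `i` is minimal,
which gives the inequalities, and smaller than every entry already matched in column `c`, which
keeps the map injective. -/
theorem EGIns.exists_isKeyMatching {x i c : ℕ} {P P' Q : Tableau} {τ : ℕ → ℕ → ℕ}
    (h : EGIns x P P' c) (hP : IsDecreasing P) (hr : IsReducedWord (x :: word P))
    (hbox : IsMinBox Q c i) (hi : ∀ z ∈ word P', i ≤ z) (hτ : IsKeyMatching P Q τ) :
    ∃ τ', IsKeyMatching P' (appendBox Q c i) τ' := by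
  obtain ⟨z, hz, h₁, -⟩ := h.exists_keyset hP hr
  have hmem : ∀ k s, s ∈ keyset P' k ↔ s ∈ keyset P k ∨ (k = c ∧ s = z) := by
    intro k s
    rw [h₁]
    split_ifs with hk
    · subst hk
      simp [or_comm]
    · simp [hk]
  have hgt : ∀ s ∈ keyset P c, i < τ c s := by
    intro s hs
    have h₂ := hτ.mem c s hs
    refine hbox.lt _ (mem_flatten_of_mem_getD (k := 0) ?_)
    simpa [List.getD_eq_getElem?_getD] using h₂
  refine ⟨fun k s => if k = c ∧ s = z then i else τ k s, ?_, ?_, ?_, ?_⟩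
  · intro k s hs t ht hst
    rw [Finset.mem_coe, hmem] at hs ht
    by_cases hk : k = c
    · subst hk
      simp only [true_and] at hs ht hst
      by_cases hs' : s = z <;> by_cases ht' : t = z
      · rw [hs', ht']
      · have := hgt t (by tauto)
        simp only [hs', ht', if_true, if_false] at hst
        omega
      · have := hgt s (by tauto)
        simp only [hs', ht', if_true, if_false] at hst
        omega
      · simp only [hs', ht', if_false] at hst
        exact hτ.injOn k (by simpa using by tauto) (by simpa using by tauto) hst
    · simp only [hk, false_and, if_false, or_false] at hs ht hst
      exact hτ.injOn k hs ht hst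
  · intro k s hs
    rw [mem_getD_appendBox hbox.le_length]
    by_cases hks : k = c ∧ s = z
    · simp [hks]
    · simp only [hks, if_false]
      rw [hmem] at hs
      exact Or.inl (hτ.mem k s (by tauto))
  · intro k s hs
    have hs' : s ∈ keyset P' k := keyset_succ_subset P' k hs
    rw [hmem] at hs hs'
    by_cases hks : k + 1 = c ∧ s = z
    · have hne : ¬ (k = c ∧ s = z) := by omega
      rw [if_pos hks, if_neg hne]
      exact hbox.le _ (mem_flatten_of_mem_getD (hτ.mem k s (by tauto)))
    -- `z` is new to column `c`, so it is not in column `c + 1` either, the key columns being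
    -- nested.
    · have hne : ¬ (k = c ∧ s = z) := by
        rintro ⟨rfl, rfl⟩
        exact hz (keyset_succ_subset P k (by tauto))
      rw [if_neg hks, if_neg hne]
      exact hτ.succ_le k s (by tauto)
  · intro s hs
    by_cases hks : 0 = c ∧ s = z
    · rw [if_pos hks]
      exact hi s (mem_word_of_mem_keyset hs)
    · rw [if_neg hks]
      rw [hmem] at hs
      exact hτ.zero_le s (by tauto)

theorem mem_starWord_of_lt {S : Finset ℕ} {w : List ℕ} {x : ℕ} (hx : x ∈ S)
    (h : ∀ m ∈ w, x < m) : x ∈ starWord S w := by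
  induction w generalizing S with
  | nil => exact hx
  | cons m w ih =>
    have hm := h m (by simp)
    refine ih ?_ fun k hk => h k (by simp [hk])
    rcases starAct_cases S m with ⟨u, -, hu, -, he⟩ | ⟨-, he⟩ <;> rw [he]
    · exact Finset.mem_insert_of_mem (Finset.mem_erase.2 ⟨by omega, hx⟩)
    · exact Finset.mem_insert_of_mem hx

theorem mem_word_factRSK {l : List (ℕ × ℕ)} (hl : IsFactorization l) :
    ∀ z ∈ word (factRSK l).1, z ∈ l.map Prod.fst := by
  induction l with
  | nil => simp [factRSK, word]
  | cons p l ih =>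
    obtain ⟨x, i⟩ := p
    obtain ⟨P, c, h₁, h₂, -⟩ := hl.exists_ins
    intro z hz
    rw [h₂] at hz
    rcases h₁.mem z hz with rfl | hz
    · simp
    · exact List.mem_cons_of_mem _ (ih hl.tail z hz)

theorem IsFactorization.le_snd {p : ℕ × ℕ} {l : List (ℕ × ℕ)} (h : IsFactorization (p :: l)) :
    ∀ q ∈ l, p.2 ≤ q.2 := by
  intro q hq
  rcases (List.pairwise_cons.1 h.pairwise).1 q hq with h | h <;> omega

/-- Forward, the matching grows letter by letter; the current index is at most every letter so far,
because earlier letters are bounded below by indices that are at least as large. Conversely, if the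
last index exceeded its letter `x`, all earlier letters would exceed `x`, so `x` would survive in
the first key column, while no entry of `Q` is at most `x`. -/
theorem bounded_iff_keyBound {l : List (ℕ × ℕ)} (hl : IsFactorization l) :
    (∀ q ∈ l, q.2 ≤ q.1) ↔ KeyBound (factRSK l).1 (factRSK l).2 := by
  constructor
  · intro h
    have key : ∃ τ, IsKeyMatching (factRSK l).1 (factRSK l).2 τ := by
      induction l with
      | nil => exact ⟨fun _ => id, by constructor <;> simp [factRSK, keyset_nil]⟩
      | cons p l ih =>
        obtain ⟨τ, hτ⟩ := ih hl.tail fun q hq => h q (by simp [hq])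
        obtain ⟨x, i⟩ := p
        obtain ⟨P, c, h₁, h₂, h₃⟩ := hl.exists_ins
        have hred := (hl.tail.spec.nilplactic.append_left [x]).isReducedWord hl.reduced
        have hw := mem_word_factRSK hl
        rw [h₂] at hw ⊢
        refine h₁.exists_isKeyMatching hl.tail.spec.isDecreasing hred h₃ (fun z hz => ?_) hτ
        obtain ⟨q, hq, rfl⟩ := List.mem_map.1 (hw z hz)
        have h₅ := h q hq
        rcases List.mem_cons.1 hq with rfl | hq
        · exact h₅
        · exact (hl.le_snd q hq).trans h₅
    obtain ⟨τ, hτ⟩ := key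
    exact hτ.keyBound
  · induction l with
    | nil => simp
    | cons p l ih =>
      obtain ⟨x, i⟩ := p
      obtain ⟨P, c, h₁, h₂, h₃⟩ := hl.exists_ins
      intro hb
      have hred := (hl.tail.spec.nilplactic.append_left [x]).isReducedWord hl.reduced
      have hnil := h₁.nilplactic hl.tail.spec.isDecreasing.sorted
      rw [h₂] at hb
      have htail := ih hl.tail (h₁.keyBound_of_keyBound hl.tail.spec.isDecreasing hred h₃ hb)
      intro q hq
      rcases List.mem_cons.1 hq with rfl | hq
      · by_contra hlt
        simp only [not_le] at hlt
        have hx : x ∈ keyset P 0 := by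
          rw [keyset_zero, ← hnil.starWord_eq, starWord_cons]
          refine mem_starWord_of_lt (by simp [starAct]) fun m hm => ?_
          obtain ⟨q, hq, rfl⟩ := List.mem_map.1 (mem_word_factRSK hl.tail m hm)
          have := htail q hq
          have := hl.le_snd q hq
          simp only at this
          omega
        have h₄ := hb 0 (x + 1)
        simp only [countLT_succ, if_pos hx] at h₄
        have h₅ := h₄.trans (leftCount_le_countLT _ 0 (x + 1))
        have h₆ : countLT ((appendBox (factRSK l).2 c i).getD 0 []).toFinset (x + 1) = 0 := by
          refine countLT_eq_zero fun s hs => ?_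
          rcases (mem_getD_appendBox h₃.le_length).1 (List.mem_toFinset.1 hs) with hs | ⟨-, rfl⟩
          · have := h₃.le s (mem_flatten_of_mem_getD hs)
            omega
          · omega
        omega
      · exact htail q hq

theorem bijOn_egRSK : Set.BijOn egRSK boundedReducedPairs boundedReducedTableaux := by
  refine ⟨?_, ?_, ?_⟩
  · rintro p ⟨hc, hb, hr⟩
    have hl := hc.isFactorization hr
    have hP : IsReducedDecreasing (factRSK (toFact p)).1 :=
      ⟨hl.spec.isDecreasing, hl.spec.nilplactic.isReducedWord hl.reduced⟩
    rw [egRSK_eq]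
    exact ⟨hl.spec.colLengths, hP, hl.spec.isRSSYT, (keyLE_iff hP hl.spec.isRSSYT
      hl.spec.colLengths).2 ((bounded_iff_keyBound hl).1 ((isBounded_iff hc.length_eq).1 hb))⟩
  · rintro p ⟨hc, -, hr⟩ q ⟨hc', -, hr'⟩ h
    rw [egRSK_eq, egRSK_eq] at h
    exact toFact_injective hc.length_eq hc'.length_eq
      (factRSK_injective (hc.isFactorization hr) (hc'.isFactorization hr') h)
  · rintro ⟨P, Q⟩ ⟨hs, hP, hQ, hk⟩
    obtain ⟨l, hl, he⟩ := factRSK_surjective hP hQ hs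
    obtain ⟨p, hc, hr, rfl⟩ := hl.exists_compatible
    refine ⟨p, ⟨hc, ?_, hr⟩, (egRSK_eq p).trans he⟩
    rw [isBounded_iff hc.length_eq, bounded_iff_keyBound hl, he]
    exact (keyLE_iff hP hQ hs).1 hk

theorem toSV_injective : Function.Injective toSV :=
  List.map_injective_iff.2 (List.map_injective_iff.2 Finset.singleton_injective)

theorem bijOn_heckeRSK :
    Set.BijOn heckeRSK boundedReducedPairs (Prod.map id toSV '' boundedReducedTableaux) := by
  have h := (Set.InjOn.bijOn_image (s := boundedReducedTableaux)
    (Function.Injective.prodMap Function.injective_id toSV_injective).injOn).comp bijOn_egRSK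
  exact h.congr fun p hp => (heckeRSK_eq hp.1 hp.2.2).symm

/-! ## Insertion is invariant under nilplactic equivalence -/

theorem ColStep.spec {x : ℕ} {C C' : List ℕ} {o : Option ℕ} (h : ColStep x C C' o)
    (hC : C.Pairwise (· > ·)) :
    (o = none ∧ (∀ z ∈ C, x < z) ∧ ∀ z, z ∈ C' ↔ z = x ∨ z ∈ C) ∨
      ∃ y, o = some y ∧ y ∈ C ∧ y < x ∧ (∀ z ∈ C, z < x → z ≤ y) ∧ (x ∈ C → x = y + 1) ∧
        ∀ z, z ∈ C' ↔ z = x ∨ (z ∈ C ∧ (z = y → x ∈ C)) := by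
  cases h with
  | append _ U hU =>
    refine Or.inl ⟨rfl, hU, fun z => ?_⟩
    simp [or_comm]
  | replace _ y U V hU hy =>
    refine Or.inr ⟨y, rfl, by simp, hy, ?_, ?_, ?_⟩ <;> grind [List.pairwise_cons]
  | keep y U V =>
    refine Or.inr ⟨y, rfl, by simp, by omega, ?_, ?_, ?_⟩ <;> grind [List.pairwise_cons]

/-- The nilplactic relations, without context. -/
inductive NilplacticTriple : List ℕ → List ℕ → Prop
  | left_witness (a b c : ℕ) (hab : a < b) (hbc : b < c) : NilplacticTriple [b, a, c] [b, c, a]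
  | right_witness (a b c : ℕ) (hab : a < b) (hbc : b < c) : NilplacticTriple [a, c, b] [c, a, b]
  | braid (a : ℕ) : NilplacticTriple [a, a + 1, a] [a + 1, a, a + 1]

theorem sorted_ext {C D : List ℕ} (hC : C.Pairwise (· > ·)) (hD : D.Pairwise (· > ·))
    (h : ∀ z, z ∈ C ↔ z ∈ D) : C = D :=
  (List.perm_of_nodup_nodup_toFinset_eq (hC.imp ne_of_gt) (hD.imp ne_of_gt)
    (by ext z; simpa using h z)).eq_of_pairwise' hC hD

theorem ColStep.unique {x : ℕ} {C C₁ C₂ : List ℕ} {o₁ o₂ : Option ℕ} (h₁ : ColStep x C C₁ o₁)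
    (h₂ : ColStep x C C₂ o₂) (hC : C.Pairwise (· > ·)) : C₁ = C₂ ∧ o₁ = o₂ := by
  have hC₁ := h₁.sorted hC
  have hC₂ := h₂.sorted hC
  rcases h₁.spec hC with ⟨rfl, k, kmem⟩ | ⟨u, rfl, hu, hua, humax, haC, kmem⟩ <;>
  rcases h₂.spec hC with ⟨rfl, k', kmem'⟩ | ⟨u', rfl, hu', hua', humax', haC', kmem'⟩
  · exact ⟨sorted_ext hC₁ hC₂ fun z => by rw [kmem, kmem'], rfl⟩
  · have := k u' hu'
    omega
  · have := k' u hu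
    omega
  · obtain rfl := le_antisymm (humax' u hu hua) (humax u' hu' hua')
    exact ⟨sorted_ext hC₁ hC₂ fun z => by rw [kmem, kmem'], rfl⟩

theorem ColStep.pred_some {x y : ℕ} {C C' : List ℕ} {o : Option ℕ} (h : ColStep x C C' o)
    (hC : C.Pairwise (· > ·)) (hy : y ∈ C) (hyx : y < x) (hmax : ∀ z ∈ C, z < x → z ≤ y) :
    o = some y ∧ (x ∈ C → x = y + 1) ∧ ∀ z, z ∈ C' ↔ z = x ∨ (z ∈ C ∧ (z = y → x ∈ C)) := by
  rcases h.spec hC with ⟨rfl, k, -⟩ | ⟨u, rfl, hu, hux, humax, hxC, hmem⟩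
  · have := k y hy
    omega
  · obtain rfl := le_antisymm (humax y hy hyx) (hmax u hu hux)
    exact ⟨rfl, hxC, hmem⟩

theorem ColStep.pred_none {x : ℕ} {C C' : List ℕ} {o : Option ℕ} (h : ColStep x C C' o)
    (hC : C.Pairwise (· > ·)) (hno : ∀ z ∈ C, x ≤ z) :
    o = none ∧ x ∉ C ∧ ∀ z, z ∈ C' ↔ z = x ∨ z ∈ C := by
  rcases h.spec hC with ⟨rfl, k, hmem⟩ | ⟨u, rfl, hu, hux, -, -, -⟩
  · exact ⟨rfl, fun hx => (k x hx).false, hmem⟩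
  · have := hno u hu
    omega

/-- With an entry strictly between `a` and `c`, the letter `c` bumps something above `a`, while `a`
only concerns the entries up to `a`: the two insertions do not interact. -/
theorem colStep_commute {a b c : ℕ} {C C₁ C₂ D₁ D₂ : List ℕ} {o₁ o₂ p₁ p₂ : Option ℕ}
    (hC : C.Pairwise (· > ·)) (hab : a < b) (hbc : b < c) (hex : ∃ z ∈ C, a < z ∧ z < c)
    (h₁ : ColStep c C C₁ o₁) (h₂ : ColStep a C₁ C₂ o₂) (k₁ : ColStep a C D₁ p₁)
    (k₂ : ColStep c D₁ D₂ p₂) : C₂ = D₂ ∧ o₂ = p₁ ∧ p₂ = o₁ ∧ ∃ y, o₁ = some y ∧ a < y := by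
  have hC₁ := h₁.sorted hC
  have hD₁ := k₁.sorted hC
  obtain ⟨z, hz, haz, hzc⟩ := hex
  have hC₂ := h₂.sorted hC₁
  have hD₂ := k₂.sorted hD₁
  rcases h₁.spec hC with ⟨-, h, -⟩ | ⟨y, ho₁, hy, hyc, hymax, hcC, hmem⟩
  · have := h z hz
    omega
  have hay : a < y := haz.trans_le (hymax z hz hzc)
  have e₁ : o₂ = p₁ := by
    rcases k₁.spec hC with ⟨hp₁, k, kmem⟩ | ⟨u, hp₁, hu, hua, humax, haC, kmem⟩ <;>
    rcases h₂.spec hC₁ with ⟨ho₂, h', kmem'⟩ | ⟨u', ho₂, hu', hua', humax', haC', kmem'⟩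
    · rw [ho₂, hp₁]
    · grind
    · grind
    · have h₁ := (hmem u').1 hu'
      have h₂ := humax' u ((hmem u).2 (Or.inr ⟨hu, by omega⟩)) hua
      have h₃ := humax u' (by rcases h₁ with h | h <;> [omega; exact h.1]) hua'
      rw [ho₂, hp₁, le_antisymm h₂ h₃]
  have e₂ : p₂ = o₁ := by
    rcases k₁.spec hC with ⟨hp₁, k, kmem⟩ | ⟨u, hp₁, hu, hua, humax, haC, kmem⟩ <;>
    rcases k₂.spec hD₁ with ⟨-, h, -⟩ | ⟨y', rfl, hy', hyc', hymax', hcC', hmem'⟩ <;> grind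
  refine ⟨sorted_ext hC₂ hD₂ fun x => ?_, e₁, e₂, y, ho₁, hay⟩
  subst e₁ e₂ ho₁
  rcases k₂.spec hD₁ with ⟨h, -, -⟩ | ⟨y', h, -, -, -, hcC', hmem'⟩
  · cases h
  obtain rfl : y = y' := by simpa using h
  rcases k₁.spec hC with ⟨rfl, k, kmem⟩ | ⟨u, rfl, hu, hua, humax, haC, kmem⟩
  · rcases h₂.spec hC₁ with ⟨-, -, kmem'⟩ | ⟨u', h, -, -, -, -, -⟩
    · simp only [kmem', hmem', hmem, kmem]
      grind
    · cases h
  · rcases h₂.spec hC₁ with ⟨h, -, -⟩ | ⟨u', h, -, -, -, haC', kmem'⟩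
    · cases h
    · obtain rfl : u = u' := by simpa using h
      simp only [kmem', hmem', hmem, kmem]
      have := hymax c
      grind

/-- What one column passes on to the next is again an equality or a relation, possibly of another
kind or direction. This lets invariance be proved column by column. -/
theorem colStep_left_witness {a b c : ℕ} {C C₁ C₂ C₃ D₁ D₂ D₃ : List ℕ}
    {o₁ o₂ o₃ p₁ p₂ p₃ : Option ℕ} (hC : C.Pairwise (· > ·)) (hab : a < b) (hbc : b < c)
    (h₁ : ColStep c C C₁ o₁) (h₂ : ColStep a C₁ C₂ o₂) (h₃ : ColStep b C₂ C₃ o₃)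
    (k₁ : ColStep a C D₁ p₁) (k₂ : ColStep c D₁ D₂ p₂) (k₃ : ColStep b D₂ D₃ p₃) :
    C₃ = D₃ ∧ (o₃.toList ++ o₂.toList ++ o₁.toList = p₃.toList ++ p₂.toList ++ p₁.toList ∨
      NilplacticTriple (o₃.toList ++ o₂.toList ++ o₁.toList)
        (p₃.toList ++ p₂.toList ++ p₁.toList) ∨
      NilplacticTriple (p₃.toList ++ p₂.toList ++ p₁.toList)
        (o₃.toList ++ o₂.toList ++ o₁.toList)) := by
  have hC₁ := h₁.sorted hC
  have hD₁ := k₁.sorted hC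
  have hC₂ := h₂.sorted hC₁
  have hD₂ := k₂.sorted hD₁
  have hC₃ := h₃.sorted hC₂
  have hD₃ := k₃.sorted hD₂
  by_cases hex : ∃ z ∈ C, a < z ∧ z < c
  · obtain ⟨rfl, rfl, rfl, y, rfl, hay⟩ := colStep_commute hC hab hbc hex h₁ h₂ k₁ k₂
    obtain ⟨rfl, rfl⟩ := h₃.unique k₃ hC₂
    refine ⟨rfl, ?_⟩
    rcases h₁.spec hC with ⟨h, -, -⟩ | ⟨y', h, hy, hyc, hymax, hcC, hmem⟩
    · cases h
    obtain rfl : y = y' := by simpa using h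
    rcases h₂.spec hC₁ with ⟨rfl, h', kmem'⟩ | ⟨u, rfl, hu, hua, humax, haC, kmem⟩
    · exact Or.inl (by simp)
    · rcases h₃.spec hC₂ with ⟨rfl, h', kmem'⟩ | ⟨t, rfl, ht, htb, htmax, hbC, tmem⟩
      · have := h' a h₂.mem_new
        omega
      · refine Or.inr (Or.inl ?_)
        have h₄ := htmax a h₂.mem_new hab
        have h₅ : t < y := by
          have e₁ := (kmem t).1 ht
          have e₂ := hmem t
          have e₃ := hymax t
          grind
        simpa using NilplacticTriple.left_witness u t y (by omega) h₅
  push Not at hex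
  -- If `a` is an entry, so is its predecessor `u`, and the bumped words are the two sides of the
  -- braid relation for `u`.
  by_cases ha : a ∈ C
  · rcases k₁.spec hC with ⟨rfl, k, kmem⟩ | ⟨u, rfl, hu, hua, humax, haC, kmem⟩
    · exact absurd (k a ha) (lt_irrefl _)
    obtain rfl := haC ha
    have hD : D₁ = C := sorted_ext hD₁ hC fun z => by grind
    subst hD
    have hbC : ∀ z ∈ D₁, z < c → z ≤ u + 1 := fun z hz hzc => by
      by_contra hlt
      have := hex z hz (by omega)
      omega
    obtain ⟨rfl, hc, m₁⟩ := h₁.pred_some hC ha (by omega) hbC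
    have hc : c ∉ D₁ := fun h => by have := hc h; omega
    have hbD : b ∉ D₁ := fun h => by have := hbC b h hbc; omega
    obtain ⟨rfl, -, m₂⟩ := h₂.pred_some hC₁ (y := u) (by grind) (by omega) (by grind)
    obtain ⟨rfl, -, m₃⟩ := h₃.pred_some hC₂ (y := u + 1) (by grind) (by omega) (by grind)
    obtain ⟨rfl, -, n₂⟩ := k₂.pred_some hD₁ ha (by omega) hbC
    obtain ⟨rfl, -, n₃⟩ := k₃.pred_some hD₂ (y := u) (by grind) (by omega) (by grind)
    refine ⟨sorted_ext hC₃ hD₃ fun z => ?_, Or.inr (Or.inr (.braid u))⟩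
    simp only [m₃, m₂, m₁, n₃, n₂]
    grind
  have hac : ∀ z ∈ C, z < c → z < a := fun z hz hzc => by
    by_contra hlt
    have hne : z ≠ a := fun h => ha (h ▸ hz)
    have := hex z hz (by omega)
    omega
  have hb : b ∉ C := fun h => by have := hac b h hbc; omega
  rcases h₁.spec hC with ⟨rfl, h, m₁⟩ | ⟨p, rfl, hp, hpc, hpmax, hcC, m₁⟩
  · have hc : c ∉ C := fun hc => (h c hc).false
    obtain ⟨rfl, -, m₂⟩ := h₂.pred_none hC₁ (by grind)
    obtain ⟨rfl, -, m₃⟩ := h₃.pred_some hC₂ (y := a) (by grind) (by omega) (by grind)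
    obtain ⟨rfl, -, n₁⟩ := k₁.pred_none hC (by grind)
    obtain ⟨rfl, -, n₂⟩ := k₂.pred_some hD₁ (y := a) (by grind) (by omega) (by grind)
    obtain ⟨rfl, -, n₃⟩ := k₃.pred_none hD₂ (by grind)
    refine ⟨sorted_ext hC₃ hD₃ fun z => ?_, Or.inl rfl⟩
    simp only [m₃, m₂, m₁, n₃, n₂, n₁]
    grind
  · have hpa := hac p hp hpc
    have hc : c ∉ C := fun h => by have := hcC h; omega
    obtain ⟨rfl, -, n₁⟩ := k₁.pred_some hC hp hpa (by grind)
    obtain ⟨rfl, -, n₂⟩ := k₂.pred_some hD₁ (y := a) (by grind) (by omega) (by grind)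
    rcases h₂.spec hC₁ with ⟨rfl, h, m₂⟩ | ⟨q, rfl, hq, hqa, hqmax, haC, m₂⟩
    · obtain ⟨rfl, -, m₃⟩ := h₃.pred_some hC₂ (y := a) (by grind) (by omega) (by grind)
      obtain ⟨rfl, -, n₃⟩ := k₃.pred_none hD₂ (by grind)
      refine ⟨sorted_ext hC₃ hD₃ fun z => ?_, Or.inl rfl⟩
      simp only [m₃, m₂, m₁, n₃, n₂, n₁]
      grind
    · have hqC : q ∈ C ∧ q ≠ p := by grind
      have hqp : q < p := by grind
      obtain ⟨rfl, -, m₃⟩ := h₃.pred_some hC₂ (y := a) (by grind) (by omega) (by grind)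
      obtain ⟨rfl, -, n₃⟩ := k₃.pred_some hD₂ (y := q) (by grind) (by omega) (by grind)
      refine ⟨sorted_ext hC₃ hD₃ fun z => ?_, Or.inr (Or.inr (.right_witness q p a hqp hpa))⟩
      simp only [m₃, m₂, m₁, n₃, n₂, n₁]
      grind

/-- Once `b` has been inserted it is an entry between `a` and `c`, so `colStep_commute` always
applies. -/
theorem colStep_right_witness {a b c : ℕ} {C C₁ C₂ C₃ D₂ D₃ : List ℕ}
    {o₁ o₂ o₃ p₂ p₃ : Option ℕ} (hC : C.Pairwise (· > ·)) (hab : a < b) (hbc : b < c)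
    (h₁ : ColStep b C C₁ o₁) (h₂ : ColStep c C₁ C₂ o₂) (h₃ : ColStep a C₂ C₃ o₃)
    (k₂ : ColStep a C₁ D₂ p₂) (k₃ : ColStep c D₂ D₃ p₃) :
    C₃ = D₃ ∧ (o₃.toList ++ o₂.toList ++ o₁.toList = p₃.toList ++ p₂.toList ++ o₁.toList ∨
      NilplacticTriple (o₃.toList ++ o₂.toList ++ o₁.toList)
        (p₃.toList ++ p₂.toList ++ o₁.toList)) := by
  have hC₁ := h₁.sorted hC
  have hC₂ := h₂.sorted hC₁
  obtain ⟨rfl, rfl, rfl, y, rfl, hay⟩ := colStep_commute hC₁ hab hbc ⟨b, h₁.mem_new, hab, hbc⟩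
    h₂ h₃ k₂ k₃
  refine ⟨rfl, ?_⟩
  have hby : b ≤ y := by
    rcases h₂.spec hC₁ with ⟨h, -, -⟩ | ⟨y', h, -, -, hmax, -, -⟩
    · cases h
    · obtain rfl : y = y' := by simpa using h
      exact hmax b h₁.mem_new hbc
  rcases k₂.spec hC₁ with ⟨rfl, k, n₂⟩ | ⟨u, rfl, hu, hua, humax, haC, n₂⟩
  · exact Or.inl (by simp)
  · right
    rcases h₁.spec hC with ⟨rfl, h, m₁⟩ | ⟨t, rfl, ht, htb, htmax, hbC, m₁⟩
    · have := h u (by grind)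
      omega
    · have hut : u < t := by
        have := htmax u
        grind
      simpa using NilplacticTriple.right_witness u t y hut (by omega)

/-- If `a` is an entry, so is its predecessor, and the braid relation is passed on one step lower.
Otherwise the bumped words agree or differ by an exchange of two letters. -/
theorem colStep_braid {a : ℕ} {C C₁ C₂ C₃ D₁ D₂ D₃ : List ℕ}
    {o₁ o₂ o₃ p₁ p₂ p₃ : Option ℕ} (hC : C.Pairwise (· > ·))
    (h₁ : ColStep a C C₁ o₁) (h₂ : ColStep (a + 1) C₁ C₂ o₂) (h₃ : ColStep a C₂ C₃ o₃)
    (k₁ : ColStep (a + 1) C D₁ p₁) (k₂ : ColStep a D₁ D₂ p₂) (k₃ : ColStep (a + 1) D₂ D₃ p₃) :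
    C₃ = D₃ ∧ (o₃.toList ++ o₂.toList ++ o₁.toList = p₃.toList ++ p₂.toList ++ p₁.toList ∨
      NilplacticTriple (o₃.toList ++ o₂.toList ++ o₁.toList)
        (p₃.toList ++ p₂.toList ++ p₁.toList)) := by
  have hC₁ := h₁.sorted hC
  have hD₁ := k₁.sorted hC
  have hC₂ := h₂.sorted hC₁
  have hD₂ := k₂.sorted hD₁
  have hC₃ := h₃.sorted hC₂
  have hD₃ := k₃.sorted hD₂
  rcases h₁.spec hC with ⟨rfl, h, m₁⟩ | ⟨p, rfl, hp, hpa, hpmax, haC, m₁⟩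
  · have ha : a ∉ C := fun ha => (h a ha).false
    obtain ⟨rfl, ha', n₁⟩ := k₁.pred_none hC (by grind)
    obtain ⟨rfl, -, m₂⟩ := h₂.pred_some hC₁ (y := a) (by grind) (by omega) (by grind)
    obtain ⟨rfl, -, m₃⟩ := h₃.pred_none hC₂ (by grind)
    obtain ⟨rfl, -, n₂⟩ := k₂.pred_none hD₁ (by grind)
    obtain ⟨rfl, -, n₃⟩ := k₃.pred_some hD₂ (y := a) (by grind) (by omega) (by grind)
    refine ⟨sorted_ext hC₃ hD₃ fun z => ?_, Or.inl rfl⟩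
    simp only [m₃, m₂, m₁, n₃, n₂, n₁]
    grind
  by_cases ha : a ∈ C
  · obtain rfl := haC ha
    obtain ⟨rfl, -, m₂⟩ := h₂.pred_some hC₁ (y := p + 1) (by grind) (by omega) (by grind)
    obtain ⟨rfl, -, m₃⟩ := h₃.pred_some hC₂ (y := p) (by grind) (by omega) (by grind)
    obtain ⟨rfl, -, n₁⟩ := k₁.pred_some hC (y := p + 1) (by grind) (by omega) (by grind)
    obtain ⟨rfl, -, n₂⟩ := k₂.pred_some hD₁ (y := p) (by grind) (by omega) (by grind)
    obtain ⟨rfl, -, n₃⟩ := k₃.pred_some hD₂ (y := p + 1) (by grind) (by omega) (by grind)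
    refine ⟨sorted_ext hC₃ hD₃ fun z => ?_, Or.inr (.braid p)⟩
    simp only [m₃, m₂, m₁, n₃, n₂, n₁]
    grind
  · obtain ⟨rfl, ha', n₁⟩ := k₁.pred_some hC (y := p) (by grind) (by omega) (by grind)
    obtain ⟨rfl, -, m₂⟩ := h₂.pred_some hC₁ (y := a) (by grind) (by omega) (by grind)
    have ha' : a + 1 ∉ C := fun h => by have := ha' h; omega
    rcases h₃.spec hC₂ with ⟨rfl, h, m₃⟩ | ⟨q, rfl, hq, hqa, hqmax, -, m₃⟩
    · obtain ⟨rfl, -, n₂⟩ := k₂.pred_none hD₁ (by grind)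
      obtain ⟨rfl, -, n₃⟩ := k₃.pred_some hD₂ (y := a) (by grind) (by omega) (by grind)
      refine ⟨sorted_ext hC₃ hD₃ fun z => ?_, Or.inl rfl⟩
      simp only [m₃, m₂, m₁, n₃, n₂, n₁]
      grind
    · have hqp : q < p := by grind
      obtain ⟨rfl, -, n₂⟩ := k₂.pred_some hD₁ (y := q) (by grind) (by omega) (by grind)
      obtain ⟨rfl, -, n₃⟩ := k₃.pred_some hD₂ (y := a) (by grind) (by omega) (by grind)
      refine ⟨sorted_ext hC₃ hD₃ fun z => ?_, Or.inr ?_⟩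
      · simp only [m₃, m₂, m₁, n₃, n₂, n₁]
        grind
      · exact .right_witness q p a hqp hpa

/-- The insertion tableau of a word, inserted from right to left into `T`. -/
def insertWord (u : List ℕ) (T : Tableau) : Tableau := u.foldr (fun x T => (egColumnInsert x T).1) T

/-! ### Insertion of whole words and invariance of the insertion tableau -/

theorem insertWord_nil (T : Tableau) : insertWord [] T = T := rfl

theorem insertWord_cons (x : ℕ) (u : List ℕ) (T : Tableau) :
    insertWord (x :: u) T = (egColumnInsert x (insertWord u T)).1 := rfl

theorem insertWord_append (u v : List ℕ) (T : Tableau) :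
    insertWord (u ++ v) T = insertWord u (insertWord v T) := List.foldr_append

theorem ColStep.egColumnInsert_eq {x : ℕ} {C C' : List ℕ} {o : Option ℕ} (h : ColStep x C C' o)
    (hC : C.Pairwise (· > ·)) (R : Tableau) :
    (egColumnInsert x (C :: R)).1 = C' :: insertWord o.toList R := by
  cases o with
  | none => simp [egColumnInsert, h.find_none, h.lt_of_none.1, insertWord]
  | some y =>
    obtain ⟨h₁, h₂⟩ := h.find_some hC
    simp only [egColumnInsert, h₁, ← h₂]
    rfl

/-- Lets a tableau without columns be treated as one with an empty column, to which
`insertWord_column` applies. -/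
theorem insertWord_empty_column {u : List ℕ} (hu : u ≠ []) :
    insertWord u [] = insertWord u [[]] := by
  obtain ⟨v, x, rfl⟩ := List.eq_nil_or_concat u |>.resolve_left hu
  rw [List.concat_eq_append, insertWord_append, insertWord_append]
  rfl

theorem exists_colStep_of_reduced {x : ℕ} {C p w : List ℕ} (hC : C.Pairwise (· > ·))
    (hr : IsReducedWord (p ++ x :: C.reverse ++ w)) :
    ∃ C' o, ColStep x C C' o ∧ C'.Pairwise (· > ·) ∧
      IsReducedWord (p ++ C'.reverse ++ (o.toList ++ w)) := by
  obtain ⟨C', o, h⟩ := exists_colStep hC hr.left.right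
  refine ⟨C', o, h, h.sorted hC, ?_⟩
  have := ((h.nilplactic hC).append p w).isReducedWord hr
  simpa using this

theorem exists_colStep_triple {x y z : ℕ} {C w : List ℕ} (hC : C.Pairwise (· > ·))
    (hr : IsReducedWord ([x, y, z] ++ (C.reverse ++ w))) :
    ∃ C₁ C₂ C₃ o₁ o₂ o₃, ColStep z C C₁ o₁ ∧ ColStep y C₁ C₂ o₂ ∧ ColStep x C₂ C₃ o₃ ∧
      IsReducedWord (o₃.toList ++ o₂.toList ++ o₁.toList ++ w) ∧
      ∀ R, insertWord [x, y, z] (C :: R) =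
        C₃ :: insertWord (o₃.toList ++ o₂.toList ++ o₁.toList) R := by
  obtain ⟨C₁, o₁, h₁, hC₁, hr₁⟩ := exists_colStep_of_reduced (p := [x, y]) (w := w) hC
    (by simpa using hr)
  obtain ⟨C₂, o₂, h₂, hC₂, hr₂⟩ := exists_colStep_of_reduced (p := [x]) (w := o₁.toList ++ w) hC₁
    (by simpa using hr₁)
  obtain ⟨C₃, o₃, h₃, -, hr₃⟩ := exists_colStep_of_reduced (p := [])
    (w := o₂.toList ++ (o₁.toList ++ w)) hC₂ (by simpa using hr₂)
  refine ⟨C₁, C₂, C₃, o₁, o₂, o₃, h₁, h₂, h₃, ?_, fun R => ?_⟩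
  · have := IsReducedWord.right (u := C₃.reverse) (by simpa using hr₃)
    simpa using this
  · rw [insertWord_cons, insertWord_cons, insertWord_cons, insertWord_nil, h₁.egColumnInsert_eq hC,
      h₂.egColumnInsert_eq hC₁, h₃.egColumnInsert_eq hC₂, insertWord_append, insertWord_append]

theorem NilplacticTriple.nilplactic {t t' : List ℕ} (h : NilplacticTriple t t') :
    Nilplactic t t' := by
  cases h with
  | left_witness a b c hab hbc => exact .rel _ _ (by simpa using .left_witness [] [] a b c hab hbc)
  | right_witness a b c hab hbc =>
    exact .rel _ _ (by simpa using .right_witness [] [] a b c hab hbc)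
  | braid a => exact .rel _ _ (by simpa using .braid [] [] a)

theorem NilplacticTriple.insertWord_nil {t t' : List ℕ} (h : NilplacticTriple t t') :
    insertWord t [] = insertWord t' [] := by
  cases h with
  | left_witness a b c hab hbc =>
    have : a < c := hab.trans hbc
    simp [insertWord, egColumnInsert, replaceEntry, *, hbc.not_gt, this.not_gt, hab.ne', this.ne',
      hbc.ne]
  | right_witness a b c hab hbc =>
    have : a < c := hab.trans hbc
    simp [insertWord, egColumnInsert, replaceEntry, *, hab.not_gt, this.not_gt, hbc.ne', this.ne',
      hab.ne]
  | braid a =>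
    simp [insertWord, egColumnInsert, replaceEntry]

/-- Induction on the columns, each of which turns the relation into an equality or a relation
between the bumped words. Reducedness makes every insertion a `ColStep`. -/
theorem NilplacticTriple.insertWord_eq {t t' : List ℕ} (h : NilplacticTriple t t') {T : Tableau}
    (hT : ∀ C ∈ T, C.Pairwise (· > ·)) (hr : IsReducedWord (t ++ word T)) :
    insertWord t T = insertWord t' T := by
  induction T generalizing t t' with
  | nil => exact h.insertWord_nil
  | cons C R ih =>
    have hC := hT C (by simp)
    have hR : ∀ D ∈ R, D.Pairwise (· > ·) := fun D hD => hT D (by simp [hD])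
    rw [word_cons] at hr
    have hr' := (h.nilplactic.append_right (C.reverse ++ word R)).isReducedWord hr
    have key : ∀ {C₁ C₂ s s' : List ℕ}, IsReducedWord (s ++ word R) → IsReducedWord (s' ++ word R) →
        C₁ = C₂ ∧ (s = s' ∨ NilplacticTriple s s' ∨ NilplacticTriple s' s) →
        C₁ :: insertWord s R = C₂ :: insertWord s' R := by
      rintro C₁ C₂ s s' hs hs' ⟨rfl, rfl | h | h⟩
      · rfl
      · rw [ih h hR hs]
      · rw [ih h hR hs']
    cases h with
    | left_witness a b c hab hbc =>
      obtain ⟨C₁, C₂, C₃, o₁, o₂, o₃, h₁, h₂, h₃, h₄, h₅⟩ := exists_colStep_triple hC hr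
      obtain ⟨D₁, D₂, D₃, p₁, p₂, p₃, k₁, k₂, k₃, k₄, k₅⟩ := exists_colStep_triple hC hr'
      rw [h₅, k₅]
      exact key h₄ k₄ (by
        have := colStep_left_witness hC hab hbc h₁ h₂ h₃ k₁ k₂ k₃
        tauto)
    | right_witness a b c hab hbc =>
      obtain ⟨C₁, C₂, C₃, o₁, o₂, o₃, h₁, h₂, h₃, h₄, h₅⟩ := exists_colStep_triple hC hr
      obtain ⟨D₁, D₂, D₃, p₁, p₂, p₃, k₁, k₂, k₃, k₄, k₅⟩ := exists_colStep_triple hC hr'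
      rw [h₅, k₅]
      obtain ⟨rfl, rfl⟩ := h₁.unique k₁ hC
      exact key h₄ k₄ (by
        have := colStep_right_witness hC hab hbc h₁ h₂ h₃ k₂ k₃
        tauto)
    | braid a =>
      obtain ⟨C₁, C₂, C₃, o₁, o₂, o₃, h₁, h₂, h₃, h₄, h₅⟩ := exists_colStep_triple hC hr
      obtain ⟨D₁, D₂, D₃, p₁, p₂, p₃, k₁, k₂, k₃, k₄, k₅⟩ := exists_colStep_triple hC hr'
      rw [h₅, k₅]
      exact key h₄ k₄ (by
        have := colStep_braid hC h₁ h₂ h₃ k₁ k₂ k₃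
        tauto)

theorem isDecreasing_insertWord {T : Tableau} (hT : IsDecreasing T) {u : List ℕ}
    (hr : IsReducedWord (u ++ word T)) :
    IsDecreasing (insertWord u T) ∧ Nilplactic (u ++ word T) (word (insertWord u T)) := by
  induction u with
  | nil => exact ⟨hT, .refl _⟩
  | cons x u ih =>
    obtain ⟨h₁, h₂⟩ := ih hr.tail
    obtain ⟨T', c, h⟩ := exists_EGIns h₁.sorted ((h₂.append_left [x]).isReducedWord hr)
    rw [insertWord_cons, h.eq h₁.sorted]
    exact ⟨h.isDecreasing (hr.1 x (by simp)) h₁,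
      (h₂.append_left [x]).trans (h.nilplactic h₁.sorted)⟩

theorem IsReducedWord.insertWord {u : List ℕ} (hr : IsReducedWord u) :
    IsDecreasing (insertWord u []) ∧ Nilplactic u (word (insertWord u [])) := by
  simpa [word_nil] using isDecreasing_insertWord isDecreasing_nil (u := u) (by simpa [word_nil] using hr)

theorem NilplacticStep.exists_triple {u v : List ℕ} (h : NilplacticStep u v) :
    ∃ p t t' s, u = p ++ (t ++ s) ∧ v = p ++ (t' ++ s) ∧ NilplacticTriple t t' := by
  cases h with
  | left_witness p s a b c hab hbc => exact ⟨p, _, _, s, by simp, by simp, .left_witness a b c hab hbc⟩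
  | right_witness p s a b c hab hbc =>
    exact ⟨p, _, _, s, by simp, by simp, .right_witness a b c hab hbc⟩
  | braid p s a => exact ⟨p, _, _, s, by simp, by simp, .braid a⟩

theorem Nilplactic.insertWord_eq {u v : List ℕ} (h : Nilplactic u v) (hu : IsReducedWord u) :
    insertWord u [] = insertWord v [] := by
  induction h with
  | rel u v h =>
    obtain ⟨p, t, t', s, rfl, rfl, ht⟩ := h.exists_triple
    obtain ⟨h₁, h₂⟩ := hu.right.right.insertWord
    simp only [insertWord_append]
    rw [ht.insertWord_eq h₁.sorted ((h₂.append_left t).isReducedWord hu.right)]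
  | refl => rfl
  | symm u v h ih => exact (ih ((Nilplactic.symm h).isReducedWord hu)).symm
  | trans u v w h₁ h₂ ih₁ ih₂ => exact (ih₁ hu).trans (ih₂ (Nilplactic.isReducedWord h₁ hu))

/-- The letters enter from the largest down. Each replaces the entry of `D` in its own row, or is
appended if there is none, so `D` is bumped from the top down and enters the next column in the same
order. -/
theorem insertWord_column {C D : List ℕ} (hC : C.Pairwise (· > ·)) (hD : D.Pairwise (· > ·))
    (h : Dominates C D) (R : Tableau) :
    insertWord C.reverse (D :: R) = C :: insertWord D.reverse R := by
  have key : ∀ U W : List ℕ, U ++ W = C → insertWord U.reverse (D :: R) =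
      (U ++ D.drop U.length) :: insertWord (D.take U.length).reverse R := by
    intro U
    induction U using List.reverseRecOn with
    | nil => intro W _; simp [insertWord_nil]
    | append_singleton U x ih =>
      intro W hW
      have ih := ih (x :: W) (by simpa using hW)
      have hs : ∀ u ∈ U, x < u := by
        intro u hu
        rw [← hW, List.append_assoc] at hC
        exact (List.pairwise_append.1 hC).2.2 u hu x (by simp)
      rw [List.reverse_append, List.reverse_singleton, List.singleton_append, insertWord_cons, ih,
        List.length_append, List.length_singleton]
      cases hd : D.drop U.length with
      | nil =>
        have hlen : D.length ≤ U.length := List.drop_eq_nil_iff.1 hd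
        rw [List.append_nil, (ColStep.append x U hs).egColumnInsert_eq (by
          rw [← hW] at hC
          exact (List.pairwise_append.1 (List.pairwise_append.1 hC).1).1),
          List.drop_eq_nil_of_le (by omega), List.take_of_length_le (by omega),
          List.take_of_length_le (by omega)]
        simp [insertWord_nil]
      | cons d D' =>
        have hget : D[U.length]? = some d := by
          have := congrArg (·[0]?) hd
          simpa using this
        obtain ⟨w, hw, hlt⟩ := dominates_iff.1 h _ _ hget
        have hwx : w = x := by
          rw [← hW] at hw
          simpa using hw.symm
        subst hwx
        have hUd : (U ++ d :: D').Pairwise (· > ·) := by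
          rw [List.pairwise_append]
          refine ⟨?_, ?_, ?_⟩
          · rw [← hW] at hC
            exact (List.pairwise_append.1 (List.pairwise_append.1 hC).1).1
          · rw [← hd]
            exact hD.sublist (List.drop_sublist _ _)
          · intro u hu z hz
            have h₁ := hs u hu
            rcases List.mem_cons.1 hz with rfl | hz
            · omega
            · have : (d :: D').Pairwise (· > ·) := hd ▸ hD.sublist (List.drop_sublist _ _)
              have := (List.pairwise_cons.1 this).1 z hz
              omega
        rw [(ColStep.replace w d U D' hs hlt).egColumnInsert_eq hUd]
        have hdrop : D.drop (U.length + 1) = D' := by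
          rw [← List.drop_drop, hd]
          rfl
        rw [hdrop, List.take_add_one, hget]
        simp [insertWord_cons, insertWord_nil]
  have := key C [] (by simp)
  rwa [List.drop_eq_nil_of_le h.1, List.take_of_length_le h.1, List.append_nil] at this

theorem IsDecreasing.insertWord_word {P : Tableau} (hP : IsDecreasing P) :
    insertWord (word P) [] = P := by
  have key : ∀ (R : Tableau) (C : List ℕ), IsDecreasing (C :: R) →
      insertWord C.reverse R = C :: R := by
    intro R
    induction R with
    | nil =>
      intro C hC
      rw [insertWord_empty_column (by simpa using (hC.1 C (by simp)).1),
        insertWord_column (hC.sorted C (by simp)) .nil (dominates_nil C)]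
      rfl
    | cons D R ih =>
      intro C hC
      obtain ⟨h₁, h₂, h₃⟩ := isDecreasing_cons.1 hC
      rw [insertWord_column h₁.2.2 (h₃.sorted D (by simp)) h₂, ih D h₃]
  induction P with
  | nil => rfl
  | cons C R ih => rw [word_cons, insertWord_append, ih (isDecreasing_cons.1 hP).2.2, key R C hP]

/-- A reduced decreasing tableau is the insertion tableau of any word equivalent to its word. -/
theorem IsReducedDecreasing.insertWord_eq {P : Tableau} (hP : IsReducedDecreasing P) {u : List ℕ}
    (h : Nilplactic u (word P)) : insertWord u [] = P :=
  (h.insertWord_eq (h.symm.isReducedWord hP.2)).trans hP.1.insertWord_word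

/-! ## Frank words and the right nil key -/

theorem word_append (A B : Tableau) : word (A ++ B) = word A ++ word B := by simp [word]

theorem colLengths_append (A B : Tableau) : colLengths (A ++ B) = colLengths A ++ colLengths B := by
  simp [colLengths]

theorem getD_addBox {l : List ℕ} {c : ℕ} (hc : c ≤ l.length) (k : ℕ) :
    (addBox l c).getD k 0 = if k = c then l.getD c 0 + 1 else l.getD k 0 := by
  induction l generalizing c k with
  | nil =>
    obtain rfl : c = 0 := by simpa using hc
    cases k <;> simp [addBox]
  | cons n l ih =>
    cases c with
    | zero => cases k <;> simp [addBox]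
    | succ c =>
      cases k with
      | zero => simp [addBox]
      | succ k => simpa [addBox] using ih (by simpa using hc) k

/-- A new column counts as having had length `0`, although no such entry is in `l`; `0 < d` makes
this harmless. -/
theorem count_addBox {l : List ℕ} {c d : ℕ} (hc : c ≤ l.length) (hd : 0 < d) :
    (addBox l c).count d + (if l.getD c 0 = d then 1 else 0) =
      l.count d + if l.getD c 0 + 1 = d then 1 else 0 := by
  induction l generalizing c with
  | nil =>
    obtain rfl : c = 0 := by simpa using hc
    simp [addBox, List.count_cons, hd.ne]
  | cons n l ih =>
    cases c with
    | zero =>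
      simp only [addBox, List.count_cons, beq_iff_eq, List.getD_cons_zero]
      split_ifs <;> omega
    | succ c =>
      have := ih (c := c) (by simpa using hc)
      simp only [addBox, List.count_cons, List.getD_cons_succ]
      omega

/-- The sum of the row indices of the boxes of a diagram with given column lengths. -/
def rowSum (l : List ℕ) : ℕ := (l.map (·.choose 2)).sum

theorem rowSum_addBox {l : List ℕ} {c : ℕ} (hc : c ≤ l.length) :
    rowSum (addBox l c) = rowSum l + l.getD c 0 := by
  induction l generalizing c with
  | nil => simp [addBox, rowSum]
  | cons n l ih =>
    cases c with
    | zero =>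
      have h : (n + 1).choose 2 = n + n.choose 2 := by
        rw [Nat.choose_succ_succ' n 1, Nat.choose_one_right]
      simp only [addBox, rowSum, List.map_cons, List.sum_cons, List.getD_cons_zero, h]
      omega
    | succ c =>
      have := ih (c := c) (by simpa using hc)
      simp only [addBox, rowSum, List.map_cons, List.sum_cons, List.getD_cons_succ] at this ⊢
      omega

/-- All columns of the right key of `T` of length `d` are equal to `S`, and there are at least `m`
of them. -/
def HasKeyColumn (T : Tableau) (S : Finset ℕ) (d m : ℕ) : Prop :=
  (∀ k, (colLengths T).getD k 0 = d → keyset T k = S) ∧ m ≤ (colLengths T).count d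

/-- Key columns other than `c` do not change. If column `c` reaches length `d`, a column further
left already has this length because `0 < m`, and nested key columns of equal size coincide. -/
theorem EGIns.hasKeyColumn {x d m m' c : ℕ} {T T' : Tableau} {S : Finset ℕ} (h : EGIns x T T' c)
    (hT : IsDecreasing T) (hr : IsReducedWord (x :: word T)) (hd : 0 < d) (hm : 0 < m)
    (hS : HasKeyColumn T S d m) (hcard : S.card = d)
    (hm' : m' + (if (NilKey.colLengths T).getD c 0 = d then 1 else 0) ≤
      m + if (NilKey.colLengths T).getD c 0 + 1 = d then 1 else 0) : HasKeyColumn T' S d m' := by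
  obtain ⟨h₁, h₂⟩ := hS
  have hc : c ≤ (NilKey.colLengths T).length := by simpa [NilKey.colLengths] using h.le_length
  have hT' := h.isDecreasing (hr.1 x (by simp)) hT
  have hr' := (h.nilplactic hT.sorted).isReducedWord hr
  obtain ⟨z, hz, hk, -⟩ := h.exists_keyset hT hr
  refine ⟨fun k hkd => ?_, ?_⟩
  · have hkd' := hkd
    rw [h.colLengths, getD_addBox hc] at hkd
    split_ifs at hkd with hkc
    · subst hkc
      obtain ⟨j, hj, hjd⟩ := List.mem_iff_getElem.1 (List.count_pos_iff.1 (hm.trans_le h₂))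
      have hjd' : (NilKey.colLengths T).getD j 0 = d := by
        rw [List.getD_eq_getElem _ _ hj, hjd]
      have hjk : j < k := by
        by_contra hlt
        have hne : k ≠ j := by
          rintro rfl
          omega
        have := List.pairwise_iff_getElem.1 hT.pairwise_colLengths k j (by omega) hj (by omega)
        rw [List.getD_eq_getElem _ _ (by omega)] at hkd
        omega
      refine Finset.eq_of_subset_of_card_le ?_ ?_
      · rw [← h₁ j hjd']
        have := hk j
        rw [if_neg (by omega)] at this
        rw [← this]
        exact keyset_antitone T' hjk.le
      · rw [card_keyset ⟨hT', hr'⟩, hkd', hcard]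
    · rw [hk, if_neg hkc]
      exact h₁ k hkd
  · have := count_addBox hc hd
    rw [h.colLengths]
    split_ifs at this hm' <;> omega

/-- The letters enter from the largest down, so letter `r`, counted from `0`, lands in row `r` or
lower, which bounds the growth of the sum of row indices. If the growth is minimal, each letter
lands exactly in row `r`: a column of length `d` is gained when `r = d - 1` and lost only when `r =
d`, so one always survives. -/
theorem insertWord_factor {C : List ℕ} {T : Tableau} (hT : IsDecreasing T)
    (hC : C.Pairwise (· > ·)) (hr : IsReducedWord (C.reverse ++ word T)) :
    rowSum (colLengths T) + C.length.choose 2 ≤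
        rowSum (colLengths (insertWord C.reverse T)) ∧
      (rowSum (colLengths (insertWord C.reverse T)) ≤
          rowSum (colLengths T) + C.length.choose 2 →
        ∀ S d, 0 < d → S.card = d → HasKeyColumn T S d 1 →
          HasKeyColumn (insertWord C.reverse T) S d 1) := by
  -- The induction keeps a second column of length `d` when exactly `d` letters have entered; it
  -- pays for the one lost to the next letter.
  suffices key : IsDecreasing (insertWord C.reverse T) ∧
      Nilplactic (C.reverse ++ word T) (word (insertWord C.reverse T)) ∧
      (∀ U x, C = U ++ [x] → ∃ c, EGIns x (insertWord U.reverse T) (insertWord C.reverse T) c ∧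
        U.length ≤ (colLengths (insertWord U.reverse T)).getD c 0) ∧
      rowSum (colLengths T) + C.length.choose 2 ≤
        rowSum (colLengths (insertWord C.reverse T)) ∧
      (rowSum (colLengths (insertWord C.reverse T)) ≤
          rowSum (colLengths T) + C.length.choose 2 →
        ∀ S d, 0 < d → S.card = d → HasKeyColumn T S d 1 →
          HasKeyColumn (insertWord C.reverse T) S d (1 + if C.length = d then 1 else 0)) by
    refine ⟨key.2.2.2.1, fun h S d hd hS hk => ?_⟩
    obtain ⟨h₁, h₂⟩ := key.2.2.2.2 h S d hd hS hk
    exact ⟨h₁, by omega⟩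
  induction C using List.reverseRecOn with
  | nil =>
    refine ⟨hT, .refl _, by simp, by simp [insertWord_nil], ?_⟩
    intro _ S d hd _ h
    simpa [insertWord_nil, hd.ne] using h
  | append_singleton U x ih =>
    rw [List.reverse_append, List.reverse_singleton, List.singleton_append, List.cons_append] at hr
    obtain ⟨h₁, h₂, h₃, h₄, h₅⟩ := ih (List.pairwise_append.1 hC).1 hr.tail
    have hr' := (h₂.append_left [x]).isReducedWord hr
    obtain ⟨T', c, hins⟩ := exists_EGIns h₁.sorted hr'
    have he : insertWord (U ++ [x]).reverse T = T' := by
      rw [List.reverse_append, List.reverse_singleton, List.singleton_append, insertWord_cons,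
        hins.eq h₁.sorted]
    have hc : c ≤ (colLengths (insertWord U.reverse T)).length := by
      simpa [colLengths] using hins.le_length
    -- The previous letter was larger, so the new box is weakly to the left of the last one, in a
    -- column at least as long as the column just extended.
    have hrow : U.length ≤ (colLengths (insertWord U.reverse T)).getD c 0 := by
      rcases List.eq_nil_or_concat U with hU | ⟨V, y, hU⟩
      · simp [hU]
      · rw [List.concat_eq_append] at hU
        obtain ⟨c', hins', hV⟩ := h₃ V y hU
        have hyx : x < y := by
          rw [hU] at hC
          exact (List.pairwise_append.1 hC).2.2 y (by simp) x (by simp)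
        have hVdec : ∀ D ∈ insertWord V.reverse T, D.Pairwise (· > ·) := by
          have hrV : IsReducedWord (V.reverse ++ word T) := by
            have := hr.tail
            rw [hU, List.reverse_append, List.reverse_singleton, List.singleton_append,
              List.cons_append] at this
            exact this.tail
          exact (isDecreasing_insertWord hT hrV).1.sorted
        have hcc := hins'.le_of_gt hins hyx hVdec
        have hlen' : c' ≤ (colLengths (insertWord V.reverse T)).length := by
          simpa [colLengths] using hins'.le_length
        have hlast : (colLengths (insertWord U.reverse T)).getD c' 0 =
            (colLengths (insertWord V.reverse T)).getD c' 0 + 1 := by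
          rw [hins'.colLengths, getD_addBox hlen', if_pos rfl]
        have hUV : U.length = V.length + 1 := by simp [hU]
        have hc' : c' < (colLengths (insertWord U.reverse T)).length := by
          by_contra hlt
          rw [List.getD_eq_default _ _ (by omega)] at hlast
          omega
        rcases hcc.eq_or_lt with rfl | hlt
        · omega
        · have := List.pairwise_iff_getElem.1 h₁.pairwise_colLengths c c' (by omega) hc' hlt
          rw [List.getD_eq_getElem _ _ hc'] at hlast
          rw [List.getD_eq_getElem _ _ (by omega)]
          omega
    have hsum : rowSum (colLengths T') = rowSum (colLengths (insertWord U.reverse T)) +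
        (colLengths (insertWord U.reverse T)).getD c 0 := by
      rw [hins.colLengths, rowSum_addBox hc]
    have hch : (U ++ [x]).length.choose 2 = U.length + U.length.choose 2 := by
      rw [List.length_append, List.length_singleton, Nat.choose_succ_succ' _ 1,
        Nat.choose_one_right]
    rw [he, hch]
    refine ⟨hins.isDecreasing (hr.1 x (by simp)) h₁, ?_, ?_, by omega, ?_⟩
    · have := (h₂.append_left [x]).trans (hins.nilplactic h₁.sorted)
      simpa using this
    · intro V y hV
      obtain ⟨rfl, hxy⟩ := List.append_inj' hV rfl
      obtain rfl : x = y := by simpa using hxy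
      exact ⟨c, hins, hrow⟩
    · intro hle S d hd hS hk
      have h₆ := h₅ (by omega) S d hd hS hk
      refine hins.hasKeyColumn h₁ hr' hd (by omega) h₆ hS ?_
      have : (colLengths (insertWord U.reverse T)).getD c 0 = U.length := by omega
      rw [this, List.length_append, List.length_singleton]
      split_ifs <;> omega

/-- Factors are inserted starting from the last one, `D`, which by itself is a tableau with key `D`.
As long as the sum of row indices stays minimal, `insertWord_factor` preserves a key column equal to
`D`. -/
theorem frank_last_column {F : Tableau} {D : List ℕ} (hD : D ≠ [])
    (hs : ∀ C ∈ F ++ [D], C.Pairwise (· > ·)) (hr : IsReducedWord (word (F ++ [D]))) :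
    rowSum (colLengths (F ++ [D])) ≤ rowSum (colLengths (insertWord (word (F ++ [D])) [])) ∧
      (rowSum (colLengths (insertWord (word (F ++ [D])) [])) ≤ rowSum (colLengths (F ++ [D])) →
        HasKeyColumn (insertWord (word (F ++ [D])) []) D.toFinset D.length 1) := by
  induction F with
  | nil =>
    have hDs := hs D (by simp)
    have hdec : IsDecreasing [D] := by
      refine isDecreasing_cons.2 ⟨⟨hD, fun x hx => hr.1 x (by simp [word, hx]), hDs⟩,
        dominates_nil _, isDecreasing_nil⟩
    rw [List.nil_append, hdec.insertWord_word]
    refine ⟨le_rfl, fun _ => ⟨fun k hk => ?_, by simp [colLengths]⟩⟩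
    cases k with
    | zero => rw [keyset_zero, word_cons, word_nil, List.append_nil, starWord_column hDs]
    | succ k =>
      simp only [colLengths, List.map_cons, List.map_nil, List.getD_cons_succ, List.getD_nil] at hk
      exact absurd (List.eq_nil_of_length_eq_zero hk.symm) hD
  | cons C F ih =>
    rw [List.cons_append, word_cons] at hr
    obtain ⟨h₁, h₂⟩ := ih (fun B hB => hs B (by simp_all))
      hr.right
    obtain ⟨h₃, h₄⟩ := hr.right.insertWord
    obtain ⟨h₅, h₆⟩ := insertWord_factor h₃ (hs C (by simp))
      ((h₄.append_left C.reverse).isReducedWord hr)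
    have hsum : rowSum (colLengths (C :: (F ++ [D]))) =
        C.length.choose 2 + rowSum (colLengths (F ++ [D])) := by simp [rowSum, colLengths]
    rw [List.cons_append, word_cons, insertWord_append, hsum]
    refine ⟨by omega, fun h => ?_⟩
    have hDs := hs D (by simp)
    exact h₆ (by omega) _ _ (List.length_pos_of_ne_nil hD)
      (List.toFinset_card_of_nodup (hDs.imp ne_of_gt)) (h₂ (by omega))

/-- The factor lengths of a frank word are the column lengths of `P`, and the word inserts to `P`;
so the bound of `frank_last_column` is attained. -/
theorem IsFrank.toFinset_eq {P F : Tableau} {D : List ℕ} (hP : IsReducedDecreasing P)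
    (h : IsFrank P (F ++ [D])) {k : ℕ} (hk : k < P.length) (hD : D.length = P[k].length) :
    D.toFinset = keyset P k := by
  obtain ⟨h₁, h₂, h₃⟩ := h
  have hne : D ≠ [] := by
    rintro rfl
    have := (hP.1.1 _ (List.getElem_mem hk)).1
    exact this (List.eq_nil_of_length_eq_zero hD.symm)
  obtain ⟨-, h₄⟩ := frank_last_column hne h₁ (h₃.symm.isReducedWord hP.2)
  rw [hP.insertWord_eq h₃] at h₄
  have := (h₂.map (·.choose 2)).sum_eq
  refine ((h₄ (by rw [rowSum, rowSum, this])).1 k ?_).symm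
  rw [List.getD_eq_getElem _ _ (by simpa [colLengths] using hk), hD]
  simp [colLengths]

/-- Leave the first `k` columns in place and move the next one past all later ones. -/
theorem exists_isFrank {P : Tableau} (hP : IsReducedDecreasing P) {k : ℕ} (hk : k < P.length) :
    ∃ F, IsFrank P (F ++ [(keyset P k).sort (· ≥ ·)]) := by
  have hdrop := List.drop_eq_getElem_cons hk
  have hred : ∀ k, IsReducedDecreasing (P.drop k) := by
    intro k
    induction k with
    | zero => exact hP
    | succ k ih =>
      rw [← List.tail_drop]
      cases hd : P.drop k with
      | nil => exact ⟨isDecreasing_nil, isReducedWord_nil⟩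
      | cons C R => exact (hd ▸ ih).tail
  obtain ⟨F, D, h₁, h₂, h₃, h₄, h₅⟩ := exists_rotate (hdrop ▸ hred k)
  have hD : D = (keyset P k).sort (· ≥ ·) := by
    refine sorted_ext (h₃ D (by simp)) (Finset.sortedGT_sort _).pairwise fun z => ?_
    rw [Finset.mem_sort, keyset, hdrop, ← h₅, List.mem_toFinset]
  rw [← hD]
  refine ⟨P.take k ++ F, ?_, ?_, ?_⟩
  · intro C hC
    rw [List.append_assoc, List.mem_append] at hC
    rcases hC with hC | hC
    · exact hP.1.sorted C (List.mem_of_mem_take hC)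
    · exact h₃ C hC
  · have : colLengths P = colLengths (P.take k) ++ colLengths (P.drop k) := by
      rw [← colLengths_append, List.take_append_drop]
    rw [this, List.append_assoc, colLengths_append, hdrop, colLengths_append, h₁]
    refine List.Perm.append_left _ ?_
    simp only [colLengths, List.map_cons, List.map_nil, h₂]
    exact List.perm_append_singleton _ _
  · have : word P = word (P.take k) ++ word (P.drop k) := by
      rw [← word_append, List.take_append_drop]
    rw [this, List.append_assoc, word_append, hdrop]
    exact h₄.append_left _

theorem isRightNilKey_iff {P K : Tableau} (hP : IsReducedDecreasing P) :
    IsRightNilKey P K ↔ K = rightKey P := by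
  have hlen : (rightKey P).length = P.length := by simp [rightKey_eq]
  constructor
  · intro h
    obtain ⟨h₁, h₂⟩ := List.forall₂_iff_get.1 h
    refine List.ext_getElem (by rw [hlen, h₁]) fun k hk hk' => ?_
    obtain ⟨h₃, F, hF⟩ := h₂ k (h₁ ▸ hk) hk
    have h₄ := hF.toFinset_eq hP (h₁ ▸ hk) h₃
    refine sorted_ext (hF.1 _ (by simp)) ?_ fun z => ?_
    · simp only [rightKey_eq, List.getElem_map]
      exact (Finset.sortedGT_sort _).pairwise
    · simp only [rightKey_eq, List.getElem_map, List.getElem_range, Finset.mem_sort, ← h₄]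
      simp
  · rintro rfl
    refine List.forall₂_iff_get.2 ⟨hlen.symm, fun k hk hk' => ?_⟩
    simp only [rightKey_eq, List.get_eq_getElem, List.getElem_map, List.getElem_range,
      Finset.length_sort, card_keyset hP]
    refine ⟨?_, exists_isFrank hP hk⟩
    rw [List.getD_eq_getElem _ _ (by simpa [colLengths] using hk)]
    simp [colLengths]

/-! ## The nilCoxeter algebra and Schubert polynomials -/

open MvPolynomial in
/-- The operators of the nilCoxeter algebra on functions on permutations. -/
noncomputable def nilOp (i : ℕ) : Module.End (MvPolynomial ℕ ℤ) (Equiv.Perm ℕ → MvPolynomial ℕ ℤ) where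
  toFun f w := if w (i + 1) < w i then f (w * Equiv.swap i (i + 1)) else 0
  map_add' f g := by
    ext1 w
    simp only [Pi.add_apply]
    split_ifs <;> simp
  map_smul' c f := by
    ext1 w
    simp only [Pi.smul_apply, RingHom.id_apply]
    split_ifs <;> simp

theorem nilOp_apply (i : ℕ) (f : Equiv.Perm ℕ → MvPolynomial ℕ ℤ) (w : Equiv.Perm ℕ) :
    nilOp i f w = if w (i + 1) < w i then f (w * Equiv.swap i (i + 1)) else 0 := rfl

theorem nilOp_mul_self (i : ℕ) : nilOp i * nilOp i = 0 := by
  ext1 f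
  funext w
  rw [Module.End.mul_apply, nilOp_apply, nilOp_apply]
  simp only [Equiv.Perm.mul_apply, Equiv.swap_apply_left, Equiv.swap_apply_right,
    LinearMap.zero_apply, Pi.zero_apply]
  split_ifs <;> first | omega | rfl

theorem nilOp_commute {i j : ℕ} (h : i + 1 < j) : Commute (nilOp i) (nilOp j) := by
  have hs := swap_comm_of_lt h
  ext1 f
  funext w
  have e₁ : Equiv.swap i (i + 1) j = j := Equiv.swap_apply_of_ne_of_ne (by omega) (by omega)
  have e₂ : Equiv.swap i (i + 1) (j + 1) = j + 1 :=
    Equiv.swap_apply_of_ne_of_ne (by omega) (by omega)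
  have e₃ : Equiv.swap j (j + 1) i = i := Equiv.swap_apply_of_ne_of_ne (by omega) (by omega)
  have e₄ : Equiv.swap j (j + 1) (i + 1) = i + 1 :=
    Equiv.swap_apply_of_ne_of_ne (by omega) (by omega)
  simp only [Module.End.mul_apply, nilOp_apply, Equiv.Perm.mul_apply, e₁, e₂, e₃, e₄, mul_assoc, hs]
  split_ifs <;> rfl

theorem nilOp_braid (i : ℕ) :
    nilOp i * nilOp (i + 1) * nilOp i = nilOp (i + 1) * nilOp i * nilOp (i + 1) := by
  have hs := swap_braid i
  ext1 f
  funext w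
  have h₀ : Equiv.swap i (i + 1) (i + 1 + 1) = i + 1 + 1 :=
    Equiv.swap_apply_of_ne_of_ne (by omega) (by omega)
  have h₁ : Equiv.swap (i + 1) (i + 1 + 1) i = i :=
    Equiv.swap_apply_of_ne_of_ne (by omega) (by omega)
  simp only [Module.End.mul_apply, nilOp_apply, Equiv.Perm.mul_apply, Equiv.swap_apply_left,
    Equiv.swap_apply_right, h₀, h₁, mul_assoc] at hs ⊢
  rw [hs]
  split_ifs <;> first | omega | rfl

/-- The element `1 + x u_i`. -/
noncomputable def nilExp (i : ℕ) (x : MvPolynomial ℕ ℤ) :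
    Module.End (MvPolynomial ℕ ℤ) (Equiv.Perm ℕ → MvPolynomial ℕ ℤ) := 1 + x • nilOp i

/-- The product `(1 + x u_k) (1 + x u_{k+1}) ⋯` of `m` factors. -/
noncomputable def nilBlock : ℕ → ℕ → MvPolynomial ℕ ℤ →
    Module.End (MvPolynomial ℕ ℤ) (Equiv.Perm ℕ → MvPolynomial ℕ ℤ)
  | 0, _, _ => 1
  | m + 1, k, x => nilExp k x * nilBlock m (k + 1) x

theorem nilOp_commute_nilBlock {i k : ℕ} (h : i + 1 < k) (m : ℕ) (x : MvPolynomial ℕ ℤ) :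
    Commute (nilOp i) (nilBlock m k x) := by
  induction m generalizing k with
  | zero => exact Commute.one_right _
  | succ m ih =>
    exact ((Commute.one_right _).add_right ((nilOp_commute h).smul_right x)).mul_right
      (ih (by omega))

theorem nilExp_mul_nilExp (i : ℕ) (x y : MvPolynomial ℕ ℤ) :
    nilExp i x * nilExp i y = nilExp i (x + y) := by
  simp only [nilExp, add_mul, mul_add, one_mul, mul_one, smul_mul_assoc, mul_smul_comm,
    nilOp_mul_self, smul_zero, add_zero, add_smul]
  abel

theorem nilExp_zero (i : ℕ) : nilExp i 0 = 1 := by simp [nilExp]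

/-- The cubic terms cancel by the braid relation. What matters is that the result is symmetric in
`x` and `y`. -/
theorem nilExp_conj (i : ℕ) (x y : MvPolynomial ℕ ℤ) :
    nilExp i x * nilExp (i + 1) x * nilExp i y * nilExp (i + 1) (-x) =
      1 + (x + y) • nilOp i + (x * y) • (nilOp (i + 1) * nilOp i - nilOp i * nilOp (i + 1)) := by
  have h₁ := nilOp_mul_self i
  have h₂ := nilOp_mul_self (i + 1)
  have h₃ := nilOp_braid i
  simp only [nilExp, add_mul, mul_add, one_mul, mul_one, smul_mul_assoc, mul_smul_comm,
    h₁, smul_zero, zero_mul, h₂, h₃]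
  simp only [mul_assoc, h₂, smul_zero, mul_zero]
  module

/-- The product splits into the element of `nilExp_conj`, symmetric in `x` and `y`, and a product of
two shorter blocks, which commute by induction. -/
theorem nilBlock_commute (m k : ℕ) (x y : MvPolynomial ℕ ℤ) :
    nilBlock m k x * nilBlock m k y = nilBlock m k y * nilBlock m k x := by
  induction m generalizing k with
  | zero => rfl
  | succ m ih =>
    cases m with
    | zero => simp only [nilBlock, mul_one, nilExp_mul_nilExp, add_comm]
    | succ m =>
      have key : ∀ x y, nilBlock (m + 1 + 1) k x * nilBlock (m + 1 + 1) k y =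
          (nilExp k x * nilExp (k + 1) x * nilExp k y * nilExp (k + 1) (-x)) *
            (nilBlock (m + 1) (k + 1) x * nilBlock (m + 1) (k + 1) y) := by
        intro x y
        have hc : nilBlock m (k + 1 + 1) x * nilExp k y = nilExp k y * nilBlock m (k + 1 + 1) x := by
          have := nilOp_commute_nilBlock (i := k) (k := k + 1 + 1) (by omega) m x
          exact (((Commute.one_left _).add_left (this.smul_left y)).eq).symm
        have hD : nilBlock m (k + 1 + 1) x =
            nilExp (k + 1) (-x) * nilBlock (m + 1) (k + 1) x := by
          rw [nilBlock, ← mul_assoc, nilExp_mul_nilExp, neg_add_cancel, nilExp_zero, one_mul]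
        calc nilBlock (m + 1 + 1) k x * nilBlock (m + 1 + 1) k y
            = nilExp k x * nilExp (k + 1) x * (nilBlock m (k + 1 + 1) x * nilExp k y) *
              nilBlock (m + 1) (k + 1) y := by
              simp only [nilBlock, mul_assoc]
          _ = nilExp k x * nilExp (k + 1) x * (nilExp k y *
              (nilExp (k + 1) (-x) * nilBlock (m + 1) (k + 1) x)) *
              nilBlock (m + 1) (k + 1) y := by rw [hc, hD]
          _ = _ := by simp only [mul_assoc]
      rw [key, key, nilExp_conj, nilExp_conj, ih (k + 1), add_comm x y, mul_comm x y]

/-- The shorter block is the longer one stripped of its first factor, so both products are a `nilExp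
k` times the same commuting pair of longer blocks, and their difference is a multiple of `u_k`. -/
theorem nilBlock_exchange (m k : ℕ) (x y : MvPolynomial ℕ ℤ) :
    nilBlock m (k + 1) y * nilBlock (m + 1) k x - nilBlock m (k + 1) x * nilBlock (m + 1) k y =
      (x - y) • (nilOp k * (nilBlock m (k + 1) y * nilBlock (m + 1) k x)) := by
  have hD : ∀ x, nilBlock m (k + 1) x = nilExp k (-x) * nilBlock (m + 1) k x := fun x => by
    rw [nilBlock, ← mul_assoc, nilExp_mul_nilExp, neg_add_cancel, nilExp_zero, one_mul]
  have hu : nilOp k * nilExp k (-y) = nilOp k := by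
    simp [nilExp, mul_add, nilOp_mul_self]
  rw [hD y, hD x, mul_assoc, mul_assoc, nilBlock_commute (m + 1) k x y, ← sub_mul,
    ← mul_assoc (nilOp k), hu, ← smul_mul_assoc]
  congr 1
  simp only [nilExp]
  module

open scoped Classical in
/-- The generating function of factorizations with letters less than `n` into `k` factors, in the
variables `ξ 1, …, ξ k`. -/
noncomputable def nilSchubert (n : ℕ) (ξ : ℕ → MvPolynomial ℕ ℤ) :
    ℕ → Equiv.Perm ℕ → MvPolynomial ℕ ℤ
  | 0 => Pi.single 1 1
  | k + 1 => nilBlock (n - (k + 1)) (k + 1) (ξ (k + 1)) (nilSchubert n ξ k)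

/-! ### The divided difference recursion for products of blocks -/

theorem nilSchubert_congr {n : ℕ} {ξ η : ℕ → MvPolynomial ℕ ℤ} {k : ℕ}
    (h : ∀ j, 1 ≤ j → j ≤ k → ξ j = η j) : nilSchubert n ξ k = nilSchubert n η k := by
  induction k with
  | zero => rfl
  | succ k ih =>
    rw [nilSchubert, nilSchubert, h (k + 1) (by omega) le_rfl, ih fun j h₁ h₂ => h j h₁ (by omega)]

theorem map_nilBlock (σ : MvPolynomial ℕ ℤ →+* MvPolynomial ℕ ℤ) (m k : ℕ) (x : MvPolynomial ℕ ℤ)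
    (f : Equiv.Perm ℕ → MvPolynomial ℕ ℤ) (w : Equiv.Perm ℕ) :
    σ (nilBlock m k x f w) = nilBlock m k (σ x) (fun w => σ (f w)) w := by
  induction m generalizing k w with
  | zero => rfl
  | succ m ih =>
    simp only [nilBlock, nilExp, Module.End.mul_apply, LinearMap.add_apply, Module.End.one_apply,
      LinearMap.smul_apply, Pi.add_apply, Pi.smul_apply, nilOp_apply, smul_eq_mul, map_add, map_mul,
      ih, apply_ite σ, map_zero]

theorem map_nilSchubert (σ : MvPolynomial ℕ ℤ →+* MvPolynomial ℕ ℤ) (n : ℕ)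
    (ξ : ℕ → MvPolynomial ℕ ℤ) (k : ℕ) (w : Equiv.Perm ℕ) :
    σ (nilSchubert n ξ k w) = nilSchubert n (fun j => σ (ξ j)) k w := by
  induction k generalizing w with
  | zero =>
    simp only [nilSchubert, Pi.single_apply]
    split_ifs <;> simp
  | succ k ih =>
    rw [nilSchubert, map_nilBlock, nilSchubert]
    simp only [ih]

/-- Blocks beyond `i + 1` commute with `u_i`, and those before `i` are the same for `ξ` and `η`.
This leaves the blocks `i` and `i + 1`, where the identity is `nilBlock_exchange`. -/
theorem nilSchubert_sub {n i k : ℕ} (hi : 1 ≤ i) (hn : i < n) (hk : i + 1 ≤ k)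
    {ξ η : ℕ → MvPolynomial ℕ ℤ} (h₁ : η i = ξ (i + 1)) (h₂ : η (i + 1) = ξ i)
    (h₃ : ∀ j, j ≠ i → j ≠ i + 1 → η j = ξ j) :
    nilSchubert n ξ k - nilSchubert n η k =
      (ξ i - ξ (i + 1)) • nilOp i (nilSchubert n ξ k) := by
  induction k, hk using Nat.le_induction with
  | base =>
    obtain ⟨i, rfl⟩ : ∃ j, i = j + 1 := ⟨i - 1, by omega⟩
    have hm : n - (i + 1) = n - (i + 1 + 1) + 1 := by omega
    have hη : nilSchubert n η i = nilSchubert n ξ i :=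
      nilSchubert_congr fun j _ hj => h₃ j (by omega) (by omega)
    simp only [nilSchubert, h₁, h₂, hη, ← Module.End.mul_apply, hm]
    rw [← LinearMap.sub_apply, nilBlock_exchange]
    rfl
  | succ k hk ih =>
    have hc := (nilOp_commute_nilBlock (i := i) (k := k + 1) (by omega) (n - (k + 1))
      (ξ (k + 1))).eq
    rw [nilSchubert, nilSchubert, h₃ (k + 1) (by omega) (by omega), ← map_sub, ih, map_smul,
      ← Module.End.mul_apply, ← hc, Module.End.mul_apply]

open MvPolynomial in
theorem divDiff_eq {i : ℕ} {f g : MvPolynomial ℕ ℤ}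
    (h : f - rename (Equiv.swap i (i + 1)) f = (X i - X (i + 1)) * g) : divDiff i f = g := by
  have h' := Classical.choose_spec (dvd_sub_rename_swap i (i + 1) f)
  refine mul_left_cancel₀ ?_ (h'.symm.trans h)
  rw [sub_ne_zero]
  intro he
  have := X_injective he
  omega

open MvPolynomial in
-- For exchanged variables, `nilSchubert_sub` says that `∂_i` acts as `u_i`. At `w s_i`, which has a
-- descent at `i`, the operator `u_i` reads off the value at `w`.
theorem divDiff_nilSchubert {n i : ℕ} (hi : 1 ≤ i) (hn : i < n) {w : Equiv.Perm ℕ}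
    (hw : w i < w (i + 1)) :
    divDiff i (nilSchubert n X n (w * Equiv.swap i (i + 1))) = nilSchubert n X n w := by
  refine divDiff_eq ?_
  have h := congrFun (nilSchubert_sub hi hn hn (ξ := X)
    (η := fun j => rename (Equiv.swap i (i + 1)) (X j)) (by simp) (by simp)
    (fun j h₁ h₂ => by simp [Equiv.swap_apply_of_ne_of_ne h₁ h₂]))
    (w * Equiv.swap i (i + 1))
  have h' := map_nilSchubert (rename (Equiv.swap i (i + 1))).toRingHom n X n
    (w * Equiv.swap i (i + 1))
  simp only [AlgHom.toRingHom_eq_coe, RingHom.coe_coe] at h'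
  rw [Pi.sub_apply, ← h', Pi.smul_apply, nilOp_apply, if_pos (by simpa using hw), mul_assoc,
    Equiv.swap_mul_self, mul_one, smul_eq_mul] at h
  exact h

/-! ## Schubert polynomials and bounded factorizations -/

/-- The letters `k + m - 1, …, k`, with index `j`. -/
def letterRow : ℕ → ℕ → ℕ → List (ℕ × ℕ)
  | 0, _, _ => []
  | m + 1, k, j => letterRow m (k + 1) j ++ [(k, j)]

/-- All pairs of an index `j` with `1 ≤ j ≤ k` and a letter `a` with `j ≤ a < n`. -/
def letterRows (n : ℕ) : ℕ → List (ℕ × ℕ)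
  | 0 => []
  | k + 1 => letterRows n k ++ letterRow (n - (k + 1)) (k + 1) (k + 1)

theorem mem_letterRow {m k j : ℕ} {p : ℕ × ℕ} :
    p ∈ letterRow m k j ↔ p.2 = j ∧ k ≤ p.1 ∧ p.1 < k + m := by
  induction m generalizing k with
  | zero => simp [letterRow]
  | succ m ih =>
    obtain ⟨a, b⟩ := p
    simp only [letterRow, List.mem_append, ih, List.mem_singleton, Prod.mk.injEq]
    omega

theorem mem_letterRows {n k : ℕ} {p : ℕ × ℕ} :
    p ∈ letterRows n k ↔ 1 ≤ p.2 ∧ p.2 ≤ k ∧ p.2 ≤ p.1 ∧ p.1 < n := by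
  induction k with
  | zero => simp [letterRows]; omega
  | succ k ih =>
    rw [letterRows, List.mem_append, ih, mem_letterRow]
    omega

theorem pairwise_letterRow (m k j : ℕ) : (letterRow m k j).Pairwise PairLT := by
  induction m generalizing k with
  | zero => simp [letterRow]
  | succ m ih =>
    refine List.pairwise_append.2 ⟨ih (k + 1), by simp, ?_⟩
    rintro p hp q hq
    rw [mem_letterRow] at hp
    obtain rfl := List.mem_singleton.1 hq
    exact Or.inr ⟨hp.1, hp.2.1⟩

theorem pairwise_letterRows (n k : ℕ) : (letterRows n k).Pairwise PairLT := by
  induction k with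
  | zero => simp [letterRows]
  | succ k ih =>
    refine List.pairwise_append.2 ⟨ih, pairwise_letterRow _ _ _, ?_⟩
    rintro p hp q hq
    rw [mem_letterRow] at hq
    rw [mem_letterRows] at hp
    exact Or.inl (by omega)

theorem nodup_of_pairLT {l : List (ℕ × ℕ)} (h : l.Pairwise PairLT) : l.Nodup :=
  h.imp fun {p q} hpq he => by
    subst he
    rcases hpq with h | h <;> omega

theorem sublist_of_pairLT {l L : List (ℕ × ℕ)} (hl : l.Pairwise PairLT) (hL : L.Pairwise PairLT)
    (h : l ⊆ L) : l.Sublist L := by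
  have : Std.Antisymm PairLT := ⟨fun p q h₁ h₂ => by
    rcases h₁ with h₁ | h₁ <;> rcases h₂ with h₂ | h₂ <;> omega⟩
  exact List.sublist_of_subperm_of_pairwise (List.subperm_of_subset (nodup_of_pairLT hl) h) hl hL

open scoped Classical in
/-- The contribution of a factorization to the generating function of the reduced words of `w`. -/
noncomputable def factTerm (ξ : ℕ → MvPolynomial ℕ ℤ) (w : Equiv.Perm ℕ) (l : List (ℕ × ℕ)) :
    MvPolynomial ℕ ℤ :=
  if IsReducedWord (l.map Prod.fst) ∧ wordPerm (l.map Prod.fst) = w then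
    (l.map fun p => ξ p.2).prod else 0

theorem factTerm_concat (ξ : ℕ → MvPolynomial ℕ ℤ) (w : Equiv.Perm ℕ) (l : List (ℕ × ℕ)) {j k : ℕ}
    (hj : 0 < j) : factTerm ξ w (l ++ [(j, k)]) =
      if w (j + 1) < w j then ξ k * factTerm ξ (w * Equiv.swap j (j + 1)) l else 0 := by
  have h₁ : wordPerm ((l ++ [(j, k)]).map Prod.fst) = w ↔
      wordPerm (l.map Prod.fst) = w * Equiv.swap j (j + 1) := by
    rw [List.map_append, wordPerm_append, List.map_singleton, wordPerm_singleton]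
    constructor
    · rintro rfl
      rw [mul_assoc, Equiv.swap_mul_self, mul_one]
    · intro h
      rw [h, mul_assoc, Equiv.swap_mul_self, mul_one]
  unfold factTerm
  rw [h₁]
  by_cases h : wordPerm (l.map Prod.fst) = w * Equiv.swap j (j + 1)
  · have h₂ : IsReducedWord ((l ++ [(j, k)]).map Prod.fst) ↔
        IsReducedWord (l.map Prod.fst) ∧ w (j + 1) < w j := by
      rw [List.map_append, List.map_singleton, isReducedWord_concat, h]
      simp [hj]
    by_cases h₃ : w (j + 1) < w j
    · by_cases h₄ : IsReducedWord (l.map Prod.fst)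
      · rw [if_pos ⟨h₂.2 ⟨h₄, h₃⟩, h⟩, if_pos h₃, if_pos ⟨h₄, h⟩]
        simp [mul_comm]
      · rw [if_neg fun h' => h₄ (h₂.1 h'.1).1, if_pos h₃, if_neg fun h' => h₄ h'.1, mul_zero]
    · rw [if_neg fun h' => h₃ (h₂.1 h'.1).2, if_neg h₃]
  · simp [h]

/-- A sublist omits the last pair or uses it, matching the two terms of `1 + ξ_k u_j`; the descent
condition in `nilOp` is the reducedness of the longer word. -/
theorem sum_factTerm_concat (ξ : ℕ → MvPolynomial ℕ ℤ) (L : List (ℕ × ℕ)) {j k : ℕ} (hj : 0 < j) :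
    (fun w => ((L ++ [(j, k)]).sublists.map (factTerm ξ w)).sum) =
      nilExp j (ξ k) fun w => (L.sublists.map (factTerm ξ w)).sum := by
  funext w
  rw [List.sublists_concat, List.map_append, List.sum_append, List.map_map, nilExp,
    LinearMap.add_apply, Pi.add_apply, LinearMap.smul_apply, Pi.smul_apply, nilOp_apply,
    Module.End.one_apply]
  congr 1
  simp only [Function.comp_def, factTerm_concat _ _ _ hj]
  split_ifs
  · rw [smul_eq_mul, List.sum_map_mul_left]
  · simp

theorem nilBlock_sum_factTerm (ξ : ℕ → MvPolynomial ℕ ℤ) (L : List (ℕ × ℕ)) (m : ℕ) {k j : ℕ}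
    (hk : 0 < k) :
    nilBlock m k (ξ j) (fun w => (L.sublists.map (factTerm ξ w)).sum) =
      fun w => ((L ++ letterRow m k j).sublists.map (factTerm ξ w)).sum := by
  induction m generalizing k with
  | zero => simp [nilBlock, letterRow]
  | succ m ih =>
    rw [nilBlock, Module.End.mul_apply, ih (by omega), ← sum_factTerm_concat _ _ hk, letterRow,
      List.append_assoc]

theorem nilSchubert_eq_sum (n : ℕ) (ξ : ℕ → MvPolynomial ℕ ℤ) (k : ℕ) :
    nilSchubert n ξ k = fun w => ((letterRows n k).sublists.map (factTerm ξ w)).sum := by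
  induction k with
  | zero =>
    classical
    funext w
    rw [nilSchubert, letterRows, List.sublists_nil, List.map_singleton, List.sum_singleton, factTerm,
      Pi.single_apply]
    refine if_congr ⟨fun h => ⟨isReducedWord_nil, h.symm⟩, fun h => h.2.symm⟩ rfl rfl
  | succ k ih => rw [nilSchubert, ih, nilBlock_sum_factTerm _ _ _ (by omega), letterRows]

open scoped Classical in
/-- The bounded factorizations of `w` with letters less than `n`. -/
noncomputable def boundedFact (n : ℕ) (w : Equiv.Perm ℕ) : Finset (List (ℕ × ℕ)) :=
  (letterRows n n).sublists.toFinset.filter fun l =>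
    IsReducedWord (l.map Prod.fst) ∧ wordPerm (l.map Prod.fst) = w

/-- `letterRows n n` lists all admissible pairs in the order `PairLT`, so its sublists are the
sorted sets of admissible pairs. -/
theorem mem_boundedFact {n : ℕ} {w : Equiv.Perm ℕ} {l : List (ℕ × ℕ)} :
    l ∈ boundedFact n w ↔ IsFactorization l ∧ (∀ q ∈ l, q.2 ≤ q.1) ∧ (∀ q ∈ l, q.1 < n) ∧
      wordPerm (l.map Prod.fst) = w := by
  classical
  rw [boundedFact, Finset.mem_filter, List.mem_toFinset, List.mem_sublists]
  constructor
  · rintro ⟨h₁, h₂, h₃⟩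
    have h₄ : ∀ q ∈ l, _ := fun q hq => mem_letterRows.1 (h₁.subset hq)
    exact ⟨⟨(pairwise_letterRows n n).sublist h₁, fun q hq => (h₄ q hq).1, h₂⟩,
      fun q hq => (h₄ q hq).2.2.1, fun q hq => (h₄ q hq).2.2.2, h₃⟩
  · rintro ⟨h₁, h₂, h₃, h₄⟩
    refine ⟨sublist_of_pairLT h₁.pairwise (pairwise_letterRows n n) fun q hq => ?_, h₁.reduced, h₄⟩
    have e₁ := h₁.pos q hq
    have e₂ := h₂ q hq
    have e₃ := h₃ q hq
    exact mem_letterRows.2 (by omega)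

open MvPolynomial in
theorem nilSchubert_eq_sum_boundedFact (n : ℕ) (w : Equiv.Perm ℕ) :
    nilSchubert n X n w = ∑ l ∈ boundedFact n w, (l.map fun p => (X p.2 : MvPolynomial ℕ ℤ)).prod := by
  classical
  rw [nilSchubert_eq_sum, boundedFact, Finset.sum_filter]
  beta_reduce
  rw [← List.sum_toFinset _ (List.nodup_sublists.2 (nodup_of_pairLT (pairwise_letterRows n n)))]
  refine Finset.sum_congr rfl fun l _ => ?_
  simp only [factTerm]

/-! ### Letters of reduced words -/

theorem wordPerm_le_of_notMem {u : List ℕ} {j a : ℕ} (h : j ∉ u) :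
    wordPerm u a ≤ j ↔ a ≤ j := by
  induction u using List.reverseRecOn generalizing a with
  | nil => simp [wordPerm_nil]
  | append_singleton u i ih =>
    have h₁ : j ∉ u := fun hj => h (by simp [hj])
    have h₂ : i ≠ j := fun hj => h (by simp [hj])
    rw [wordPerm_append, wordPerm_singleton, Equiv.Perm.mul_apply, ih h₁]
    rw [Equiv.swap_apply_def]
    split_ifs <;> omega

/-- The first `s_j` moves some `a ≤ j` above `j`, and letters appended at ascents never undo this: a
further `s_j` can only bring in a larger value. This bounds the letters of the reduced words of an
element of `S_n`. -/
theorem IsReducedWord.exists_lt {u : List ℕ} (hu : IsReducedWord u) {j : ℕ} (hj : j ∈ u) :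
    ∃ a ≤ j, j < wordPerm u a := by
  induction u using List.reverseRecOn with
  | nil => simp at hj
  | append_singleton u i ih =>
    obtain ⟨h₁, h₂, h₃⟩ := isReducedWord_concat.1 hu
    rw [wordPerm_append, wordPerm_singleton]
    by_cases hju : j ∈ u
    · obtain ⟨a, ha, hja⟩ := ih h₁ hju
      by_cases hij : i = j
      · subst hij
        rcases ha.eq_or_lt with rfl | ha
        · refine ⟨a, le_rfl, ?_⟩
          rw [Equiv.Perm.mul_apply, Equiv.swap_apply_left]
          omega
        · refine ⟨a, ha.le, ?_⟩
          rwa [Equiv.Perm.mul_apply, Equiv.swap_apply_of_ne_of_ne (by omega) (by omega)]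
      · refine ⟨Equiv.swap i (i + 1) a, ?_, ?_⟩
        · rw [Equiv.swap_apply_def]
          split_ifs <;> omega
        · rwa [Equiv.Perm.mul_apply, Equiv.swap_apply_self]
    · obtain rfl : j = i := by simpa [hju] using hj
      refine ⟨j, le_rfl, ?_⟩
      rw [Equiv.Perm.mul_apply, Equiv.swap_apply_left]
      by_contra hc
      have := (wordPerm_le_of_notMem hju).1 (not_lt.1 hc)
      omega

theorem IsReducedWord.lt_of_inSym {u : List ℕ} (hu : IsReducedWord u) {n : ℕ}
    (hw : InSym n (wordPerm u)) : ∀ j ∈ u, j < n := by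
  intro j hj
  by_contra hn
  obtain ⟨a, ha, hlt⟩ := hu.exists_lt hj
  have h₁ := hw (wordPerm u a) (Or.inr (by omega))
  have h₂ := (wordPerm u).injective h₁
  omega

theorem IsReducedWord.length_eq {u v : List ℕ} (hu : IsReducedWord u) (hv : IsReducedWord v)
    (h : wordPerm u = wordPerm v) : u.length = v.length :=
  le_antisymm (hu.2 v hv.1 h.symm) (hv.2 u hu.1 h)

/-! ### The long element -/

/-- `u` is a reduced word for the permutation of `1, …, m` with one-line notation
`m, …, m - k + 1, 1, …, j - 1 - k, m - k, j - k, …, m - k - 1`. -/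
def IsPartialLongWord (m k j : ℕ) (u : List ℕ) : Prop :=
  IsReducedWord u ∧ ∀ i, wordPerm u i =
    if i = 0 ∨ m < i then i else if i ≤ k then m + 1 - i else if i < j then i - k
      else if i = j then m - k else i - k - 1

/-- Each appended letter moves the value `m - k` one place to the left past a smaller value, so the
word stays reduced. -/
theorem IsPartialLongWord.letterRow {m k i : ℕ} {u : List ℕ} (hu : IsPartialLongWord m k m u)
    (t : ℕ) (ht : k + 1 + t ≤ m) :
    IsPartialLongWord m k (m - t) (u ++ (letterRow t (m - t) i).map Prod.fst) := by
  induction t with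
  | zero => simpa [NilKey.letterRow] using hu
  | succ t ih =>
    have h := ih (by omega)
    have he : m - (t + 1) + 1 = m - t := by omega
    rw [NilKey.letterRow, List.map_append, List.map_singleton, ← List.append_assoc, he]
    refine ⟨isReducedWord_concat.2 ⟨h.1, by omega, ?_⟩, fun a => ?_⟩
    · rw [h.2, h.2, he]
      split_ifs <;> omega
    · rw [wordPerm_append _ [_], wordPerm_singleton, Equiv.Perm.mul_apply, he, h.2,
        Equiv.swap_apply_def]
      split_ifs <;> omega

theorem isPartialLongWord_letterRows (m k : ℕ) (hk : k ≤ m) :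
    IsPartialLongWord m k m ((letterRows m k).map Prod.fst) := by
  induction k with
  | zero =>
    refine ⟨isReducedWord_nil, fun i => ?_⟩
    rw [letterRows, List.map_nil, wordPerm_nil, Equiv.Perm.one_apply]
    split_ifs <;> omega
  | succ k ih =>
    have h := (ih (by omega)).letterRow (i := k + 1) (m - (k + 1)) (by omega)
    rw [show m - (m - (k + 1)) = k + 1 by omega, ← List.map_append, ← letterRows] at h
    refine ⟨h.1, fun i => ?_⟩
    rw [h.2]
    split_ifs <;> omega

theorem letterRows_longPerm (m : ℕ) : IsReducedWord ((letterRows m m).map Prod.fst) ∧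
    wordPerm ((letterRows m m).map Prod.fst) = longPerm m := by
  obtain ⟨h₁, h₂⟩ := isPartialLongWord_letterRows m m le_rfl
  refine ⟨h₁, ?_⟩
  ext i
  rw [h₂]
  change _ = if 1 ≤ i ∧ i ≤ m then m + 1 - i else i
  split_ifs <;> omega

theorem inSym_longPerm (m : ℕ) : InSym m (longPerm m) := by
  intro i hi
  change (if 1 ≤ i ∧ i ≤ m then m + 1 - i else i) = i
  rw [if_neg (by omega)]

/-- Boundedness confines a factorization to a sublist of `letterRows m m`, and since all reduced
words of a permutation have the same length, it is the whole list. -/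
theorem boundedFact_longPerm {m n : ℕ} (h : m ≤ n) :
    boundedFact n (longPerm m) = {letterRows m m} := by
  obtain ⟨h₁, h₂⟩ := letterRows_longPerm m
  ext l
  rw [mem_boundedFact, Finset.mem_singleton]
  constructor
  · rintro ⟨k₁, k₂, k₃, k₄⟩
    have k₅ := k₁.reduced.lt_of_inSym (n := m) (by rw [k₄]; exact inSym_longPerm m)
    have hsub : l.Sublist (letterRows m m) := by
      refine sublist_of_pairLT k₁.pairwise (pairwise_letterRows m m) fun q hq => ?_
      have e₁ := k₁.pos q hq
      have e₂ := k₂ q hq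
      have e₃ := k₅ q.1 (List.mem_map_of_mem hq)
      exact mem_letterRows.2 (by omega)
    refine hsub.eq_of_length ?_
    have := k₁.reduced.length_eq h₁ (k₄.trans h₂.symm)
    simpa using this
  · rintro rfl
    refine ⟨⟨pairwise_letterRows m m, fun q hq => (mem_letterRows.1 hq).1, h₁⟩,
      fun q hq => (mem_letterRows.1 hq).2.2.1, fun q hq => ?_, h₂⟩
    have := mem_letterRows.1 hq
    omega

open MvPolynomial in
theorem prod_letterRows (n k : ℕ) :
    ((letterRows n k).map fun p => (X p.2 : MvPolynomial ℕ ℤ)).prod =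
      ∏ i ∈ Finset.Icc 1 k, X i ^ (n - i) := by
  have hrow : ∀ m k j, ((letterRow m k j).map fun p => (X p.2 : MvPolynomial ℕ ℤ)).prod =
      X j ^ m := by
    intro m k j
    induction m generalizing k with
    | zero => simp [letterRow]
    | succ m ih => simp [letterRow, ih, pow_succ]
  induction k with
  | zero => simp [letterRows]
  | succ k ih =>
    rw [letterRows, List.map_append, List.prod_append, ih, hrow, Finset.prod_Icc_succ_top (by omega)]

open MvPolynomial in
-- A step of the recursion needs only `i < n`, so the identity is carried along for all large `n`.
-- In particular the polynomial does not depend on the chain of divided differences.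
theorem IsSchubert.exists_eq {w : Equiv.Perm ℕ} {f : MvPolynomial ℕ ℤ} (h : IsSchubert w f) :
    ∃ N, ∀ n ≥ N, f = nilSchubert n X n w := by
  induction h with
  | long m =>
    refine ⟨m, fun n hn => ?_⟩
    rw [nilSchubert_eq_sum_boundedFact, boundedFact_longPerm hn, Finset.sum_singleton,
      prod_letterRows]
  | step w i f hi hw _ ih =>
    obtain ⟨N, hN⟩ := ih
    refine ⟨max N (i + 1), fun n hn => ?_⟩
    rw [hN n (le_trans (le_max_left _ _) hn)]
    exact divDiff_nilSchubert hi (le_trans (le_max_right _ _) hn) hw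

open MvPolynomial in
theorem exists_schubert_eq (w : Equiv.Perm ℕ) (hw : InSymPlus w) :
    ∃ n, InSym n w ∧ schubert w hw =
      ∑ l ∈ boundedFact n w, (l.map fun p => (X p.2 : MvPolynomial ℕ ℤ)).prod := by
  obtain ⟨N, hN⟩ := (exists_isSchubert w hw).choose_spec.exists_eq
  have hw' := hw
  obtain ⟨n, hn⟩ := hw'
  refine ⟨max N n, fun i hi => hn i (by omega), ?_⟩
  rw [← nilSchubert_eq_sum_boundedFact]
  exact hN _ (le_max_left _ _)

/-- The words have a fixed length and letters below `n`, and a decreasing tableau is recovered from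
its word by insertion. -/
theorem finite_reducedTableaux {w : Equiv.Perm ℕ} (hw : InSymPlus w) :
    (reducedTableaux w).Finite := by
  obtain ⟨n, hn⟩ := hw
  rcases (reducedTableaux w).eq_empty_or_nonempty with h | ⟨P₀, hP₀⟩
  · rw [h]
    exact Set.finite_empty
  refine Set.Finite.of_finite_image (f := word) ?_ ?_
  · refine ((List.finite_length_eq (Fin n) (word P₀).length).image (List.map Fin.val)).subset ?_
    rintro _ ⟨P, hP, rfl⟩
    have h₁ := hP.1.2.lt_of_inSym (n := n) (by rw [hP.2]; exact hn)
    have h₂ := hP.1.2.length_eq hP₀.1.2 (hP.2.trans hP₀.2.symm)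
    refine ⟨(word P).attach.map fun x => ⟨x.1, h₁ x.1 x.2⟩, by simpa using h₂, ?_⟩
    simp [List.map_map, Function.comp_def]
  · intro P hP P' hP' h
    rw [← hP.1.1.insertWord_word, ← hP'.1.1.insertWord_word, h]

/-! ## Strings of sequences of columns -/

/-- The counting functions of the left key, for columns given as sets. -/
def setCount : List (Finset ℕ) → ℕ → ℕ → ℕ
  | [], _ => fun _ => 0
  | C :: _, 0 => countLT C
  | C :: b, k + 1 => pickCount (C.sort (· ≥ ·)) (setCount b k)

theorem pickCount_zero (C : List ℕ) (f : ℕ → ℕ) : pickCount C f 0 = 0 := rfl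

theorem pickCount_succ (C : List ℕ) (f : ℕ → ℕ) (v : ℕ) :
    pickCount C f (v + 1) = min (pickCount C f v + if v ∈ C then 1 else 0) (f (v + 1)) := rfl

theorem leftCount_map_sort (b : List (Finset ℕ)) (k : ℕ) :
    leftCount (b.map fun C => C.sort (· ≥ ·)) k = setCount b k := by
  induction b generalizing k with
  | nil => rfl
  | cons C b ih =>
    cases k with
    | zero =>
      funext v
      rw [List.map_cons, leftCount_cons_zero, Finset.sort_toFinset]
      rfl
    | succ k => rw [List.map_cons, leftCount, ih, setCount]

/-- Counting functions start at `0` and increase by steps of at most `1`. -/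
structure IsCounting (f : ℕ → ℕ) : Prop where
  zero : f 0 = 0
  mono : ∀ v, f v ≤ f (v + 1)
  step : ∀ v, f (v + 1) ≤ f v + 1

theorem isCounting_countLT (S : Finset ℕ) : IsCounting (countLT S) := by
  refine ⟨countLT_zero S, fun v => countLT_mono S (by omega), fun v => ?_⟩
  rw [countLT_succ]
  split_ifs <;> omega

theorem pickCount_le {C : List ℕ} {f : ℕ → ℕ} (v : ℕ) : pickCount C f v ≤ f v := by
  cases v with
  | zero => simp [pickCount_zero]
  | succ v => exact min_le_right _ _

theorem IsCounting.pickCount {f : ℕ → ℕ} (hf : IsCounting f) (C : List ℕ) :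
    IsCounting (pickCount C f) := by
  refine ⟨rfl, fun v => ?_, fun v => ?_⟩ <;> rw [pickCount_succ]
  · have := pickCount_le (C := C) (f := f) v
    have := hf.mono v
    split_ifs <;> omega
  · split_ifs <;> omega

theorem isCounting_setCount (b : List (Finset ℕ)) (k : ℕ) : IsCounting (setCount b k) := by
  induction b generalizing k with
  | nil => exact ⟨rfl, fun _ => le_rfl, fun _ => by simp [setCount]⟩
  | cons C b ih =>
    cases k with
    | zero => exact isCounting_countLT C
    | succ k => exact (ih k).pickCount _

theorem pickCount_congr_of_le {C D : List ℕ} {f g : ℕ → ℕ} {n : ℕ}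
    (hC : ∀ v < n, (v ∈ C ↔ v ∈ D)) (hf : ∀ v ≤ n, f v = g v) :
    ∀ v ≤ n, pickCount C f v = pickCount D g v := by
  intro v
  induction v with
  | zero => simp [pickCount_zero]
  | succ v ih =>
    intro hv
    rw [pickCount_succ, pickCount_succ, ih (by omega), hf _ hv]
    simp only [hC v (by omega)]

theorem pickCount_congr_of_ge {C D : List ℕ} {f g : ℕ → ℕ} {n : ℕ}
    (hC : ∀ v, n ≤ v → (v ∈ C ↔ v ∈ D)) (hf : ∀ v, n ≤ v → f v = g v)
    (h : pickCount C f n = pickCount D g n) : ∀ v, n ≤ v → pickCount C f v = pickCount D g v := by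
  intro v hv
  induction v, hv using Nat.le_induction with
  | base => exact h
  | succ v hv ih =>
    rw [pickCount_succ, pickCount_succ, ih, hf _ (by omega)]
    simp only [hC v hv]

/-- The relation between the counting function of the first element of an `i`-string and that of
the other elements. -/
structure IsStringPair (i : ℕ) (f g : ℕ → ℕ) : Prop where
  left : IsCounting f
  right : IsCounting g
  eq : ∀ v, v ≠ i + 1 → f v = g v
  dominant : f (i + 1) < f (i + 1 + 1) → f i < f (i + 1)
  cases : g (i + 1) = f (i + 1) ∨ (g (i + 1) = f i ∧ f (i + 1) = f i + 1 ∧ f (i + 1 + 1) = f i + 1)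

/-- The counts agree up to `i`. What needs checking is that they meet again at `i + 2`, a finite
comparison of the values at `i`, `i + 1` and `i + 2`. -/
theorem IsStringPair.pick {i : ℕ} {f g : ℕ → ℕ} (h : IsStringPair i f g) {C : List ℕ}
    (hC : i ∈ C ↔ i + 1 ∈ C) : IsStringPair i (pickCount C f) (pickCount C g) := by
  have e₀ := pickCount_congr_of_le (C := C) (D := C) (n := i) (fun _ _ => Iff.rfl)
    fun v hv => h.eq v (by omega)
  have hf₁ := pickCount_succ C f i
  have hg₁ := pickCount_succ C g i
  have hf₂ := pickCount_succ C f (i + 1)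
  have hg₂ := pickCount_succ C g (i + 1)
  have hle := pickCount_le (C := C) (f := f) i
  have hi := e₀ i le_rfl
  have m₀ := h.left.mono i
  have m₁ := h.left.mono (i + 1)
  have s₀ := h.left.step i
  have s₁ := h.left.step (i + 1)
  have n₀ := h.right.mono i
  have n₁ := h.right.mono (i + 1)
  have q₀ := h.eq i (by omega)
  have q₂ := h.eq (i + 1 + 1) (by omega)
  have hd := h.dominant
  have hc := h.cases
  have e₂ : pickCount C f (i + 1 + 1) = pickCount C g (i + 1 + 1) := by
    by_cases hi : i ∈ C
    · have hi' := hC.1 hi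
      simp only [hi, hi', if_true] at hf₁ hg₁ hf₂ hg₂
      omega
    · have hi' : i + 1 ∉ C := fun h => hi (hC.2 h)
      simp only [hi, hi', if_false] at hf₁ hg₁ hf₂ hg₂
      omega
  have e₃ := pickCount_congr_of_ge (C := C) (D := C) (n := i + 1 + 1) (fun _ _ => Iff.rfl)
    (fun v hv => h.eq v (by omega)) e₂
  refine ⟨h.left.pickCount C, h.right.pickCount C, fun v hv => ?_, ?_, ?_⟩
  · rcases Nat.lt_or_ge i v with hlt | hle
    · exact e₃ v (by omega)
    · exact e₀ v hle
  · by_cases hi : i ∈ C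
    · have hi' := hC.1 hi
      simp only [hi, hi', if_true] at hf₁ hg₁ hf₂ hg₂
      omega
    · have hi' : i + 1 ∉ C := fun h => hi (hC.2 h)
      simp only [hi, hi', if_false] at hf₁ hg₁ hf₂ hg₂
      omega
  · by_cases hi : i ∈ C
    · have hi' := hC.1 hi
      simp only [hi, hi', if_true] at hf₁ hg₁ hf₂ hg₂
      omega
    · have hi' : i + 1 ∉ C := fun h => hi (hC.2 h)
      simp only [hi, hi', if_false] at hf₁ hg₁ hf₂ hg₂
      omega

/-- Nothing can be chosen at `i` from a column without `i`, so the bound at `i + 1`, the only place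
where `f` and `g` differ, has no effect. -/
theorem IsStringPair.pick_minus {i : ℕ} {f g : ℕ → ℕ} (h : IsStringPair i f g) {D : List ℕ}
    (hD : i ∉ D) : pickCount D g = pickCount D f := by
  have e₀ := pickCount_congr_of_le (C := D) (D := D) (n := i) (fun _ _ => Iff.rfl)
    fun v hv => h.eq v (by omega)
  have hf₁ := pickCount_succ D f i
  have hg₁ := pickCount_succ D g i
  have hle := pickCount_le (C := D) (f := f) i
  have hi := e₀ i le_rfl
  have m₀ := h.left.mono i
  have n₀ := h.right.mono i
  have q₀ := h.eq i (by omega)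
  simp only [hD, if_false] at hf₁ hg₁
  have e₁ : pickCount D f (i + 1) = pickCount D g (i + 1) := by omega
  have e₂ : pickCount D f (i + 1 + 1) = pickCount D g (i + 1 + 1) := by
    rw [pickCount_succ D f (i + 1), pickCount_succ D g (i + 1), e₁, h.eq (i + 1 + 1) (by omega)]
  have e₃ := pickCount_congr_of_ge (C := D) (D := D) (n := i + 1 + 1) (fun _ _ => Iff.rfl)
    (fun v hv => h.eq v (by omega)) e₂
  funext v
  rcases Nat.lt_or_ge i v with hlt | hle
  · rcases Nat.lt_or_ge (i + 1) v with hlt | hle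
    · exact (e₃ v (by omega)).symm
    · obtain rfl : v = i + 1 := by omega
      exact e₁.symm
  · exact (e₀ v hle).symm

/-- The choice from `C` may use `i` where the choice from `D` can only use `i + 1`. The dominance
condition on `f` ensures that both have the same count at `i + 2`. -/
theorem IsStringPair.pick_plus {i : ℕ} {f g : ℕ → ℕ} (h : IsStringPair i f g) {C D : List ℕ}
    (hC : i ∈ C ∧ i + 1 ∉ C) (hD : i ∉ D ∧ i + 1 ∈ D)
    (hCD : ∀ v, v ≠ i → v ≠ i + 1 → (v ∈ C ↔ v ∈ D)) :
    IsStringPair i (pickCount C f) (pickCount D f) := by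
  have e₀ := pickCount_congr_of_le (C := C) (D := D) (f := f) (g := f) (n := i)
    (fun v hv => hCD v (by omega) (by omega)) fun v hv => rfl
  have hf₁ := pickCount_succ C f i
  have hg₁ := pickCount_succ D f i
  have hf₂ := pickCount_succ C f (i + 1)
  have hg₂ := pickCount_succ D f (i + 1)
  have hle := pickCount_le (C := C) (f := f) i
  have hi := e₀ i le_rfl
  have m₀ := h.left.mono i
  have m₁ := h.left.mono (i + 1)
  have s₀ := h.left.step i
  have s₁ := h.left.step (i + 1)
  have hd := h.dominant
  simp only [hC, hD, if_true, if_false] at hf₁ hg₁ hf₂ hg₂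
  have e₂ : pickCount C f (i + 1 + 1) = pickCount D f (i + 1 + 1) := by omega
  have e₃ := pickCount_congr_of_ge (C := C) (D := D) (n := i + 1 + 1)
    (fun v hv => hCD v (by omega) (by omega)) (fun v hv => rfl) e₂
  refine ⟨h.left.pickCount C, h.left.pickCount D, fun v hv => ?_, by omega, by omega⟩
  rcases Nat.lt_or_ge i v with hlt | hle
  · exact e₃ v (by omega)
  · exact e₀ v hle

theorem IsCounting.isStringPair_pick {i : ℕ} {f : ℕ → ℕ} (hf : IsCounting f) {C : List ℕ}
    (hC : i + 1 ∉ C) : IsStringPair i (NilKey.pickCount C f) (NilKey.pickCount C f) := by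
  refine ⟨hf.pickCount C, hf.pickCount C, fun _ _ => rfl, ?_, Or.inl rfl⟩
  have := pickCount_succ C f (i + 1)
  simp only [hC, if_false] at this
  omega

theorem isStringPair_countLT {i : ℕ} {C : Finset ℕ} (hC : i + 1 ∈ C → i ∈ C) :
    IsStringPair i (countLT C) (countLT C) := by
  refine ⟨isCounting_countLT C, isCounting_countLT C, fun _ _ => rfl, ?_, Or.inl rfl⟩
  rw [countLT_succ C (i + 1), countLT_succ C i]
  split_ifs <;> first | omega | tauto

/-- The column obtained from `C` by replacing `i + 1` by `i`. -/
def plusColumn (i : ℕ) (C : Finset ℕ) : Finset ℕ := insert i (C.erase (i + 1))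

/-- The column obtained from `C` by replacing `i` by `i + 1`. -/
def minusColumn (i : ℕ) (C : Finset ℕ) : Finset ℕ := insert (i + 1) (C.erase i)

theorem mem_plusColumn {i v : ℕ} {C : Finset ℕ} :
    v ∈ plusColumn i C ↔ v = i ∨ (v ≠ i + 1 ∧ v ∈ C) := by simp [plusColumn]

theorem mem_minusColumn {i v : ℕ} {C : Finset ℕ} :
    v ∈ minusColumn i C ↔ v = i + 1 ∨ (v ≠ i ∧ v ∈ C) := by simp [minusColumn]

theorem plusColumn_eq_insert (i : ℕ) (C : Finset ℕ) :
    plusColumn i C = insert i (C \ {i, i + 1}) := by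
  ext v
  simp only [mem_plusColumn, Finset.mem_insert, Finset.mem_sdiff, Finset.mem_singleton]
  tauto

theorem minusColumn_eq_insert (i : ℕ) (C : Finset ℕ) :
    minusColumn i C = insert (i + 1) (C \ {i, i + 1}) := by
  ext v
  simp only [mem_minusColumn, Finset.mem_insert, Finset.mem_sdiff, Finset.mem_singleton]
  tauto

theorem countLT_minusColumn {i : ℕ} {C : Finset ℕ} (v : ℕ) :
    countLT (minusColumn i C) v = countLT (C \ {i, i + 1}) v + if i + 1 < v then 1 else 0 := by
  rw [minusColumn_eq_insert, countLT_insert (by simp), add_comm]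

theorem countLT_plusColumn {i : ℕ} {C : Finset ℕ} (v : ℕ) :
    countLT (plusColumn i C) v = countLT (C \ {i, i + 1}) v + if i < v then 1 else 0 := by
  rw [plusColumn_eq_insert, countLT_insert (by simp), add_comm]

theorem isStringPair_countLT_plus (i : ℕ) (C : Finset ℕ) :
    IsStringPair i (countLT (plusColumn i C)) (countLT (minusColumn i C)) := by
  have h₁ := countLT_succ (C \ {i, i + 1}) i
  have h₂ := countLT_succ (C \ {i, i + 1}) (i + 1)
  rw [if_neg (by simp)] at h₁ h₂
  refine ⟨isCounting_countLT _, isCounting_countLT _, fun v hv => ?_, ?_, ?_⟩ <;>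
    simp only [countLT_plusColumn, countLT_minusColumn] <;> split_ifs <;> omega

/-- The `i`-string of a sequence of columns. -/
def iString (i : ℕ) : List (Finset ℕ) → List (List (Finset ℕ))
  | [] => [[]]
  | C :: b =>
    if i ∈ C ↔ i + 1 ∈ C then (iString i b).map (C :: ·)
    else if i + 1 ∈ C ∨ b = (iString i b).headD [] then
      (plusColumn i C :: (iString i b).headD []) :: (iString i b).map (minusColumn i C :: ·)
    else (iString i b).tail.map (C :: ·)

/-- The cases of `iString` are the tensor product rule for strings. A column with both or neither of
`i`, `i + 1` changes nothing. A column with one of them, put before a string of `n` elements, yields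
a string of `n + 1` elements (the head preceded by `i`, then all elements preceded by `i + 1`) and a
string of `n - 1` elements (the other elements preceded by `i`). -/
theorem iString_cons_of_iff {i : ℕ} {C : Finset ℕ} (b : List (Finset ℕ))
    (h : i ∈ C ↔ i + 1 ∈ C) : iString i (C :: b) = (iString i b).map (C :: ·) := by
  rw [iString, if_pos h]

theorem iString_cons_of_or {i : ℕ} {C : Finset ℕ} {b b₀ : List (Finset ℕ)}
    {s : List (List (Finset ℕ))} (hs : iString i b = b₀ :: s) (h : ¬ (i ∈ C ↔ i + 1 ∈ C))
    (h' : i + 1 ∈ C ∨ b = b₀) :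
    iString i (C :: b) = (plusColumn i C :: b₀) :: (b₀ :: s).map (minusColumn i C :: ·) := by
  rw [iString, if_neg h, if_pos (by simpa [hs] using h'), hs, List.headD_cons]

theorem iString_cons_of_not {i : ℕ} {C : Finset ℕ} {b b₀ : List (Finset ℕ)}
    {s : List (List (Finset ℕ))} (hs : iString i b = b₀ :: s) (h : ¬ (i ∈ C ↔ i + 1 ∈ C))
    (h' : ¬ (i + 1 ∈ C ∨ b = b₀)) : iString i (C :: b) = s.map (C :: ·) := by
  rw [iString, if_neg h, if_neg (by simpa [hs] using h'), hs, List.tail_cons]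

theorem plusColumn_eq_self {i : ℕ} {C : Finset ℕ} (h : i ∈ C) (h' : i + 1 ∉ C) :
    plusColumn i C = C := by
  ext v
  rw [mem_plusColumn]
  constructor
  · rintro (rfl | h)
    exacts [h, h.2]
  · exact fun hv => Or.inr ⟨fun he => h' (he ▸ hv), hv⟩

theorem minusColumn_eq_self {i : ℕ} {C : Finset ℕ} (h : i ∉ C) (h' : i + 1 ∈ C) :
    minusColumn i C = C := by
  ext v
  rw [mem_minusColumn]
  constructor
  · rintro (rfl | h)
    exacts [h', h.2]
  · exact fun hv => Or.inr ⟨fun he => h (he ▸ hv), hv⟩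

theorem mem_iString_self (i : ℕ) (b : List (Finset ℕ)) : b ∈ iString i b := by
  induction b with
  | nil => simp [iString]
  | cons C b ih =>
    rw [iString]
    split_ifs with h₁ h₂
    · exact List.mem_map_of_mem ih
    · by_cases hi : i + 1 ∈ C
      · have hi' : i ∉ C := by tauto
        refine List.mem_cons_of_mem _ (List.mem_map.2 ⟨b, ih, ?_⟩)
        rw [minusColumn_eq_self hi' hi]
      · have hb := h₂.resolve_left hi
        rw [← hb, plusColumn_eq_self (by tauto) hi]
        exact List.mem_cons_self
    · rw [not_or] at h₂
      refine List.mem_map_of_mem ?_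
      cases hs : iString i b with
      | nil => simp [hs] at ih
      | cons b₀ s =>
        rw [hs] at ih h₂
        exact (List.mem_cons.1 ih).resolve_left h₂.2

theorem exists_iString_eq (i : ℕ) (b : List (Finset ℕ)) : ∃ b₀ s, iString i b = b₀ :: s :=
  List.exists_cons_of_ne_nil (List.ne_nil_of_mem (mem_iString_self i b))

theorem nodup_iString (i : ℕ) (b : List (Finset ℕ)) : (iString i b).Nodup := by
  induction b with
  | nil => simp [iString]
  | cons C b ih =>
    have hinj : ∀ D : Finset ℕ, Function.Injective (D :: ·) := fun D => List.cons_injective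
    rw [iString]
    split_ifs with h₁ h₂
    · exact ih.map (hinj C)
    · refine List.nodup_cons.2 ⟨?_, ih.map (hinj _)⟩
      intro hmem
      obtain ⟨b', -, he⟩ := List.mem_map.1 hmem
      have he := (List.cons.inj he).1
      have : i ∈ minusColumn i C := by
        rw [he, mem_plusColumn]
        exact Or.inl rfl
      rw [mem_minusColumn] at this
      omega
    · exact (ih.sublist (List.tail_sublist _)).map (hinj C)

/-- Strings partition the sequences of columns, so that sums over sequences can be taken string by
string. -/
theorem iString_eq_of_mem {i : ℕ} {b b' : List (Finset ℕ)} (h : b' ∈ iString i b) :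
    iString i b' = iString i b := by
  induction b generalizing b' with
  | nil =>
    obtain rfl : b' = [] := by simpa [iString] using h
    rfl
  | cons C b ih =>
    obtain ⟨b₀, s, hs⟩ := exists_iString_eq i b
    have hnd := nodup_iString i b
    rw [hs] at ih hnd
    by_cases h₁ : i ∈ C ↔ i + 1 ∈ C
    · rw [iString_cons_of_iff b h₁] at h ⊢
      obtain ⟨b'', hb, rfl⟩ := List.mem_map.1 h
      rw [iString_cons_of_iff _ h₁, ih (hs ▸ hb), hs]
    by_cases h₂ : i + 1 ∈ C ∨ b = b₀
    · rw [iString_cons_of_or hs h₁ h₂] at h ⊢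
      rcases List.mem_cons.1 h with rfl | h
      · have e₁ : ¬ (i ∈ plusColumn i C ↔ i + 1 ∈ plusColumn i C) := by simp [mem_plusColumn]
        have e₂ : plusColumn i (plusColumn i C) = plusColumn i C := by
          ext v; simp only [mem_plusColumn]; tauto
        have e₃ : minusColumn i (plusColumn i C) = minusColumn i C := by
          ext v
          simp only [mem_plusColumn, mem_minusColumn]
          by_cases hv : v = i + 1 <;> by_cases hv' : v = i <;> simp [hv, hv']
        rw [iString_cons_of_or (ih List.mem_cons_self) e₁ (Or.inr rfl), e₂, e₃]
      · obtain ⟨b'', hb, rfl⟩ := List.mem_map.1 h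
        have e₁ : ¬ (i ∈ minusColumn i C ↔ i + 1 ∈ minusColumn i C) := by simp [mem_minusColumn]
        have e₂ : minusColumn i (minusColumn i C) = minusColumn i C := by
          ext v; simp only [mem_minusColumn]; tauto
        have e₃ : plusColumn i (minusColumn i C) = plusColumn i C := by
          ext v
          simp only [mem_plusColumn, mem_minusColumn]
          by_cases hv : v = i + 1 <;> by_cases hv' : v = i <;> simp [hv, hv']
        rw [iString_cons_of_or (ih hb) e₁ (Or.inl (by simp [mem_minusColumn])), e₂, e₃]
    · rw [iString_cons_of_not hs h₁ h₂] at h ⊢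
      obtain ⟨b'', hb, rfl⟩ := List.mem_map.1 h
      rw [not_or] at h₂
      have hne : b'' ≠ b₀ := by
        rintro rfl
        exact (List.nodup_cons.1 hnd).1 hb
      rw [iString_cons_of_not (ih (List.mem_cons_of_mem _ hb)) h₁ (by simp [h₂.1, hne])]

/-- Induction on the columns with the `pick` lemmas. A column in minus form hides the difference
between the head and the rest of a string; a column in plus form stands before the head only, or
before the other elements only, and these share one count. The string property of Demazure sets
rests on this. -/
theorem exists_setCount_iString (i : ℕ) (b : List (Finset ℕ)) (k : ℕ) :
    ∃ g, IsStringPair i (setCount ((iString i b).headD []) k) g ∧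
      ∀ b' ∈ (iString i b).tail, setCount b' k = g := by
  induction b generalizing k with
  | nil =>
    refine ⟨fun _ => 0, ⟨isCounting_setCount [] k, isCounting_setCount [] 0, fun _ _ => rfl, ?_,
      Or.inl rfl⟩, by simp [iString]⟩
    simp [iString, setCount]
  | cons C b ih =>
    obtain ⟨b₀, s, hs⟩ := exists_iString_eq i b
    simp only [hs, List.headD_cons, List.tail_cons] at ih
    have hmemC : ∀ (D : Finset ℕ) v, v ∈ D.sort (· ≥ ·) ↔ v ∈ D := fun D v => Finset.mem_sort _
    by_cases h₁ : i ∈ C ↔ i + 1 ∈ C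
    · rw [iString_cons_of_iff b h₁, hs]
      simp only [List.map_cons, List.headD_cons, List.tail_cons, List.mem_map,
        forall_exists_index, and_imp, forall_apply_eq_imp_iff₂]
      cases k with
      | zero => exact ⟨_, isStringPair_countLT h₁.2, fun _ _ => rfl⟩
      | succ k =>
        obtain ⟨g, hg, hg'⟩ := ih k
        exact ⟨_, hg.pick (by simpa [hmemC] using h₁), fun b' hb' => by rw [setCount, hg' b' hb']⟩
    by_cases h₂ : i + 1 ∈ C ∨ b = b₀
    · rw [iString_cons_of_or hs h₁ h₂]
      simp only [List.headD_cons, List.tail_cons, List.mem_map, forall_exists_index, and_imp,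
        forall_apply_eq_imp_iff₂]
      cases k with
      | zero => exact ⟨_, isStringPair_countLT_plus i C, fun _ _ => rfl⟩
      | succ k =>
        obtain ⟨g, hg, hg'⟩ := ih k
        refine ⟨_, hg.pick_plus (C := (plusColumn i C).sort (· ≥ ·))
          (D := (minusColumn i C).sort (· ≥ ·)) ?_ ?_ ?_, ?_⟩
        · simp [hmemC, mem_plusColumn]
        · simp [hmemC, mem_minusColumn]
        · intro v h h'
          simp [hmemC, mem_plusColumn, mem_minusColumn, h, h']
        · intro b' hb'
          rcases List.mem_cons.1 hb' with rfl | hb'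
          · rfl
          · rw [setCount, hg' b' hb', hg.pick_minus]
            simp [hmemC, mem_minusColumn]
    · rw [iString_cons_of_not hs h₁ h₂]
      rw [not_or] at h₂
      cases s with
      | nil =>
        have := mem_iString_self i b
        rw [hs] at this
        exact absurd (by simpa using this) h₂.2
      | cons b₁ s =>
        simp only [List.map_cons, List.headD_cons, List.tail_cons, List.mem_map,
          forall_exists_index, and_imp, forall_apply_eq_imp_iff₂]
        cases k with
        | zero => exact ⟨_, isStringPair_countLT fun h => absurd h h₂.1, fun _ _ => rfl⟩
        | succ k =>
          obtain ⟨g, hg, hg'⟩ := ih k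
          refine ⟨_, (isCounting_setCount b₁ k).isStringPair_pick (by simpa [hmemC] using h₂.1),
            fun b' hb' => ?_⟩
          rw [setCount, hg' b' (by simp [hb']), hg' b₁ (by simp)]

/-! ### Weights of strings -/

open MvPolynomial in
/-- The monomial of a sequence of columns. -/
noncomputable def columnsWeight (b : List (Finset ℕ)) : MvPolynomial ℕ ℤ :=
  (b.map fun C => ∏ v ∈ C, X v).prod

open MvPolynomial in
theorem columnsWeight_cons (C : Finset ℕ) (b : List (Finset ℕ)) :
    columnsWeight (C :: b) = (∏ v ∈ C, X v) * columnsWeight b := by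
  rw [columnsWeight, List.map_cons, List.prod_cons]
  rfl

open MvPolynomial in
theorem rename_swap_prod {i : ℕ} {C : Finset ℕ} (h : i ∈ C ↔ i + 1 ∈ C) :
    rename (Equiv.swap i (i + 1)) (∏ v ∈ C, (X v : MvPolynomial ℕ ℤ)) = ∏ v ∈ C, X v := by
  rw [map_prod]
  refine Finset.prod_nbij' (Equiv.swap i (i + 1)) (Equiv.swap i (i + 1)) ?_ ?_ (by simp) (by simp)
    (by simp [rename_X])
  all_goals
    intro v hv
    rw [Equiv.swap_apply_def]
    split_ifs with h₁ h₂
    · exact h.1 (h₁ ▸ hv)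
    · exact h.2 (h₂ ▸ hv)
    · exact hv

open MvPolynomial in
-- Up to division, the second clause says that the Demazure operator turns the weight of the head
-- into that of the string. The third clause, a constant ratio of consecutive weights, is needed
-- when the head is dropped and the second element takes its place.
theorem columnsWeight_iString (i : ℕ) (b : List (Finset ℕ)) :
    rename (Equiv.swap i (i + 1)) ((iString i b).map columnsWeight).sum =
        ((iString i b).map columnsWeight).sum ∧
      X i * columnsWeight ((iString i b).headD []) -
          X (i + 1) * rename (Equiv.swap i (i + 1)) (columnsWeight ((iString i b).headD [])) =
        (X i - X (i + 1)) * ((iString i b).map columnsWeight).sum ∧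
      (iString i b).IsChain fun b b' => X i * columnsWeight b' = X (i + 1) * columnsWeight b := by
  induction b with
  | nil => simp [iString, columnsWeight]
  | cons C b ih =>
    obtain ⟨b₀, s, hs⟩ := exists_iString_eq i b
    rw [hs] at ih
    simp only [List.headD_cons, List.map_cons, List.sum_cons] at ih
    have hsum : ∀ (D : Finset ℕ) (t : List (List (Finset ℕ))),
        ((t.map (D :: ·)).map columnsWeight).sum =
          (∏ v ∈ D, X v) * (t.map columnsWeight).sum := by
      intro D t
      rw [List.map_map, ← List.sum_map_mul_left]
      simp [Function.comp_def, columnsWeight_cons]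
    have hchain : ∀ (D : Finset ℕ) {t : List (List (Finset ℕ))},
        (t.IsChain fun b b' => (X i : MvPolynomial ℕ ℤ) * columnsWeight b' =
          X (i + 1) * columnsWeight b) →
        (t.map (D :: ·)).IsChain fun b b' => (X i : MvPolynomial ℕ ℤ) * columnsWeight b' =
          X (i + 1) * columnsWeight b := by
      intro D t ht
      rw [List.isChain_map]
      refine ht.imp fun b b' h => ?_
      rw [columnsWeight_cons, columnsWeight_cons, mul_left_comm, h, mul_left_comm]
    have hX : rename (Equiv.swap i (i + 1)) (X i : MvPolynomial ℕ ℤ) = X (i + 1) := by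
      simp [rename_X]
    have hX' : rename (Equiv.swap i (i + 1)) (X (i + 1) : MvPolynomial ℕ ℤ) = X i := by
      simp [rename_X]
    obtain ⟨k₁, k₂, k₃⟩ := ih
    have hY := rename_swap_prod (i := i) (C := C \ {i, i + 1}) (by simp)
    have hp : ∏ v ∈ plusColumn i C, (X v : MvPolynomial ℕ ℤ) =
        X i * ∏ v ∈ C \ {i, i + 1}, X v := by
      rw [plusColumn_eq_insert, Finset.prod_insert (by simp)]
    have hm : ∏ v ∈ minusColumn i C, (X v : MvPolynomial ℕ ℤ) =
        X (i + 1) * ∏ v ∈ C \ {i, i + 1}, X v := by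
      rw [minusColumn_eq_insert, Finset.prod_insert (by simp)]
    set Y := ∏ v ∈ C \ {i, i + 1}, (X v : MvPolynomial ℕ ℤ)
    set H := columnsWeight b₀
    set R := (s.map columnsWeight).sum with hR
    rw [map_add] at k₁
    by_cases h₁ : i ∈ C ↔ i + 1 ∈ C
    · have hC := rename_swap_prod h₁
      have hhead : ((b₀ :: s).map (C :: ·)).headD [] = C :: b₀ := rfl
      rw [iString_cons_of_iff b h₁, hsum, hs, hhead, List.map_cons, List.sum_cons,
        columnsWeight_cons, map_mul, map_mul, hC, map_add, k₁]
      exact ⟨rfl, by linear_combination (∏ v ∈ C, X v) * k₂, hchain C k₃⟩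
    by_cases h₂ : i + 1 ∈ C ∨ b = b₀
    · rw [iString_cons_of_or hs h₁ h₂, List.map_cons, List.sum_cons, hsum, List.headD_cons,
        columnsWeight_cons, List.map_cons, List.sum_cons, hp, hm]
      refine ⟨?_, ?_, ?_⟩
      · simp only [map_add, map_mul, hX, hX', hY]
        linear_combination (X i * Y) * k₁ - Y * k₂
      · simp only [map_mul, hX, hY]
        linear_combination (X (i + 1) * Y) * k₂
      · rw [List.map_cons]
        refine List.IsChain.cons_cons ?_ (hchain _ k₃)
        rw [columnsWeight_cons, columnsWeight_cons, hp, hm]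
        ring
    · rw [iString_cons_of_not hs h₁ h₂]
      rw [not_or] at h₂
      cases s with
      | nil =>
        have := mem_iString_self i b
        rw [hs] at this
        exact absurd (by simpa using this) h₂.2
      | cons b₁ s =>
        have hb₁ := (List.isChain_cons_cons.1 k₃).1
        have hC : ∏ v ∈ C, (X v : MvPolynomial ℕ ℤ) = X i * Y := by
          rw [← hp, plusColumn_eq_self (by tauto) h₂.1]
        have hw : X i * Y * columnsWeight b₁ = X (i + 1) * Y * H := by linear_combination Y * hb₁
        rw [hsum, ← hR, List.map_cons, List.headD_cons, columnsWeight_cons, hC, hw]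
        refine ⟨?_, ?_, hchain C (List.isChain_cons_cons.1 k₃).2⟩
        · simp only [map_mul, hX, hY]
          linear_combination (X (i + 1) * Y) * k₁ + Y * k₂
        · simp only [map_mul, hX', hY]
          linear_combination (X i * Y) * k₂

theorem iString_card_pos {i : ℕ} (hi : 1 ≤ i) {b b' : List (Finset ℕ)} (h : b' ∈ iString i b) :
    b'.map Finset.card = b.map Finset.card ∧ ((∀ C ∈ b, 0 ∉ C) → ∀ C ∈ b', 0 ∉ C) := by
  induction b generalizing b' with
  | nil =>
    obtain rfl : b' = [] := by simpa [iString] using h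
    exact ⟨rfl, fun h => h⟩
  | cons C b ih =>
    obtain ⟨b₀, s, hs⟩ := exists_iString_eq i b
    have hcons : ∀ {D : Finset ℕ} {b'' : List (Finset ℕ)}, D.card = C.card → (0 ∉ C → 0 ∉ D) →
        b'' ∈ iString i b → (D :: b'').map Finset.card = (C :: b).map Finset.card ∧
          ((∀ C' ∈ C :: b, 0 ∉ C') → ∀ C' ∈ D :: b'', 0 ∉ C') := by
      intro D b'' h₁ h₂ h₃
      obtain ⟨k₁, k₂⟩ := ih h₃
      refine ⟨by rw [List.map_cons, List.map_cons, k₁, h₁], fun h C' hC' => ?_⟩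
      rcases List.mem_cons.1 hC' with rfl | hC'
      · exact h₂ (h C List.mem_cons_self)
      · exact k₂ (fun C' hC' => h C' (List.mem_cons_of_mem _ hC')) C' hC'
    by_cases h₁ : i ∈ C ↔ i + 1 ∈ C
    · rw [iString_cons_of_iff b h₁] at h
      obtain ⟨b'', hb, rfl⟩ := List.mem_map.1 h
      exact hcons rfl (fun h => h) hb
    have hcard : (C \ {i, i + 1}).card + 1 = C.card := by
      by_cases hiC : i ∈ C
      · rw [← plusColumn_eq_self hiC (by tauto), plusColumn_eq_insert,
          Finset.card_insert_of_notMem (by simp)]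
        congr 2
        ext v
        simp only [Finset.mem_insert, Finset.mem_sdiff, Finset.mem_singleton]
        tauto
      · rw [← minusColumn_eq_self hiC (by tauto), minusColumn_eq_insert,
          Finset.card_insert_of_notMem (by simp)]
        congr 2
        ext v
        simp only [Finset.mem_insert, Finset.mem_sdiff, Finset.mem_singleton]
        tauto
    have hp : (plusColumn i C).card = C.card := by
      rw [plusColumn_eq_insert, Finset.card_insert_of_notMem (by simp), hcard]
    have hm : (minusColumn i C).card = C.card := by
      rw [minusColumn_eq_insert, Finset.card_insert_of_notMem (by simp), hcard]
    by_cases h₂ : i + 1 ∈ C ∨ b = b₀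
    · rw [iString_cons_of_or hs h₁ h₂] at h
      rcases List.mem_cons.1 h with rfl | h
      · refine hcons hp (fun h => ?_) (hs ▸ List.mem_cons_self)
        rw [mem_plusColumn]
        rintro (h' | h')
        exacts [by omega, h h'.2]
      · obtain ⟨b'', hb, rfl⟩ := List.mem_map.1 h
        refine hcons hm (fun h => ?_) (hs ▸ hb)
        rw [mem_minusColumn]
        rintro (h' | h')
        exacts [by omega, h h'.2]
    · rw [iString_cons_of_not hs h₁ h₂] at h
      obtain ⟨b'', hb, rfl⟩ := List.mem_map.1 h
      exact hcons rfl (fun h => h) (hs ▸ List.mem_cons_of_mem _ hb)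

/-! ## Demazure characters as sums over sequences of columns -/

/-- The sequences of columns of the same lengths as those of `S` whose left key dominates `S`. -/
structure IsDominating (S b : List (Finset ℕ)) : Prop where
  card : b.map Finset.card = S.map Finset.card
  pos : ∀ C ∈ b, 0 ∉ C
  le : ∀ k v, countLT (S.getD k ∅) v ≤ setCount b k v

theorem setCount_le_countLT (b : List (Finset ℕ)) (k v : ℕ) :
    setCount b k v ≤ countLT (b.getD k ∅) v := by
  induction b generalizing k with
  | nil => simp [setCount]
  | cons C b ih =>
    cases k with
    | zero => exact le_rfl
    | succ k => exact (pickCount_le v).trans (ih k)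

theorem exists_forall_lt (S : List (Finset ℕ)) : ∃ N, ∀ C ∈ S, ∀ v ∈ C, v < N := by
  induction S with
  | nil => simp
  | cons C S ih =>
    obtain ⟨N, hN⟩ := ih
    refine ⟨max N (C.sup id + 1), fun D hD v hv => ?_⟩
    rcases List.mem_cons.1 hD with rfl | hD
    · have := Finset.le_sup (f := id) hv
      simp only [id] at this
      omega
    · have := hN D hD v hv
      omega

theorem getD_empty_mem_or (S : List (Finset ℕ)) (k : ℕ) : S.getD k ∅ ∈ S ∨ S.getD k ∅ = ∅ := by
  rw [List.getD_eq_getElem?_getD]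
  cases h : S[k]? with
  | none => exact Or.inr rfl
  | some C => exact Or.inl (List.mem_of_getElem? h)

theorem card_getD {S b : List (Finset ℕ)} (h : b.map Finset.card = S.map Finset.card) (k : ℕ) :
    (b.getD k ∅).card = (S.getD k ∅).card := by
  have := congrArg (fun l => l.getD k (Finset.card (∅ : Finset ℕ))) h
  simpa only [List.getD_map] using this

/-- At `N` the counts of `S` are full, and domination makes those of `b` full as well. This is what
makes the set of dominating sequences finite. -/
theorem IsDominating.forall_lt {S b : List (Finset ℕ)} (h : IsDominating S b) {N : ℕ}
    (hN : ∀ C ∈ S, ∀ v ∈ C, v < N) : ∀ C ∈ b, ∀ v ∈ C, v < N := by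
  intro C hC v hv
  obtain ⟨k, hk, rfl⟩ := List.getElem_of_mem hC
  rw [← List.getD_eq_getElem _ ∅] at hv
  have hSN : ∀ v ∈ S.getD k ∅, v < N := by
    rcases getD_empty_mem_or S k with hm | he
    · exact hN _ hm
    · rw [he]; simp
  have h₁ := (h.le k N).trans (setCount_le_countLT b k N)
  rw [countLT_eq_card hSN, ← card_getD h.card, countLT] at h₁
  have h₂ := Finset.eq_of_subset_of_card_le (Finset.filter_subset _ _) h₁
  rw [← h₂] at hv
  exact (Finset.mem_filter.1 hv).2

theorem finite_isDominating (S : List (Finset ℕ)) : {b | IsDominating S b}.Finite := by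
  obtain ⟨N, hN⟩ := exists_forall_lt S
  refine ((List.finite_length_eq (Finset.range N).powerset S.length).image
    (List.map Subtype.val)).subset fun b hb => ?_
  have hlt := hb.forall_lt hN
  refine ⟨b.attach.map fun C => ⟨C.1, ?_⟩, ?_, ?_⟩
  · exact Finset.mem_powerset.2 fun v hv => Finset.mem_range.2 (hlt C.1 C.2 v hv)
  · simpa using congrArg List.length hb.card
  · simp [List.map_map, Function.comp_def]

/-- The finite set of sequences of columns dominating `S`. -/
noncomputable def dominating (S : List (Finset ℕ)) : Finset (List (Finset ℕ)) :=
  (finite_isDominating S).toFinset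

theorem mem_dominating {S b : List (Finset ℕ)} : b ∈ dominating S ↔ IsDominating S b := by
  simp [dominating]

/-! ### Exchanging `i` and `i + 1` -/

/-- Exchange `i` and `i + 1` in a column. -/
def swapColumn (i : ℕ) (C : Finset ℕ) : Finset ℕ := C.image (Equiv.swap i (i + 1))

theorem mem_swapColumn {i v : ℕ} {C : Finset ℕ} :
    v ∈ swapColumn i C ↔ Equiv.swap i (i + 1) v ∈ C := by
  rw [swapColumn, Finset.mem_image]
  constructor
  · rintro ⟨x, hx, rfl⟩
    simpa using hx
  · exact fun h => ⟨_, h, by simp⟩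

theorem card_swapColumn (i : ℕ) (C : Finset ℕ) : (swapColumn i C).card = C.card :=
  Finset.card_image_of_injective _ (Equiv.injective _)

theorem countLT_swapColumn {i v : ℕ} (hv : v ≠ i + 1) (C : Finset ℕ) :
    countLT (swapColumn i C) v = countLT C v := by
  rw [countLT, countLT, ← card_swapColumn i (C.filter (· < v))]
  congr 1
  ext x
  rw [mem_swapColumn, Finset.mem_filter, Finset.mem_filter, mem_swapColumn, Equiv.swap_apply_def]
  split_ifs <;> simp only [and_congr_right_iff] <;> omega

theorem countLT_swapColumn_self (i : ℕ) (C : Finset ℕ) :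
    countLT (swapColumn i C) (i + 1) = countLT C i + if i + 1 ∈ C then 1 else 0 := by
  rw [countLT_succ, countLT_swapColumn (by omega)]
  simp only [mem_swapColumn, Equiv.swap_apply_left]

theorem countLT_le_swapColumn {i : ℕ} {C : Finset ℕ} (hC : i ∈ C → i + 1 ∈ C) (v : ℕ) :
    countLT C v ≤ countLT (swapColumn i C) v := by
  by_cases hv : v = i + 1
  · rw [hv, countLT_swapColumn_self, countLT_succ]
    split_ifs <;> first | omega | tauto
  · rw [countLT_swapColumn hv]

theorem IsStringPair.right_le {i : ℕ} {f g : ℕ → ℕ} (h : IsStringPair i f g) (v : ℕ) :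
    g v ≤ f v := by
  by_cases hv : v = i + 1
  · have := h.cases
    subst hv
    omega
  · exact (h.eq v hv).ge

/-- The counts `f` and `g` can differ only at `i + 1`, and then `f` grows at `i` but not at `i + 1`.
A column containing `i`, hence also `i + 1`, cannot reach `f (i + 1)` there without exceeding `f` at
`i + 2`; a column without `i` stays at most `f i`. -/
theorem IsStringPair.le_iff {i : ℕ} {f g : ℕ → ℕ} (h : IsStringPair i f g) {C : Finset ℕ}
    (hC : i ∈ C → i + 1 ∈ C) : (∀ v, countLT C v ≤ f v) ↔ ∀ v, countLT C v ≤ g v := by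
  refine ⟨fun hf v => ?_, fun hg v => (hg v).trans (h.right_le v)⟩
  by_cases hv : v = i + 1
  · subst hv
    have h₀ := hf i
    have h₁ := hf (i + 1)
    have h₂ := hf (i + 1 + 1)
    have h₃ := h.cases
    rw [countLT_succ C (i + 1), countLT_succ C i] at h₂
    rw [countLT_succ C i] at h₁ ⊢
    split_ifs at * <;> first | omega | tauto
  · rw [← h.eq v hv]
    exact hf v

/-- If `f` grows from `i + 1` to `i + 2`, it also grows from `i` to `i + 1`, which makes room for
the exchanged letter; otherwise the bound at `i + 2` suffices. -/
theorem IsStringPair.swapColumn_le {i : ℕ} {f g : ℕ → ℕ} (h : IsStringPair i f g) {C : Finset ℕ}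
    (hf : ∀ v, countLT C v ≤ f v) (v : ℕ) : countLT (swapColumn i C) v ≤ f v := by
  by_cases hv : v = i + 1
  · subst hv
    rw [countLT_swapColumn_self]
    have h₀ := hf i
    have h₂ := hf (i + 1 + 1)
    have h₃ := h.dominant
    have h₄ := h.left.mono i
    have h₅ := h.left.mono (i + 1)
    rw [countLT_succ C (i + 1), countLT_succ C i] at h₂
    split_ifs at * <;> omega
  · rw [countLT_swapColumn hv]
    exact hf v

theorem IsDominating.of_mem_iString {i : ℕ} (hi : 1 ≤ i) {S b b' : List (Finset ℕ)}
    (h : IsDominating S b) (hb : b' ∈ iString i b)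
    (hle : ∀ k v, countLT (S.getD k ∅) v ≤ setCount b' k v) : IsDominating S b' :=
  ⟨(iString_card_pos hi hb).1.trans h.card, (iString_card_pos hi hb).2 h.pos, hle⟩

theorem getD_map_swapColumn (i : ℕ) (S : List (Finset ℕ)) (k : ℕ) :
    (S.map (swapColumn i)).getD k ∅ = swapColumn i (S.getD k ∅) := by
  have := List.getD_map (l := S) (n := k) (d := ∅) (swapColumn i)
  simpa [swapColumn] using this

theorem isDominating_map_swapColumn_iff {i : ℕ} {S b : List (Finset ℕ)} :
    IsDominating (S.map (swapColumn i)) b ↔ b.map Finset.card = S.map Finset.card ∧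
      (∀ C ∈ b, 0 ∉ C) ∧ ∀ k v, countLT (swapColumn i (S.getD k ∅)) v ≤ setCount b k v := by
  have hc : (S.map (swapColumn i)).map Finset.card = S.map Finset.card := by
    simp [List.map_map, Function.comp_def, card_swapColumn]
  constructor
  · rintro ⟨h₁, h₂, h₃⟩
    exact ⟨h₁.trans hc, h₂, fun k v => by simpa only [getD_map_swapColumn] using h₃ k v⟩
  · rintro ⟨h₁, h₂, h₃⟩
    exact ⟨h₁.trans hc.symm, h₂, fun k v => by simpa only [getD_map_swapColumn] using h₃ k v⟩

section

variable {i : ℕ} {S : List (Finset ℕ)}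

theorem IsDominating.of_map_swapColumn (hS : ∀ k, i ∈ S.getD k ∅ → i + 1 ∈ S.getD k ∅)
    {b : List (Finset ℕ)} (h : IsDominating (S.map (swapColumn i)) b) : IsDominating S b := by
  obtain ⟨h₁, h₂, h₃⟩ := isDominating_map_swapColumn_iff.1 h
  exact ⟨h₁, h₂, fun k v => (countLT_le_swapColumn (hS k) v).trans (h₃ k v)⟩

/-- A bound satisfied by any element of the string passes to the head by `IsStringPair.le_iff`, and
the dominance of the head allows the exchange. -/
theorem IsDominating.head (hi : 1 ≤ i) (hS : ∀ k, i ∈ S.getD k ∅ → i + 1 ∈ S.getD k ∅)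
    {b b₀ : List (Finset ℕ)} {s : List (List (Finset ℕ))} (hs : iString i b = b₀ :: s)
    (h : IsDominating S b) : IsDominating (S.map (swapColumn i)) b₀ := by
  have hb₀ : b₀ ∈ iString i b := hs ▸ List.mem_cons_self
  rw [isDominating_map_swapColumn_iff]
  refine ⟨(iString_card_pos hi hb₀).1.trans h.card, (iString_card_pos hi hb₀).2 h.pos, fun k v => ?_⟩
  obtain ⟨g, hg, hg'⟩ := exists_setCount_iString i b k
  rw [hs] at hg hg'
  refine hg.swapColumn_le ?_ v
  have hb := mem_iString_self i b
  rw [hs] at hb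
  rcases List.mem_cons.1 hb with rfl | hb
  · exact h.le k
  · rw [hg.le_iff (hS k), ← hg' b hb]
    exact h.le k

/-- Columns in which `i` entails `i + 1` do not distinguish the head from the rest of a string, so
the sequences dominating `S` form whole strings. -/
theorem IsDominating.of_mem (hi : 1 ≤ i) (hS : ∀ k, i ∈ S.getD k ∅ → i + 1 ∈ S.getD k ∅)
    {b b' : List (Finset ℕ)} (hb' : b' ∈ iString i b) (h : IsDominating S b) :
    IsDominating S b' := by
  obtain ⟨b₀, s, hs⟩ := exists_iString_eq i b
  have h₀ := (h.head hi hS hs).of_map_swapColumn hS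
  refine h.of_mem_iString hi hb' fun k => ?_
  obtain ⟨g, hg, hg'⟩ := exists_setCount_iString i b k
  rw [hs] at hg hg' hb'
  rcases List.mem_cons.1 hb' with rfl | hb'
  · exact h₀.le k
  · rw [hg' b' hb', ← hg.le_iff (hS k)]
    exact h₀.le k

/-- All elements after the head share one count, and that of the head is at least as large. -/
theorem IsDominating.map_swapColumn_of_mem (hi : 1 ≤ i)
    {b b₀ b₁ b' : List (Finset ℕ)} {s : List (List (Finset ℕ))} (hs : iString i b = b₀ :: s)
    (hb₁ : b₁ ∈ s) (h : IsDominating (S.map (swapColumn i)) b₁) (hb' : b' ∈ iString i b) :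
    IsDominating (S.map (swapColumn i)) b' := by
  have hb₁' : b₁ ∈ iString i b := hs ▸ List.mem_cons_of_mem _ hb₁
  rw [← iString_eq_of_mem hb₁'] at hb'
  refine h.of_mem_iString hi hb' fun k v => ?_
  rw [iString_eq_of_mem hb₁'] at hb'
  have hle := h.le k v
  obtain ⟨g, hg, hg'⟩ := exists_setCount_iString i b k
  rw [hs] at hg hg' hb'
  rw [hg' b₁ hb₁] at hle
  rcases List.mem_cons.1 hb' with rfl | hb'
  · exact hle.trans (hg.right_le v)
  · rw [hg' b' hb']
    exact hle

open MvPolynomial in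
-- The sequences dominating the exchanged columns contain, of each string dominating `S`, either
-- everything or the head alone. In the first case the weight of the string is symmetric and the
-- operator fixes it; in the second the operator turns the head into the string.
theorem divDiff_sum_dominating (hi : 1 ≤ i) (hS : ∀ k, i ∈ S.getD k ∅ → i + 1 ∈ S.getD k ∅) :
    divDiff i (X i * ∑ b ∈ dominating (S.map (swapColumn i)), columnsWeight b) =
      ∑ b ∈ dominating S, columnsWeight b := by
  classical
  apply divDiff_eq
  rw [map_mul, rename_X, Equiv.swap_apply_left, map_sum, Finset.mul_sum, Finset.mul_sum,
    Finset.mul_sum, ← Finset.sum_sub_distrib]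
  have hmap : ∀ b ∈ dominating S, iString i b ∈ (dominating S).image (iString i) :=
    fun b hb => Finset.mem_image_of_mem _ hb
  rw [← Finset.sum_fiberwise_of_maps_to hmap, ← Finset.sum_fiberwise_of_maps_to
    (s := dominating (S.map (swapColumn i))) fun b hb =>
      hmap b (mem_dominating.2 ((mem_dominating.1 hb).of_map_swapColumn hS))]
  refine Finset.sum_congr rfl fun t ht => ?_
  obtain ⟨b, hb, rfl⟩ := Finset.mem_image.1 ht
  rw [mem_dominating] at hb
  have hfib : (dominating S).filter (iString i · = iString i b) = (iString i b).toFinset := by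
    ext b'
    rw [Finset.mem_filter, mem_dominating, List.mem_toFinset]
    constructor
    · rintro ⟨-, h⟩
      exact h ▸ mem_iString_self i b'
    · exact fun h => ⟨hb.of_mem hi hS h, iString_eq_of_mem h⟩
  obtain ⟨b₀, s, hs⟩ := exists_iString_eq i b
  obtain ⟨k₁, k₂, -⟩ := columnsWeight_iString i b
  have hnd := nodup_iString i b
  have h₀ := hb.head hi hS hs
  rw [hfib, ← Finset.mul_sum, List.sum_toFinset _ hnd]
  by_cases hex : ∃ b₁ ∈ s, IsDominating (S.map (swapColumn i)) b₁
  · obtain ⟨b₁, hb₁, h₁⟩ := hex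
    have hfib' : (dominating (S.map (swapColumn i))).filter (iString i · = iString i b) =
        (iString i b).toFinset := by
      ext b'
      rw [Finset.mem_filter, mem_dominating, List.mem_toFinset]
      constructor
      · rintro ⟨-, h⟩
        exact h ▸ mem_iString_self i b'
      · exact fun h => ⟨h₁.map_swapColumn_of_mem hi hs hb₁ h, iString_eq_of_mem h⟩
    rw [hfib', Finset.sum_sub_distrib, ← Finset.mul_sum, ← Finset.mul_sum, ← map_sum,
      List.sum_toFinset _ hnd, k₁]
    ring
  · have hfib' : (dominating (S.map (swapColumn i))).filter (iString i · = iString i b) = {b₀} := by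
      ext b'
      rw [Finset.mem_filter, mem_dominating, Finset.mem_singleton]
      constructor
      · rintro ⟨h, h'⟩
        have hm := mem_iString_self i b'
        rw [h', hs] at hm
        exact (List.mem_cons.1 hm).resolve_right fun hm => hex ⟨b', hm, h⟩
      · rintro rfl
        exact ⟨h₀, iString_eq_of_mem (hs ▸ List.mem_cons_self)⟩
    rw [hs, List.headD_cons, ← hs] at k₂
    rw [hfib', Finset.sum_singleton, k₂]

end

/-! ### Demazure characters -/

/-- The columns contain each other. -/
def IsNested (S : List (Finset ℕ)) : Prop := S.Pairwise fun C D => D ⊆ C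

/-- In a nested sequence the columns containing `v` come first, so the sequence is determined by its
weight. -/
theorem IsNested.mem_getD_iff {S : List (Finset ℕ)} (h : IsNested S) (k v : ℕ) :
    v ∈ S.getD k ∅ ↔ k < S.countP (v ∈ ·) := by
  induction S generalizing k with
  | nil => simp
  | cons C S ih =>
    obtain ⟨h₁, h₂⟩ := List.pairwise_cons.1 h
    have h₀ : v ∉ C → S.countP (v ∈ ·) = 0 := fun hv =>
      List.countP_eq_zero.2 fun D hD => by simpa using fun h => hv (h₁ D hD h)
    rw [List.countP_cons]
    simp only [decide_eq_true_eq]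
    cases k with
    | zero =>
      rw [List.getD_cons_zero]
      split_ifs with hv
      · simp [hv]
      · simp [hv, h₀ hv]
    | succ k =>
      rw [List.getD_cons_succ, ih h₂]
      split_ifs with hv
      · omega
      · simp [h₀ hv]

theorem IsNested.getD_subset {S : List (Finset ℕ)} (h : IsNested S) {j k : ℕ} (hjk : j ≤ k) :
    S.getD k ∅ ⊆ S.getD j ∅ := by
  intro v hv
  rw [h.mem_getD_iff] at hv ⊢
  omega

theorem IsNested.isDominating_self {S : List (Finset ℕ)} (h : IsNested S) (h₀ : ∀ C ∈ S, 0 ∉ C) :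
    IsDominating S S := by
  refine ⟨rfl, h₀, fun k v => ?_⟩
  rw [← leftCount_map_sort]
  refine le_leftCount (X := fun _ => S.getD k ∅) (fun j hj => ?_) (fun _ _ _ => le_rfl) v
  have := List.getD_map (l := S) (n := j) (d := ∅) fun C : Finset ℕ => C.sort (· ≥ ·)
  rw [Finset.sort_empty] at this
  rw [this, Finset.sort_toFinset]
  exact h.getD_subset hj

theorem countLT_le_of_isInitial {C D : Finset ℕ} (hcard : D.card = C.card) (hD : 0 ∉ D)
    (hC : ∀ v w, 1 ≤ v → v ≤ w → w ∈ C → v ∈ C) (v : ℕ) : countLT D v ≤ countLT C v := by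
  induction v with
  | zero => simp [countLT_zero]
  | succ v ih =>
    by_cases hv : v ∈ C
    · rw [countLT_succ, countLT_succ C, if_pos hv]
      split_ifs <;> omega
    · cases v with
      | zero =>
        rw [countLT_succ, if_neg hD, countLT_zero]
        exact Nat.zero_le _
      | succ v =>
        rw [countLT_eq_card (S := C) fun w hw => ?_, ← hcard]
        · exact countLT_le_card _ _
        · by_contra hlt
          exact hv (hC _ w (by omega) (by omega) hw)

/-- An initial interval has the largest counts among the columns of its size, so domination becomes
equality. -/
theorem dominating_eq_singleton {S : List (Finset ℕ)} (h : IsNested S) (h₀ : ∀ C ∈ S, 0 ∉ C)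
    (hS : ∀ k v w, 1 ≤ v → v ≤ w → w ∈ S.getD k ∅ → v ∈ S.getD k ∅) : dominating S = {S} := by
  ext b
  rw [mem_dominating, Finset.mem_singleton]
  constructor
  · intro hb
    have hlen : b.length = S.length := by simpa using congrArg List.length hb.card
    refine List.ext_getElem hlen fun k hk hk' => ?_
    rw [← List.getD_eq_getElem _ ∅, ← List.getD_eq_getElem _ ∅]
    refine eq_of_countLT fun v => le_antisymm ?_ ((hb.le k v).trans (setCount_le_countLT b k v))
    refine countLT_le_of_isInitial (card_getD hb.card k) ?_ (hS k) v
    rw [List.getD_eq_getElem _ _ hk]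
    exact hb.pos _ (List.getElem_mem hk)
  · rintro rfl
    exact h.isDominating_self h₀

open MvPolynomial in
theorem columnsWeight_eq_monomial {S : List (Finset ℕ)} {α : ℕ →₀ ℕ}
    (h : ∀ v, α v = S.countP (v ∈ ·)) : columnsWeight S = monomial α 1 := by
  induction S generalizing α with
  | nil =>
    obtain rfl : α = 0 := by
      ext v
      simp [h]
    rfl
  | cons C S ih =>
    have hC : ∏ v ∈ C, (X v : MvPolynomial ℕ ℤ) = monomial (∑ v ∈ C, Finsupp.single v 1) 1 := by
      rw [monomial_sum_one]
      rfl
    have hle : ∑ v ∈ C, Finsupp.single v 1 ≤ α := by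
      intro v
      simp only [h, Finsupp.coe_finsetSum, Finset.sum_apply, Finsupp.single_apply,
        Finset.sum_ite_eq', List.countP_cons, decide_eq_true_eq]
      omega
    rw [columnsWeight_cons, hC, ih (α := α - ∑ v ∈ C, Finsupp.single v 1), monomial_mul, mul_one,
      add_tsub_cancel_of_le hle]
    intro v
    simp only [Finsupp.coe_tsub, Pi.sub_apply, h, Finsupp.coe_finsetSum, Finset.sum_apply,
      Finsupp.single_apply, Finset.sum_ite_eq', List.countP_cons, decide_eq_true_eq]
    omega

theorem IsNested.map_swapColumn {S : List (Finset ℕ)} (h : IsNested S) (i : ℕ) :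
    IsNested (S.map (swapColumn i)) :=
  List.pairwise_map.2 (h.imp fun h => Finset.image_subset_image h)

/-- `divDiff_sum_dominating` is the recursion of `κ`, and for a partition only the key itself
dominates. -/
theorem IsDemazure.eq_sum {α : ℕ →₀ ℕ} {f : MvPolynomial ℕ ℤ} (h : IsDemazure α f)
    {S : List (Finset ℕ)} (hS : IsNested S) (h₀ : ∀ C ∈ S, 0 ∉ C)
    (hα : ∀ v, α v = S.countP (v ∈ ·)) : f = ∑ b ∈ dominating S, columnsWeight b := by
  induction h generalizing S with
  | partition α h =>
    rw [dominating_eq_singleton hS h₀, Finset.sum_singleton, columnsWeight_eq_monomial hα]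
    intro k v w hv hvw hw
    rw [hS.mem_getD_iff, ← hα] at hw ⊢
    refine hw.trans_le ?_
    clear hw
    induction w, hvw using Nat.le_induction with
    | base => exact le_rfl
    | succ w hw ih => exact (h w (by omega)).trans ih
  | step α i f hi hlt _ ih =>
    rw [ih (S := S.map (swapColumn i)) (hS.map_swapColumn i), divDiff_sum_dominating hi]
    · intro k
      rw [hS.mem_getD_iff, hS.mem_getD_iff, ← hα, ← hα]
      omega
    · intro C hC
      obtain ⟨D, hD, rfl⟩ := List.mem_map.1 hC
      rw [mem_swapColumn, Equiv.swap_apply_of_ne_of_ne (by omega) (by omega)]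
      exact h₀ D hD
    · intro v
      rw [Finsupp.equivMapDomain_apply, Equiv.symm_swap, hα, List.countP_map]
      simp [Function.comp_def, mem_swapColumn]

/-! ## The expansion of Schubert polynomials -/

theorem countLT_toFinset {L : List ℕ} (hL : L.Nodup) (v : ℕ) :
    countLT L.toFinset v = L.countP (· < v) := by
  have h : L.toFinset.filter (· < v) = (L.filter (· < v)).toFinset := by
    ext x
    simp
  rw [countLT, List.countP_eq_length_filter, h, List.toFinset_card_of_nodup (hL.filter _)]

theorem countLT_add_of_lt {L : List ℕ} (hL : L.Pairwise (· > ·)) {r v : ℕ} (hr : r < L.length)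
    (hv : L.getD r 0 < v) : L.length ≤ countLT L.toFinset v + r := by
  rw [countLT_toFinset (hL.imp ne_of_gt)]
  nth_rw 2 [← List.take_append_drop r L]
  have h : (L.drop r).countP (· < v) = (L.drop r).length := by
    refine List.countP_eq_length.2 fun x hx => ?_
    obtain ⟨k, hk, rfl⟩ := List.getElem_of_mem hx
    rw [List.length_drop] at hk
    rw [List.getElem_drop, decide_eq_true_eq]
    rw [List.getD_eq_getElem _ _ hr] at hv
    rcases Nat.eq_zero_or_pos k with rfl | hk₀
    · simpa using hv
    · exact lt_trans (List.pairwise_iff_getElem.1 hL r (r + k) hr (by omega) (by omega)) hv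
  rw [List.countP_append, h, List.length_drop]
  omega

theorem countLT_add_le_of_le {L : List ℕ} (hL : L.Pairwise (· > ·)) {r v : ℕ} (hr : r < L.length)
    (hv : v ≤ L.getD r 0) : countLT L.toFinset v + r < L.length := by
  rw [countLT_toFinset (hL.imp ne_of_gt)]
  nth_rw 1 [← List.take_append_drop (r + 1) L]
  have h : (L.take (r + 1)).countP (· < v) = 0 := by
    refine List.countP_eq_zero.2 fun x hx => ?_
    obtain ⟨k, hk, rfl⟩ := List.getElem_of_mem hx
    rw [List.length_take] at hk
    rw [List.getElem_take, decide_eq_true_eq, not_lt]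
    rw [List.getD_eq_getElem _ _ hr] at hv
    rcases Nat.lt_or_ge k r with hk₀ | hk₀
    · exact hv.trans (List.pairwise_iff_getElem.1 hL k r (by omega) hr hk₀).le
    · obtain rfl : k = r := by omega
      exact hv
  have h' := List.countP_le_length (p := fun x => decide (x < v)) (l := L.drop (r + 1))
  rw [List.length_drop] at h'
  rw [List.countP_append, h]
  omega

/-- At most `f v` letters are chosen below `v`, and after that at most all letters of `C` from `v`
up to `w`. -/
theorem pickCount_add_le {C : Finset ℕ} {f : ℕ → ℕ} {v w : ℕ} (h : v ≤ w) :
    pickCount (C.sort (· ≥ ·)) f w + countLT C v ≤ f v + countLT C w := by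
  induction w, h using Nat.le_induction with
  | base => exact Nat.add_le_add_right (pickCount_le v) _
  | succ w h ih =>
    rw [pickCount_succ, countLT_succ]
    simp only [Finset.mem_sort]
    omega

/-- If the left key has full columns, the columns form a reverse semistandard tableau. -/
theorem isChain_map_sort {b : List (Finset ℕ)} {N : ℕ}
    (hc : (b.map Finset.card).IsChain (· ≥ ·)) (h : ∀ k, (b.getD k ∅).card ≤ setCount b k N) :
    (b.map fun C => C.sort (· ≥ ·)).IsChain fun C D =>
      D.length ≤ C.length ∧ ∀ r < D.length, D.getD r 0 ≤ C.getD r 0 := by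
  induction b with
  | nil => exact List.IsChain.nil
  | cons C b ih =>
    cases b with
    | nil => exact List.IsChain.singleton _
    | cons D b =>
      rw [List.map_cons, List.map_cons, List.isChain_cons_cons] at hc
      rw [List.map_cons, List.map_cons, List.isChain_cons_cons]
      refine ⟨⟨by simpa using hc.1, fun r hr => ?_⟩,
        ih hc.2 fun k => (h (k + 1)).trans (pickCount_le N)⟩
      have hCs := (Finset.sortedGT_sort C).pairwise
      have hDs := (Finset.sortedGT_sort D).pairwise
      have hlen : (D.sort (· ≥ ·)).length ≤ (C.sort (· ≥ ·)).length := by simpa using hc.1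
      by_contra! hlt
      -- Let `v` be the offending entry of `D`. At most `countLT D v` letters of `C` are chosen
      -- below `v`, and `C` has at most `r` letters from `v` on, so fewer than `D.card` letters are
      -- chosen in all.
      have h₁ := countLT_add_of_lt hCs (by omega) hlt
      have h₂ := countLT_add_le_of_le hDs hr le_rfl
      rw [Finset.sort_toFinset, Finset.length_sort] at h₁ h₂
      have h₃ : D.card ≤ pickCount (C.sort (· ≥ ·)) (countLT D) N := h 1
      have h₅ := countLT_le_card C N
      set v := (D.sort (· ≥ ·)).getD r 0
      rcases Nat.le_total v N with hv | hv
      · have h₄ := pickCount_add_le (C := C) (f := countLT D) hv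
        omega
      · have h₄ := pickCount_le (C := C.sort (· ≥ ·)) (f := countLT D) N
        have h₆ := countLT_mono D hv
        omega

/-- The columns of the right key as sets. -/
def keyColumns (P : Tableau) : List (Finset ℕ) := (List.range P.length).map (keyset P)

theorem map_card_keyColumns {P : Tableau} (hP : IsReducedDecreasing P) :
    (keyColumns P).map Finset.card = colLengths P := by
  refine List.ext_getElem (by simp [keyColumns, colLengths]) fun k hk hk' => ?_
  rw [← List.getD_eq_getElem _ 0 hk', ← card_keyset hP]
  simp [keyColumns]

theorem getD_keyColumns {P : Tableau} (hP : IsReducedDecreasing P) (k : ℕ) :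
    (keyColumns P).getD k ∅ = keyset P k := by
  by_cases hk : k < P.length
  · rw [List.getD_eq_getElem _ _ (by simpa [keyColumns] using hk)]
    simp [keyColumns]
  · have hl : (keyColumns P).length ≤ k := by simpa [keyColumns] using hk
    rw [List.getD_eq_default _ _ hl, eq_comm, ← Finset.card_eq_zero, card_keyset hP,
      List.getD_eq_default _ _ (by simpa [colLengths] using hk)]

theorem isNested_keyColumns (P : Tableau) : IsNested (keyColumns P) := by
  refine List.pairwise_map.2 (List.pairwise_lt_range.imp fun h => ?_)
  exact keyset_antitone P h.le

theorem zero_notMem_keyColumns {P : Tableau} (hP : IsReducedDecreasing P) :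
    ∀ C ∈ keyColumns P, 0 ∉ C := by
  intro C hC h₀
  obtain ⟨k, -, rfl⟩ := List.mem_map.1 hC
  exact (hP.2.1 0 (mem_word_of_mem_keyset h₀)).ne rfl

theorem wt_map_sort (S : List (Finset ℕ)) (v : ℕ) :
    wt (S.map fun C => C.sort (· ≥ ·)) v = S.countP (v ∈ ·) := by
  rw [wt, Multiset.toFinsupp_apply, Multiset.coe_count]
  induction S with
  | nil => rfl
  | cons C S ih =>
    rw [List.map_cons, List.flatten_cons, List.count_append, ih, List.countP_cons, add_comm]
    congr 1
    rw [(Finset.sort_nodup C (· ≥ ·)).count]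
    simp

theorem demazure_wt_rightKey {P : Tableau} (hP : IsReducedDecreasing P) :
    demazure (wt (rightKey P)) = ∑ b ∈ dominating (keyColumns P), columnsWeight b := by
  refine IsDemazure.eq_sum (exists_isDemazure _).choose_spec (isNested_keyColumns P)
    (zero_notMem_keyColumns hP) fun v => ?_
  rw [← wt_map_sort, rightKey_eq, keyColumns, List.map_map]
  rfl

/-- That `b` is semistandard need not be assumed: domination makes every column of its left key
full, and this gives the row condition by `isChain_map_sort`. -/
theorem isDominating_keyColumns_iff {P : Tableau} (hP : IsReducedDecreasing P)
    {b : List (Finset ℕ)} : IsDominating (keyColumns P) b ↔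
      IsRSSYT (b.map fun C => C.sort (· ≥ ·)) ∧
        colLengths P = colLengths (b.map fun C => C.sort (· ≥ ·)) ∧
        KeyBound P (b.map fun C => C.sort (· ≥ ·)) := by
  have hcol : colLengths (b.map fun C => C.sort (· ≥ ·)) = b.map Finset.card := by
    simp [colLengths, Function.comp_def]
  have hkey : KeyBound P (b.map fun C => C.sort (· ≥ ·)) ↔
      ∀ k v, countLT ((keyColumns P).getD k ∅) v ≤ setCount b k v := by
    simp only [KeyBound, leftCount_map_sort, getD_keyColumns hP]
  rw [hcol, hkey]
  constructor
  · intro h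
    have hcard : b.map Finset.card = colLengths P := h.card.trans (map_card_keyColumns hP)
    refine ⟨⟨fun C hC => ?_, ?_⟩, hcard.symm, h.le⟩
    · obtain ⟨D, hD, rfl⟩ := List.mem_map.1 hC
      refine ⟨?_, fun x hx => Nat.pos_of_ne_zero ?_, (Finset.sortedGT_sort D).pairwise⟩
      · have : D.card ∈ colLengths P := hcard ▸ List.mem_map_of_mem hD
        obtain ⟨C, hC, he⟩ := List.mem_map.1 this
        have := List.length_pos_of_ne_nil (hP.1.1 C hC).1
        rw [ne_eq, ← List.length_eq_zero_iff, Finset.length_sort]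
        omega
      · rintro rfl
        exact h.pos D hD (by simpa using hx)
    · obtain ⟨N, hN⟩ := exists_forall_lt (keyColumns P)
      refine isChain_map_sort (N := N) ?_ fun k => ?_
      · rw [hcard, colLengths, List.isChain_map]
        exact hP.1.2.imp fun _ _ h => h.1
      · rw [card_getD h.card, ← countLT_eq_card (v := N)]
        · exact h.le k N
        · rcases getD_empty_mem_or (keyColumns P) k with hm | he
          · exact hN _ hm
          · rw [he]; simp
  · rintro ⟨h₁, h₂, h₃⟩
    refine ⟨by rw [map_card_keyColumns hP, h₂], fun C hC h₀ => ?_, h₃⟩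
    exact ((h₁.1 _ (List.mem_map_of_mem hC)).2.1 0 (by simpa using h₀)).ne rfl

theorem map_sort_map_toFinset {Q : Tableau} (hQ : ∀ C ∈ Q, C.Pairwise (· > ·)) :
    (Q.map List.toFinset).map (fun C => C.sort (· ≥ ·)) = Q := by
  rw [List.map_map]
  refine (List.map_congr_left fun C hC => ?_).trans (List.map_id Q)
  exact sorted_ext (Finset.sortedGT_sort _).pairwise (hQ C hC) (by simp)

open MvPolynomial in
theorem columnsWeight_map_toFinset {Q : Tableau} (hQ : ∀ C ∈ Q, C.Pairwise (· > ·)) :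
    columnsWeight (Q.map List.toFinset) =
      (Q.flatten.map fun v => (X v : MvPolynomial ℕ ℤ)).prod := by
  induction Q with
  | nil => rfl
  | cons C Q ih =>
    rw [List.map_cons, columnsWeight_cons, ih fun D hD => hQ D (List.mem_cons_of_mem _ hD),
      List.flatten_cons, List.map_append, List.prod_append,
      List.prod_toFinset _ ((hQ C List.mem_cons_self).imp ne_of_gt)]

/-- `factRSK` carries the bounded factorizations of `w` to the pairs of a tableau `P` for `w` and a
`Q` dominating the right key of `P`. The monomial of the indices is the weight of `Q`, so the fibre
over `P` contributes its Demazure character. -/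
theorem schubert_eq_sum_demazure (w : Equiv.Perm ℕ) (hw : InSymPlus w) :
    schubert w hw = ∑ᶠ P ∈ reducedTableaux w, demazure (wt (rightKey P)) := by
  obtain ⟨n, hn, he⟩ := exists_schubert_eq w hw
  have hmem : ∀ P, P ∈ (finite_reducedTableaux hw).toFinset ↔ P ∈ reducedTableaux w :=
    fun P => (finite_reducedTableaux hw).mem_toFinset
  rw [he, finsum_mem_eq_finite_toFinset_sum _ (finite_reducedTableaux hw),
    Finset.sum_congr rfl fun P hP => demazure_wt_rightKey ((hmem P).1 hP).1, Finset.sum_sigma']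
  have hspec : ∀ l ∈ boundedFact n w, IsFactorization l ∧ (factRSK l).1 ∈ reducedTableaux w ∧
      ((factRSK l).2.map List.toFinset).map (fun C => C.sort (· ≥ ·)) = (factRSK l).2 := by
    intro l hl
    obtain ⟨h₁, -, -, h₄⟩ := mem_boundedFact.1 hl
    refine ⟨h₁, ⟨⟨h₁.spec.isDecreasing, h₁.spec.nilplactic.isReducedWord h₁.reduced⟩, ?_⟩,
      map_sort_map_toFinset fun C hC => (h₁.spec.isRSSYT.1 C hC).2.2⟩
    rw [← h₄]
    exact h₁.spec.nilplactic.invariants.2.1.symm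
  refine Finset.sum_nbij (fun l => ⟨(factRSK l).1, (factRSK l).2.map List.toFinset⟩) ?_ ?_ ?_ ?_
  · intro l hl
    obtain ⟨h₁, h₂, h₃⟩ := hspec l hl
    rw [Finset.mem_sigma, hmem, mem_dominating, isDominating_keyColumns_iff h₂.1, h₃]
    exact ⟨h₂, h₁.spec.isRSSYT, h₁.spec.colLengths,
      (bounded_iff_keyBound h₁).1 (mem_boundedFact.1 hl).2.1⟩
  · intro l hl l' hl' h
    obtain ⟨h₁, -, h₃⟩ := hspec l hl
    obtain ⟨h₁', -, h₃'⟩ := hspec l' hl'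
    obtain ⟨e₁, e₂⟩ := Sigma.mk.inj h
    refine factRSK_injective h₁ h₁' (Prod.ext e₁ ?_)
    rw [← h₃, ← h₃', eq_of_heq e₂]
  · rintro ⟨P, b⟩ hPb
    rw [Finset.mem_coe, Finset.mem_sigma, hmem, mem_dominating] at hPb
    obtain ⟨hP, hb⟩ := hPb
    obtain ⟨h₁, h₂, h₃⟩ := (isDominating_keyColumns_iff hP.1).1 hb
    obtain ⟨l, hl, hlPQ⟩ := factRSK_surjective hP.1 h₁ h₂
    have hperm : wordPerm (l.map Prod.fst) = w := by
      rw [← hP.2, hl.spec.nilplactic.invariants.2.1, hlPQ]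
    refine ⟨l, mem_boundedFact.2 ⟨hl, (bounded_iff_keyBound hl).2 (by rw [hlPQ]; exact h₃),
      fun q hq => hl.reduced.lt_of_inSym (by rw [hperm]; exact hn) _ (List.mem_map_of_mem hq),
      hperm⟩, ?_⟩
    beta_reduce
    rw [hlPQ]
    simp [List.map_map, Function.comp_def]
  · intro l hl
    obtain ⟨h₁, -, -⟩ := hspec l hl
    rw [columnsWeight_map_toFinset fun C hC => (h₁.spec.isRSSYT.1 C hC).2.2,
      (h₁.spec.perm.map _).prod_eq, List.map_map]
    rfl

end NilKey

open NilKey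
theorem theorem1p5 :
    -- the right nil key is well defined and agrees with the right key
    (∀ P K : Tableau, IsReducedDecreasing P → (IsRightNilKey P K ↔ K = rightKey P)) ∧
    -- Hecke insertion restricts to a bijection, with recording tableaux having singleton entries
    Set.BijOn heckeRSK boundedReducedPairs (Prod.map id toSV '' boundedReducedTableaux) ∧
    -- on compatible pairs with reduced first word it is computed by Edelman-Greene insertion
    (∀ p : List ℕ × List ℕ, IsCompatible p → IsReducedWord p.1 →
      heckeRSK p = Prod.map id toSV (egRSK p)) ∧
    -- Edelman-Greene insertion is a bijection
    Set.BijOn egRSK boundedReducedPairs boundedReducedTableaux ∧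
    -- the expansion of Schubert polynomials into Demazure characters
    (∀ (w : Equiv.Perm ℕ) (hw : InSymPlus w), (reducedTableaux w).Finite ∧
      schubert w hw = ∑ᶠ P ∈ reducedTableaux w, demazure (wt (rightKey P))) := by
  refine ⟨fun P K hP => isRightNilKey_iff hP, bijOn_heckeRSK, fun p => heckeRSK_eq, bijOn_egRSK,
    fun w hw => ⟨finite_reducedTableaux hw, schubert_eq_sum_demazure w hw⟩⟩
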